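/- Let $X$ be a $\operatorname{CAT}(0)$-cubical complex (a simply connected cubical complex whose vertex links are flag complexes) of bounded geometry (the number of edges containing a vertex is uniformly bounded), and let $P$ be a base vertex. Hyperplanes are the classes of midplanes of cubes under the equivalence relation generated by declaring two midplanes equivalent if their intersection is a midplane. For a cube $C$ let $\operatorname{Mid}(C)$ be the set of hyperplanes that cut $C$, and let $\operatorname{SAH}(C)$ be the set of hyperplanes that are disjoint from $C$, cut a cube having $C$ as a codimension-one face, and separate $C$ from $P$. For $H\in\operatorname{Mid}(C)$ let $x_H\colon C\to[0,1]$ be the affine function equal to $1$ on the codimension-one face of $C$ that $H$ separates from $P$ and to $0$ on the opposite face; the $x_H$ identify $C$ with $[0,1]^{\operatorname{Mid}(C)}$. Let $\Omega^*_{L^2}(X)=\bigoplus_C\Omega^*_{L^2}(C)$ be the Hilbert direct sum, over all cubes $C$ of $X$, of the spaces of complex square-integrable differential forms on $C$, and let $\Omega^*_0(X)$ be the algebraic direct sum of the spaces $\Omega_0^*(C)$ of forms on $C$ that are smooth up to the boundary and pull back to zero on every proper face of $C$. Let $w$ be a weight function, that is, a positive function on the set of hyperplanes. For a form $\beta$ on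 $C$ put \[ d_w\beta=d\beta+\sum_{H\in\operatorname{Mid}(C)}w(H)\,dx_H\wedge\beta,\qquad e_w\beta=\sum_{H\in\operatorname{SAH}(C)}w(H)\,e^{w(H)(x_H-1)}\,dx_H\wedge\beta , \] where the $H$-th summand of $e_w\beta$ is a form on the cube $D_H$ that is cut by $H$ and has $C$ as a codimension-one face, $\beta$ being pulled back to $D_H$ along the orthogonal projection $D_H\to C$. With $\diamond$ denoting formal adjoints, let \[ D_{\mathrm{dR}}=d_w+e_w+d_w^\diamond+e_w^\diamond \] be the unbounded operator on $\Omega^*_{L^2}(X)$ with domain $\Omega_0^*(X)$. Assume that $w$ is proper: $\{H: w(H)\le M\}$ is finite for every $M>0$. Then $D_{\mathrm{dR}}$ is essentially self-adjoint and its closure has compact resolvent. Moreover, $\Omega^*_{L^2}(X)$ has an orthonormal basis of eigenvectors of $D_{\mathrm{dR}}$ in $\Omega^*_0(X)$ such that for each basis vector $b$, with eigenvalue $\lambda\in\mathbb R$, there is a vertex $Q$ for which $b$ is supported on the cubes $C\ni Q$ with $\operatorname{Mid}(C)\subseteq\operatorname{SAH}(Q)$, and $\lambda^2$ is a sum, over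 $H\in\operatorname{SAH}(Q)$, of one term from each of the lists \[ \bigl\{\tfrac12 w(H)(1-e^{-2w(H)})\bigr\}\sqcup\bigl\{\pi^2k^2+w(H)^2: k=1,2,\dots\bigr\}. \] -/

import Mathlib

open MeasureTheory
open scoped ContDiff

noncomputable section

set_option linter.unusedSectionVars false

/-! ### Unbounded operators -/

namespace UnboundedOp

variable {E : Type*} [NormedAddCommGroup E] [InnerProductSpace ℂ E] [CompleteSpace E]

/-- A densely defined, closable operator whose closure is self-adjoint. -/
def IsEssentiallySelfAdjoint (T : E →ₗ.[ℂ] E) : Prop :=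
  Dense (T.domain : Set E) ∧ T.IsClosable ∧ IsSelfAdjoint T.closure

/-- The bounded operator `R` is the resolvent `(T - z)⁻¹`. -/
def IsResolventAt (T : E →ₗ.[ℂ] E) (z : ℂ) (R : E →L[ℂ] E) : Prop :=
  (∀ y : E, ∃ h : R y ∈ T.domain, T ⟨R y, h⟩ - z • R y = y) ∧
  ∀ x : T.domain, R (T x - z • (x : E)) = x

/-- The resolvent set is not empty, and every resolvent is a compact operator. -/
def HasCompactResolvent (T : E →ₗ.[ℂ] E) : Prop :=
  (∃ z R, IsResolventAt T z R) ∧ ∀ z R, IsResolventAt T z R → IsCompactOperator R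

end UnboundedOp

/-- The operator with domain the range of `i` that sends `i a` to `T a`. -/
def LinearPMap.ofRange {A E : Type*} [AddCommGroup A] [Module ℂ A] [AddCommGroup E] [Module ℂ E]
    (i T : A →ₗ[ℂ] E) (h : ∀ a, i a = 0 → T a = 0) : E →ₗ.[ℂ] E where
  domain := LinearMap.range i
  toFun := (LinearMap.ker i).liftQ T (fun a ha => h a ha) ∘ₗ i.quotKerEquivRange.symm.toLinearMap

theorem LinearPMap.ofRange_apply {A E : Type*} [AddCommGroup A] [Module ℂ A] [AddCommGroup E]
    [Module ℂ E] (i T : A →ₗ[ℂ] E) (h : ∀ a, i a = 0 → T a = 0) (a : A) :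
    LinearPMap.ofRange i T h ⟨i a, LinearMap.mem_range_self i a⟩ = T a := by
  have : i.quotKerEquivRange.symm ⟨i a, LinearMap.mem_range_self i a⟩ =
      (LinearMap.ker i).mkQ a := by
    rw [LinearEquiv.symm_apply_eq]; rfl
  exact congrArg ((LinearMap.ker i).liftQ T fun a ha => h a ha) this

/-! ### Differential forms on the unit cube `[0,1]^ι`

A form `∑_I f_I dx_I` is recorded by its coefficients `f_I`, where `I` runs over the subsets of the
ordered set `ι` of coordinates and `dx_I = dx_{i₁} ∧ ⋯ ∧ dx_{iₚ}` for
`I = {i₁ < ⋯ < iₚ}`. -/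

/-- Coefficient families of complex valued differential forms, of all degrees. -/
abbrev CubeForm (ι : Type*) : Type _ := Finset ι → (ι → ℝ) → ℂ

namespace CubeForm

variable {ι κ : Type*} [Fintype ι] [LinearOrder ι] [Fintype κ] [LinearOrder κ]

/-- The sign with which `dx_i` moves to its place in `dx_{J ∪ {i}}`. -/
def sgn (i : ι) (J : Finset ι) : ℂ := (-1) ^ (J.filter (· < i)).card

/-- `dx_i ∧ β`. -/
def wedge (i : ι) (β : CubeForm ι) : CubeForm ι :=
  fun J x => if i ∈ J then sgn i J * β (J.erase i) x else 0

/-- The contraction of `β` by the coordinate vector field `∂/∂x_i`. -/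
def contract (i : ι) (β : CubeForm ι) : CubeForm ι :=
  fun J x => if i ∈ J then 0 else sgn i J * β (insert i J) x

/-- The partial derivative of the coefficients in the direction `x_i`. -/
def partialD (i : ι) (β : CubeForm ι) : CubeForm ι :=
  fun J x => fderiv ℝ (β J) x (Pi.single i 1)

/-- `d_w β = dβ + ∑ i, w_i dx_i ∧ β`, where `dβ = ∑ i, dx_i ∧ ∂_i β`. -/
def dW (w : ι → ℝ) (β : CubeForm ι) : CubeForm ι :=
  ∑ i, (wedge i (partialD i β) + (w i : ℂ) • wedge i β)

/-- The formal adjoint of `d_w`. -/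
def dWAdj (w : ι → ℝ) (β : CubeForm ι) : CubeForm ι :=
  ∑ i, (-contract i (partialD i β) + (w i : ℂ) • contract i β)

/-- The pullback along the projection `[0,1]^κ → [0,1]^ι` that forgets the coordinates outside
`j(ι)`. -/
def pull (j : ι ↪ κ) (β : CubeForm ι) : CubeForm κ :=
  fun J x => if ∀ k ∈ J, ∃ a, j a = k then β (Finset.univ.filter fun a => j a ∈ J) (x ∘ j) else 0

/-- `c e^{c y} dx_i ∧ π^* β`, where `y = x_i - 1` and `π : [0,1]^κ → [0,1]^ι` is the projection. -/
def eOp (j : ι ↪ κ) (i : κ) (c : ℝ) (β : CubeForm ι) : CubeForm κ :=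
  fun J x => ((c * Real.exp (c * (x i - 1)) : ℝ) : ℂ) * wedge i (pull j β) J x

/-- The formal adjoint of `eOp` when `i` is the only coordinate outside `j(ι)`: contraction by
`∂/∂x_i` followed by integration against `c e^{c (x_i - 1)}` along the fibres of the
projection. -/
def eAdj (j : ι ↪ κ) (i : κ) (c : ℝ) (τ : CubeForm κ) : CubeForm ι :=
  fun I y => ∫ t in (0 : ℝ)..1, ((c * Real.exp (c * (t - 1)) : ℝ) : ℂ) *
    contract i τ (I.map j) (Function.extend j y fun _ => t)

/-- The open unit cube. -/
def openCube (ι : Type*) : Set (ι → ℝ) := Set.univ.pi fun _ => Set.Ioo 0 1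

/-- Lebesgue measure on the open unit cube. -/
def cubeVol (ι : Type*) [Fintype ι] : Measure (ι → ℝ) := volume.restrict (openCube ι)

/-- The Hilbert space of square-integrable forms; the `dx_I` are pointwise orthonormal. -/
abbrev L2Form (ι : Type*) [Fintype ι] : Type _ :=
  PiLp 2 fun _ : Finset ι => Lp ℂ 2 (cubeVol ι)

/-- Forms with continuous coefficients. -/
def contForm (ι : Type*) : Submodule ℂ (CubeForm ι) where
  carrier := {β | ∀ I, Continuous (β I)}
  add_mem' ha hb I := (ha I).add (hb I)
  zero_mem' _ := continuous_const
  smul_mem' c _ ha I := (ha I).const_smul c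

/-- The forms in `Ω_0^*([0,1]^ι)`: the coefficients are smooth up to the boundary (they are given
by smooth functions on `ℝ^ι`; only the restrictions to the cube matter below), and the
pullback to each face `{x_i = 0}`, `{x_i = 1}` vanishes, that is, `f_I` vanishes on the faces
`{x_i = 0}` and `{x_i = 1}` for every `i ∉ I`. -/
def smoothForm₀ (ι : Type*) [Fintype ι] : Submodule ℂ (CubeForm ι) where
  carrier := {β | (∀ I, ContDiff ℝ ∞ (β I)) ∧
    ∀ I, ∀ i ∉ I, ∀ x ∈ Set.Icc (0 : ι → ℝ) 1, (x i = 0 ∨ x i = 1) → β I x = 0}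
  add_mem' ha hb := ⟨fun I => (ha.1 I).add (hb.1 I), fun I i hi x hx h => by
    simp [ha.2 I i hi x hx h, hb.2 I i hi x hx h]⟩
  zero_mem' := ⟨fun _ => contDiff_const, fun _ _ _ _ _ _ => rfl⟩
  smul_mem' c _ ha := ⟨fun I => (ha.1 I).const_smul c, fun I i hi x hx h => by
    simp [ha.2 I i hi x hx h]⟩

/-! #### Continuity and linearity -/

theorem continuous_wedge {β : CubeForm ι} (h : ∀ I, Continuous (β I)) (i : ι) (I : Finset ι) :
    Continuous (wedge i β I) := by
  unfold wedge
  split_ifs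
  · exact continuous_const.mul (h _)
  · exact continuous_const

theorem continuous_contract {β : CubeForm ι} (h : ∀ I, Continuous (β I)) (i : ι) (I : Finset ι) :
    Continuous (contract i β I) := by
  unfold contract
  split_ifs
  · exact continuous_const
  · exact continuous_const.mul (h _)

theorem continuous_partialD {β : CubeForm ι} (h : ∀ I, ContDiff ℝ ∞ (β I)) (i : ι)
    (I : Finset ι) : Continuous (partialD i β I) :=
  ((h I).continuous_fderiv (by simp)).clm_apply continuous_const

theorem wedge_add (i : ι) (β γ : CubeForm ι) : wedge i (β + γ) = wedge i β + wedge i γ := by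
  ext J x; simp only [wedge, Pi.add_apply]; split_ifs <;> ring

theorem wedge_smul (i : ι) (c : ℂ) (β : CubeForm ι) : wedge i (c • β) = c • wedge i β := by
  ext J x; simp only [wedge, Pi.smul_apply, smul_eq_mul]; split_ifs <;> ring

theorem contract_add (i : ι) (β γ : CubeForm ι) :
    contract i (β + γ) = contract i β + contract i γ := by
  ext J x; simp only [contract, Pi.add_apply]; split_ifs <;> ring

theorem contract_smul (i : ι) (c : ℂ) (β : CubeForm ι) :
    contract i (c • β) = c • contract i β := by
  ext J x; simp only [contract, Pi.smul_apply, smul_eq_mul]; split_ifs <;> ring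

theorem pull_add (j : ι ↪ κ) (β γ : CubeForm ι) : pull j (β + γ) = pull j β + pull j γ := by
  ext J x; simp only [pull, Pi.add_apply]; split_ifs <;> simp

theorem pull_smul (j : ι ↪ κ) (c : ℂ) (β : CubeForm ι) : pull j (c • β) = c • pull j β := by
  ext J x; simp only [pull, Pi.smul_apply]; split_ifs <;> simp

theorem partialD_add (i : ι) {β γ : CubeForm ι} (hβ : ∀ I, ContDiff ℝ ∞ (β I))
    (hγ : ∀ I, ContDiff ℝ ∞ (γ I)) : partialD i (β + γ) = partialD i β + partialD i γ := by
  ext J x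
  have h1 : DifferentiableAt ℝ (β J) x := (hβ J).differentiable (by simp) x
  have h2 : DifferentiableAt ℝ (γ J) x := (hγ J).differentiable (by simp) x
  simp only [partialD, Pi.add_apply]
  rw [fderiv_add h1 h2]; rfl

theorem partialD_smul (i : ι) (c : ℂ) {β : CubeForm ι} (hβ : ∀ I, ContDiff ℝ ∞ (β I)) :
    partialD i (c • β) = c • partialD i β := by
  ext J x
  have h1 : DifferentiableAt ℝ (β J) x := (hβ J).differentiable (by simp) x
  simp only [partialD, Pi.smul_apply]
  rw [fderiv_const_smul h1]; rfl

theorem continuous_extend (j : ι ↪ κ) :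
    Continuous fun p : (ι → ℝ) × ℝ => Function.extend j p.1 fun _ => p.2 := by
  refine continuous_pi fun k => ?_
  by_cases hk : ∃ a, j a = k
  · obtain ⟨a, rfl⟩ := hk
    simp only [j.injective.extend_apply]
    exact (continuous_apply a).comp continuous_fst
  · simp only [Function.extend_apply' _ _ _ hk]
    exact continuous_snd

theorem continuous_eAdj_integrand (j : ι ↪ κ) (i : κ) (c : ℝ) {τ : CubeForm κ}
    (h : ∀ I, Continuous (τ I)) (I : Finset ι) :
    Continuous fun p : (ι → ℝ) × ℝ => ((c * Real.exp (c * (p.2 - 1)) : ℝ) : ℂ) *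
      contract i τ (I.map j) (Function.extend j p.1 fun _ => p.2) :=
  (Complex.continuous_ofReal.comp (by fun_prop)).mul
    ((continuous_contract h i _).comp (continuous_extend j))

/-- The Witten-type operator `d_w + d_w^⋄` on `Ω_0^*([0,1]^ι)`. -/
def wittenOp (w : ι → ℝ) : smoothForm₀ ι →ₗ[ℂ] contForm ι where
  toFun β := ⟨dW w β + dWAdj w β, fun I => by
    have hc : ∀ I, Continuous (β.1 I) := fun I => (β.2.1 I).continuous
    have hd := fun i => continuous_partialD β.2.1 i
    have he : (dW w β.1 + dWAdj w β.1) I = fun x =>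
        (∑ i, (wedge i (partialD i β.1) I x + (w i : ℂ) * wedge i β.1 I x)) +
          ∑ i, (-contract i (partialD i β.1) I x + (w i : ℂ) * contract i β.1 I x) := by
      ext x
      simp [dW, dWAdj, Finset.sum_apply]
    rw [he]
    exact (continuous_finsetSum _ fun i _ =>
        (continuous_wedge (hd i) i I).add (continuous_const.mul (continuous_wedge hc i I))).add
      (continuous_finsetSum _ fun i _ =>
        (continuous_contract (hd i) i I).neg.add (continuous_const.mul (continuous_contract hc i I)))⟩
  map_add' β γ := by
    ext1
    simp only [dW, dWAdj, Submodule.coe_add, partialD_add _ β.2.1 γ.2.1, wedge_add, contract_add,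
      ← Finset.sum_add_distrib]
    exact Finset.sum_congr rfl fun i _ => by simp only [smul_add]; abel
  map_smul' c β := by
    ext1
    simp only [dW, dWAdj, Submodule.coe_smul, partialD_smul _ c β.2.1, wedge_smul, contract_smul,
      RingHom.id_apply, ← Finset.sum_add_distrib, Finset.smul_sum]
    exact Finset.sum_congr rfl fun i _ => by
      simp only [smul_add, smul_neg, smul_comm c]

/-- `eOp` as a linear map. -/
def eMap (j : ι ↪ κ) (i : κ) (c : ℝ) : smoothForm₀ ι →ₗ[ℂ] contForm κ where
  toFun β := ⟨eOp j i c β, fun J => by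
    refine (Complex.continuous_ofReal.comp (by fun_prop)).mul (continuous_wedge (fun I => ?_) i J)
    unfold pull
    split_ifs
    · exact (β.2.1 _).continuous.comp (continuous_pi fun a => continuous_apply _)
    · exact continuous_const⟩
  map_add' β γ := by
    ext1; ext J x
    simp only [eOp, Submodule.coe_add, pull_add, wedge_add, Pi.add_apply, mul_add]
  map_smul' a β := by
    ext1; ext J x
    simp only [eOp, Submodule.coe_smul, pull_smul, wedge_smul, Pi.smul_apply, smul_eq_mul,
      RingHom.id_apply]
    ring

/-- `eAdj` as a linear map. -/
def eAdjMap (j : ι ↪ κ) (i : κ) (c : ℝ) : smoothForm₀ κ →ₗ[ℂ] contForm ι where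
  toFun τ := ⟨eAdj j i c τ, fun I =>
    intervalIntegral.continuous_parametric_intervalIntegral_of_continuous'
      (continuous_eAdj_integrand j i c (fun I => (τ.2.1 I).continuous) I) 0 1⟩
  map_add' σ τ := by
    ext1; ext I y
    have h : ∀ ρ : smoothForm₀ κ, IntervalIntegrable
        (fun t : ℝ => ((c * Real.exp (c * (t - 1)) : ℝ) : ℂ) *
          contract i ρ.1 (I.map j) (Function.extend j y fun _ => t)) volume 0 1 := fun ρ =>
      ((continuous_eAdj_integrand j i c (fun I => (ρ.2.1 I).continuous) I).comp
        (Continuous.prodMk_right y)).intervalIntegrable 0 1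
    simp only [eAdj, Submodule.coe_add, contract_add, Pi.add_apply, mul_add]
    exact intervalIntegral.integral_add (h σ) (h τ)
  map_smul' a τ := by
    ext1; ext I y
    simp only [eAdj, Submodule.coe_smul, contract_smul, Pi.smul_apply, smul_eq_mul,
      RingHom.id_apply, ← intervalIntegral.integral_const_mul]
    exact intervalIntegral.integral_congr fun t _ => by ring

theorem isOpen_openCube : IsOpen (openCube ι) :=
  isOpen_set_pi Set.finite_univ fun _ _ => isOpen_Ioo

theorem memLp_of_continuous {f : (ι → ℝ) → ℂ} (hf : Continuous f) : MemLp f 2 (cubeVol ι) := by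
  have hK : IsCompact (Set.Icc (0 : ι → ℝ) 1) := isCompact_Icc
  obtain ⟨M, hM⟩ := hK.exists_bound_of_continuousOn hf.continuousOn
  have hsub : openCube ι ⊆ Set.Icc (0 : ι → ℝ) 1 := fun x hx =>
    ⟨fun i => (hx i trivial).1.le, fun i => (hx i trivial).2.le⟩
  have : IsFiniteMeasure (cubeVol ι) :=
    ⟨by
      rw [cubeVol, Measure.restrict_apply_univ]
      exact (measure_mono hsub).trans_lt hK.measure_lt_top⟩
  refine MemLp.of_bound hf.aestronglyMeasurable M ?_
  exact (ae_restrict_iff' isOpen_openCube.measurableSet).2 (ae_of_all _ fun x hx => hM x (hsub hx))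

/-- The class of a form with continuous coefficients in the space of square-integrable forms. -/
def toL2 (ι : Type*) [Fintype ι] [LinearOrder ι] : contForm ι →ₗ[ℂ] L2Form ι where
  toFun β := WithLp.toLp 2 fun I => (memLp_of_continuous (β.2 I)).toLp (β.1 I)
  map_add' _ _ := rfl
  map_smul' _ _ := rfl

theorem toL2_eq_zero_iff (β : contForm ι) :
    toL2 ι β = 0 ↔ ∀ I, ∀ x ∈ openCube ι, β.1 I x = 0 := by
  have key : toL2 ι β = 0 ↔ ∀ I, (memLp_of_continuous (β.2 I)).toLp (β.1 I) = 0 := by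
    constructor
    · intro h I
      exact congrArg (fun v : L2Form ι => v I) h
    · intro h
      ext1 I
      exact h I
  rw [key]
  refine forall_congr' fun I => ?_
  rw [Lp.eq_zero_iff_ae_eq_zero]
  constructor
  · intro h
    have h' : β.1 I =ᵐ[volume.restrict (openCube ι)] 0 := (MemLp.coeFn_toLp _).symm.trans h
    exact Measure.eqOn_open_of_ae_eq h' isOpen_openCube (β.2 I).continuousOn
      continuous_const.continuousOn
  · intro h
    refine (MemLp.coeFn_toLp _).trans ?_
    exact (ae_restrict_iff' isOpen_openCube.measurableSet).2 (ae_of_all _ h)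

/-- A smooth form has continuous coefficients. -/
def smoothToCont (ι : Type*) [Fintype ι] : smoothForm₀ ι →ₗ[ℂ] contForm ι :=
  Submodule.inclusion fun _ h I => (h.1 I).continuous

theorem wittenOp_eq_zero (w : ι → ℝ) {β : smoothForm₀ ι}
    (h : ∀ I, ∀ x ∈ openCube ι, β.1 I x = 0) : toL2 ι (wittenOp w β) = 0 := by
  rw [toL2_eq_zero_iff]
  intro I x hx
  have hd : ∀ i I, partialD i β.1 I x = 0 := fun i I => by
    have : β.1 I =ᶠ[nhds x] fun _ => 0 :=
      Filter.eventually_of_mem (isOpen_openCube.mem_nhds hx) (h I)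
    simp [partialD, this.fderiv_eq]
  simp [wittenOp, dW, dWAdj, wedge, contract, hd, h _ x hx]

theorem eMap_eq_zero (j : ι ↪ κ) (i : κ) (c : ℝ) {β : smoothForm₀ ι}
    (h : ∀ I, ∀ x ∈ openCube ι, β.1 I x = 0) : toL2 κ (eMap j i c β) = 0 := by
  rw [toL2_eq_zero_iff]
  intro J x hx
  have : ∀ I, β.1 I (x ∘ j) = 0 := fun I => h I _ fun a _ => hx (j a) trivial
  simp [eMap, eOp, wedge, pull, this]

theorem eAdjMap_eq_zero (j : ι ↪ κ) (i : κ) (c : ℝ) {τ : smoothForm₀ κ}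
    (h : ∀ I, ∀ x ∈ openCube κ, τ.1 I x = 0) : toL2 ι (eAdjMap j i c τ) = 0 := by
  rw [toL2_eq_zero_iff]
  intro I y hy
  change ∫ t in (0 : ℝ)..1, ((c * Real.exp (c * (t - 1)) : ℝ) : ℂ) *
    contract i τ.1 (I.map j) (Function.extend j y fun _ => t) = 0
  rw [intervalIntegral.integral_of_le zero_le_one, integral_Ioc_eq_integral_Ioo]
  refine setIntegral_eq_zero_of_forall_eq_zero fun t ht => ?_
  have hmem : (Function.extend j y fun _ => t) ∈ openCube κ := fun k _ => by
    by_cases hk : ∃ a, j a = k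
    · obtain ⟨a, rfl⟩ := hk
      rw [j.injective.extend_apply]
      exact hy a trivial
    · rw [Function.extend_apply' _ _ _ hk]
      exact ht
  simp [contract, h _ _ hmem]

end CubeForm

/-! ### Cubical complexes -/

/-- A cubical complex, recorded by the vertex sets of its cubes. Every cube is a copy of the
standard cube `{0,1}^q` whose faces are exactly the cubes it contains, and two cubes are disjoint
or meet in a cube, which is then a common face of them. -/
structure CubicalComplex (V : Type*) where
  /-- The vertex sets of the cubes. -/
  cubes : Set (Finset V)
  singleton_mem : ∀ v, {v} ∈ cubes
  exists_chart : ∀ s ∈ cubes, ∃ (q : ℕ) (φ : (Fin q → Bool) → V), Function.Injective φ ∧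
    Set.range φ = s ∧ ∀ t ⊆ s, (t ∈ cubes ↔ ∃ (J : Finset (Fin q)) (a : Fin q → Bool),
      (t : Set V) = φ '' {x | ∀ i ∈ J, x i = a i})
  exists_inter : ∀ s ∈ cubes, ∀ t ∈ cubes, ((s : Set V) ∩ t).Nonempty →
    ∃ r ∈ cubes, (r : Set V) = (s : Set V) ∩ t

namespace CubicalComplex

variable {V : Type*} (K : CubicalComplex V)

/-- The cubes of the complex. A `q`-cube has `2 ^ q` vertices. -/
def Cube : Type _ := {s : Finset V // s ∈ K.cubes}

/-- The edges, that is, the `1`-cubes. -/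
def Edge : Type _ := {s : Finset V // s ∈ K.cubes ∧ s.card = 2}

variable {K}

/-- The vertex `v` as a `0`-cube. -/
def vertex (v : V) : K.Cube := ⟨{v}, K.singleton_mem v⟩

variable (K)

/-- The `1`-skeleton. -/
def graph : SimpleGraph V where
  Adj u v := u ≠ v ∧ ∃ e : K.Edge, u ∈ e.1 ∧ v ∈ e.1
  symm := ⟨fun _ _ h => ⟨h.1.symm, h.2.imp fun _ he => ⟨he.2, he.1⟩⟩⟩
  loopless := ⟨fun _ h => h.1 rfl⟩

/-- Homotopy of edge paths with the same end points, generated by the insertion and deletion of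
backtrackings and by the moves across squares. -/
inductive Homotopic : ∀ {u v : V}, K.graph.Walk u v → K.graph.Walk u v → Prop
  | refl {u v : V} (p : K.graph.Walk u v) : Homotopic p p
  | symm {u v : V} {p q : K.graph.Walk u v} : Homotopic p q → Homotopic q p
  | trans {u v : V} {p q r : K.graph.Walk u v} : Homotopic p q → Homotopic q r → Homotopic p r
  | cons {u v z : V} (h : K.graph.Adj u v) {p q : K.graph.Walk v z} :
      Homotopic p q → Homotopic (.cons h p) (.cons h q)
  | backtrack {u v z : V} (h : K.graph.Adj u v) (p : K.graph.Walk u z) :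
      Homotopic (.cons h (.cons h.symm p)) p
  | square {a b c d z : V} (s : Finset V) (hs : s ∈ K.cubes) (hcard : s.card = 4)
      (ha : a ∈ s) (hb : b ∈ s) (hc : c ∈ s) (hd : d ∈ s)
      (hab : K.graph.Adj a b) (hbc : K.graph.Adj b c)
      (had : K.graph.Adj a d) (hdc : K.graph.Adj d c) (p : K.graph.Walk c z) :
      Homotopic (.cons hab (.cons hbc p)) (.cons had (.cons hdc p))

/-- The complex is connected and every closed edge path is null-homotopic. -/
def IsSimplyConnected : Prop :=
  K.graph.Connected ∧ ∀ (v : V) (p : K.graph.Walk v v), K.Homotopic p .nil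

/-- The links of all vertices are flag complexes: if finitely many edges at a vertex pairwise span
squares, then together they span a cube. -/
def HasFlagLinks : Prop :=
  ∀ (v : V) (A : Finset V), (∀ a ∈ A, K.graph.Adj v a) →
    (∀ a ∈ A, ∀ b ∈ A, a ≠ b → ∃ s ∈ K.cubes, s.card = 4 ∧ v ∈ s ∧ a ∈ s ∧ b ∈ s) →
    ∃ s ∈ K.cubes, v ∈ s ∧ A ⊆ s ∧ s.card = 2 ^ A.card

/-- A `CAT(0)` cubical complex: it is simply connected and its links are flag complexes. -/
def IsCAT0 : Prop := K.IsSimplyConnected ∧ K.HasFlagLinks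

/-- There is a uniform bound on the number of edges that contain a given vertex. -/
def HasBoundedGeometry : Prop :=
  ∃ N : ℕ, ∀ v : V, {e : K.Edge | v ∈ e.1}.encard ≤ N

/-- Two edges are opposite edges of a square. -/
def Opposite (e e' : K.Edge) : Prop :=
  ∃ s ∈ K.cubes, s.card = 4 ∧ e.1 ⊆ s ∧ e'.1 ⊆ s ∧ Disjoint e.1 e'.1

/-- The hyperplanes. A hyperplane is recorded by the edges that it cuts; these form a class of the
equivalence relation generated by `Opposite`, since the edges cut by a midplane of a cube are
parallel, and two midplanes meet in a midplane precisely when they cut a common edge. -/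
def Hyperplane : Type _ := Quot K.Opposite

variable {K}

/-- The set `Mid(C)` of the hyperplanes that cut the cube `C`. -/
def Mid (C : K.Cube) : Set K.Hyperplane :=
  {H | ∃ e : K.Edge, e.1 ⊆ C.1 ∧ Quot.mk _ e = H}

/-- The edge paths that do not cross `H`: two vertices lie in the same component of the complement
of `H` if they are connected in this graph. -/
def avoid (H : K.Hyperplane) : SimpleGraph V where
  Adj u v := u ≠ v ∧ ∃ e : K.Edge, u ∈ e.1 ∧ v ∈ e.1 ∧ Quot.mk _ e ≠ H
  symm := ⟨fun _ _ h => ⟨h.1.symm, h.2.imp fun _ he => ⟨he.2.1, he.1, he.2.2⟩⟩⟩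
  loopless := ⟨fun _ h => h.1 rfl⟩

/-- `C` is a codimension-one face of `D`. -/
def IsFacet (C D : K.Cube) : Prop := C.1 ⊆ D.1 ∧ D.1.card = 2 * C.1.card

/-- `H` is adjacent to `C`: it is disjoint from `C`, but meets a cube that has `C` as a
codimension-one face. -/
def IsAdjacent (H : K.Hyperplane) (C : K.Cube) : Prop :=
  H ∉ Mid C ∧ ∃ D : K.Cube, IsFacet C D ∧ H ∈ Mid D

/-- `H` separates the cube `C` from the vertex `P`. -/
def Separates (H : K.Hyperplane) (C : K.Cube) (P : V) : Prop :=
  H ∉ Mid C ∧ ∀ v ∈ C.1, ¬ (avoid H).Reachable v P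

/-- The set `SAH(C)` of the hyperplanes that are adjacent to `C` and separate `C` from the base
vertex `P`. -/
def SAH (P : V) (C : K.Cube) : Set K.Hyperplane := {H | IsAdjacent H C ∧ Separates H C P}

/-- The cube `C` leads the vertex `Q` to the base vertex `P`. -/
def Leads (P Q : V) (C : K.Cube) : Prop := Q ∈ C.1 ∧ Mid C ⊆ SAH P (vertex Q)

/-- A weight function: a positive function on the set of hyperplanes. -/
def IsWeight (w : K.Hyperplane → ℝ) : Prop := ∀ H, 0 < w H

/-- The weight function is proper. -/
def IsProperWeight (w : K.Hyperplane → ℝ) : Prop := ∀ M : ℝ, 0 < M → {H | w H ≤ M}.Finite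

/-! ### Differential forms on a cubical complex

In a `CAT(0)` cubical complex with base vertex `P`, a cube `C` is identified with `[0,1]^{Mid(C)}`
by the coordinates `x_H`, `H ∈ Mid(C)`: the affine function `x_H` is `0` on the codimension-one
face of `C` that `H` does not cut and does not separate from `P`, and `1` on the opposite face,
which `H` separates from `P`. For a face `C` of `D`, the orthogonal projection from `D` to `C`
then forgets the coordinates `x_H` with `H ∉ Mid(C)`. -/

/-- An auxiliary linear order on the hyperplanes, used only to write forms in coordinates. -/
instance : LinearOrder K.Hyperplane :=
  (WellOrderingRel.isWellOrder (α := K.Hyperplane)).linearOrder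

/-- The coordinates of the cube `C`. -/
abbrev Dir (C : K.Cube) : Type _ := ↥(Mid C)

theorem finite_mid (C : K.Cube) : (Mid C).Finite := by
  have hf : {e : K.Edge | e.1 ⊆ C.1}.Finite := by
    refine Set.Finite.of_finite_image (f := fun e : K.Edge => e.1) ?_ Subtype.val_injective.injOn
    refine (C.1.powerset.finite_toSet).subset ?_
    rintro _ ⟨e, he, rfl⟩
    exact Finset.mem_coe.2 (Finset.mem_powerset.2 he)
  exact (hf.image fun e => Quot.mk K.Opposite e).subset fun _ ⟨e, he, h⟩ => ⟨e, he, h⟩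

instance (C : K.Cube) : Fintype (Dir C) := (finite_mid C).fintype

/-- The hyperplanes that cut a face cut the cube. -/
def dirIncl {C D : K.Cube} (h : C.1 ⊆ D.1) : Dir C ↪ Dir D where
  toFun a := ⟨a.1, a.2.imp fun _ he => ⟨he.1.trans h, he.2⟩⟩
  inj' _ _ hab := Subtype.ext (congrArg (fun b : Dir D => b.1) hab)

/-- A triple `(C, H, D)` where `H ∈ SAH(C)` and `D = D_H` is a cube that is cut by `H` and has `C`
as a codimension-one face. -/
structure Step (P : V) (C D : K.Cube) where
  /-- The hyperplane. -/
  H : K.Hyperplane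
  mem_sah : H ∈ SAH P C
  mem_mid : H ∈ Mid D
  facet : IsFacet C D

variable (K)

/-- The Hilbert space `Ω_{L²}^*(X)`: the Hilbert sum of the spaces of square-integrable forms on the
cubes. -/
abbrev L2Forms : Type _ := lp (fun C : K.Cube => CubeForm.L2Form (Dir C)) 2

/-- The algebraic direct sum of the spaces `Ω_0^*(C)`. -/
abbrev Smooth₀ : Type _ := DirectSum K.Cube fun C => CubeForm.smoothForm₀ (Dir C)

variable {K}

open Classical in
/-- The inclusion of the square-integrable forms on a cube `C`, extended by zero. -/
def onCube (C : K.Cube) : CubeForm.contForm (Dir C) →ₗ[ℂ] K.L2Forms :=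
  lp.lsingle 2 C ∘ₗ CubeForm.toL2 (Dir C)

open Classical in
/-- The map from `Ω_0^*(X)` to `Ω_{L²}^*(X)`. -/
def smoothToL2 : K.Smooth₀ →ₗ[ℂ] K.L2Forms :=
  DirectSum.toModule ℂ K.Cube K.L2Forms fun C =>
    onCube C ∘ₗ CubeForm.smoothToCont (Dir C)

/-- `d_w + d_w^⋄` on the forms on `C`. -/
def wittenOn (w : K.Hyperplane → ℝ) (C : K.Cube) :
    CubeForm.smoothForm₀ (Dir C) →ₗ[ℂ] K.L2Forms :=
  onCube C ∘ₗ CubeForm.wittenOp fun H : Dir C => w H.1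

/-- `e_w` on the forms on `C`: the sum over `H ∈ SAH(C)` of `w(H) e^{w(H) y_H} α_H ∧ β` on the
cube `D_H`. The sum is finite for a complex of bounded geometry. -/
def eOn (P : V) (w : K.Hyperplane → ℝ) (C : K.Cube) :
    CubeForm.smoothForm₀ (Dir C) →ₗ[ℂ] K.L2Forms :=
  ∑ᶠ s : (Σ D : K.Cube, Step P C D),
    onCube s.1 ∘ₗ CubeForm.eMap (dirIncl s.2.facet.1) ⟨s.2.H, s.2.mem_mid⟩ (w s.2.H)

/-- The formal adjoint `e_w^⋄` of `e_w` on the forms on `D`. The sum is finite, since a cube has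
finitely many faces and is cut by finitely many hyperplanes. -/
def eAdjOn (P : V) (w : K.Hyperplane → ℝ) (D : K.Cube) :
    CubeForm.smoothForm₀ (Dir D) →ₗ[ℂ] K.L2Forms :=
  ∑ᶠ s : (Σ C : K.Cube, Step P C D),
    onCube s.1 ∘ₗ CubeForm.eAdjMap (dirIncl s.2.facet.1) ⟨s.2.H, s.2.mem_mid⟩ (w s.2.H)

open Classical in
/-- The formula `d_w + e_w + d_w^⋄ + e_w^⋄` on `Ω_0^*(X)`. -/
def deRhamMap (P : V) (w : K.Hyperplane → ℝ) : K.Smooth₀ →ₗ[ℂ] K.L2Forms :=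
  DirectSum.toModule ℂ K.Cube K.L2Forms fun C => wittenOn w C + eOn P w C + eAdjOn P w C

theorem finsum_apply_eq_zero {A E ι : Type*} [AddCommGroup A] [Module ℂ A] [AddCommGroup E]
    [Module ℂ E] (f : ι → A →ₗ[ℂ] E) (a : A) (h : ∀ i, f i a = 0) : (∑ᶠ i, f i) a = 0 := by
  classical
  rw [finsum_def]
  split_ifs
  · simp [LinearMap.sum_apply, h]
  · rfl

open Classical in
theorem smoothToL2_apply (β : K.Smooth₀) (C : K.Cube) :
    smoothToL2 β C = CubeForm.toL2 (Dir C) (CubeForm.smoothToCont (Dir C) (β C)) := by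
  induction β using DirectSum.induction_on with
  | zero => simp
  | of D x =>
    change smoothToL2 (DirectSum.lof ℂ K.Cube _ D x) C = _
    rw [smoothToL2, DirectSum.toModule_lof]
    by_cases h : C = D
    · subst h
      change lp.single 2 C _ C = _
      rw [lp.single_apply_self, DirectSum.of_eq_same]
    · change lp.single 2 D _ C = _
      rw [lp.single_apply_ne _ _ _ h, DirectSum.of_eq_of_ne _ _ _ h]
      simp
  | add x y hx hy =>
    rw [map_add, lp.coeFn_add, Pi.add_apply, hx, hy, DirectSum.add_apply, map_add, map_add]

theorem deRhamMap_eq_zero (P : V) (w : K.Hyperplane → ℝ) (β : K.Smooth₀)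
    (hβ : smoothToL2 β = 0) : deRhamMap P w β = 0 := by
  classical
  have h0 : ∀ C : K.Cube, ∀ I, ∀ x ∈ CubeForm.openCube (Dir C), (β C).1 I x = 0 := fun C =>
    (CubeForm.toL2_eq_zero_iff (CubeForm.smoothToCont (Dir C) (β C))).1
      (by rw [← smoothToL2_apply, hβ]; rfl)
  rw [← DirectSum.sum_support_of β, map_sum]
  refine Finset.sum_eq_zero fun C _ => ?_
  change deRhamMap P w (DirectSum.lof ℂ K.Cube _ C (β C)) = 0
  rw [deRhamMap, DirectSum.toModule_lof]
  have hE : ∀ {D : K.Cube} {γ : CubeForm.contForm (Dir D)}, CubeForm.toL2 _ γ = 0 →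
      onCube D γ = 0 := fun h => by simp [onCube, h]
  have h1 : wittenOn w C (β C) = 0 := hE (CubeForm.wittenOp_eq_zero _ (h0 C))
  have h2 : eOn P w C (β C) = 0 :=
    finsum_apply_eq_zero _ _ fun s => hE (CubeForm.eMap_eq_zero _ _ _ (h0 C))
  have h3 : eAdjOn P w C (β C) = 0 :=
    finsum_apply_eq_zero _ _ fun s => hE (CubeForm.eAdjMap_eq_zero _ _ _ (h0 C))
  rw [LinearMap.add_apply, LinearMap.add_apply, h1, h2, h3, add_zero, add_zero]

/-- The operator `D_dR = d_w + e_w + d_w^⋄ + e_w^⋄` on `Ω_{L²}^*(X)` with domain `Ω_0^*(X)`. -/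
def deRham (P : V) (w : K.Hyperplane → ℝ) : K.L2Forms →ₗ.[ℂ] K.L2Forms :=
  LinearPMap.ofRange (A := K.Smooth₀) (E := K.L2Forms) smoothToL2 (deRhamMap P w) (deRhamMap_eq_zero P w)

/-- The block `Ω_{L²}^*(X)_Q`: the forms that are supported on the cubes that lead `Q` to `P`. -/
def block (P Q : V) : Submodule ℂ K.L2Forms where
  carrier := {φ | ∀ C : K.Cube, ¬ Leads P Q C → φ C = 0}
  add_mem' ha hb C hC := by simp [ha C hC, hb C hC]
  zero_mem' _ _ := rfl
  smul_mem' c _ ha C hC := by simp [ha C hC]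

/-- The `k`-th scalar in the list `½ c (1 - e^{-2c}), π² + c², 4π² + c², 9π² + c², …`. -/
def intervalEigenvalueSq (c : ℝ) (k : ℕ) : ℝ :=
  if k = 0 then c * (1 - Real.exp (-2 * c)) / 2 else Real.pi ^ 2 * k ^ 2 + c ^ 2

end CubicalComplex

end

open MeasureTheory
open scoped ContDiff

noncomputable section

set_option linter.unusedSectionVars false

/-! ### Charts of cubes -/

namespace CubicalComplex

open scoped symmDiff

variable {V : Type*} {K : CubicalComplex V}

/-! Every cube has exactly one vertex `Q` farthest from `P`, and all hyperplanes that cut the cube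
then lie in SAH(`Q`); conversely each subset of SAH(`Q`) is the set `Mid C` of exactly one cube `C`
at `Q`. So the cubes fall into blocks indexed by the vertices, and all four summands of the operator
preserve the blocks. The block of `Q` is a tensor product, over `H` in SAH(`Q`), of one-dimensional
models: a copy of ℂ (for `H` not cutting the cube) plus the forms on [0,1] (for `H` cutting it).

In the model of weight `c`, the operator pairs 1 with c e^{c(t-1)} dt through `e_w`, and sin kπt
with (kπ cos kπt + c sin kπt) dt through `d_w`. The squares are the scalars of the list, and these
vectors form a complete orthogonal family. In the product, fix `Q` and a mode for each hyperplane.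
The product forms, indexed by the sets `I` of directions of the differentials, span a
finite-dimensional space on which the operator is a sum of anticommuting pieces, one for each `H`,
which adds `H` to `I` or removes it. Hence its square is the sum of the scalars
(`exists_mem_graph_of_mem_blockSpan`).

These spaces are orthogonal with dense span (`inner_blockForm_eq_zero`, `eq_top_of_blockForm_mem`).
Only finitely many have scalar below a given bound, because properness leaves finitely many
hyperplanes and modes, and `Q` is determined by SAH(`Q`) (`finite_sum_intervalEigenvalueSq_le`). The
operator is symmetric, so diagonalization in each space yields all the claims
(`UnboundedOp.exists_eigenbasis_of_blocks`).

The combinatorics comes directly from simple connectivity and flag links. Edge paths are taken up to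
moves across squares. Flag links make these moves confluent (`fork_of_eqv`), so walks act on reduced
paths; simple connectivity then makes any two reduced paths with the same ends equivalent
(`PathFrom.eqv_of_reduced`). This gives a bipartite 1-skeleton with the quadrangle condition, from
which the two sides of a hyperplane (`IsCAT0.side_ne_iff`) and the blocks (`IsCAT0.exists_cube`,
`IsCAT0.leads_unique`) are obtained. -/

theorem empty_symmDiff_finset {α : Type*} [DecidableEq α] (X : Finset α) : ∅ ∆ X = X :=
  bot_symmDiff X

/-- A parametrization of the vertices of a cube by the subsets of a finite set of directions, the
vertex `v` corresponding to the empty set. -/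
structure CubeChart (K : CubicalComplex V) (s : Finset V) (v : V) where
  /-- The dimension. -/
  q : ℕ
  /-- The parametrization. -/
  ψ : Finset (Fin q) → V
  inj : Function.Injective ψ
  mem_iff : ∀ x, x ∈ s ↔ ∃ X, ψ X = x
  base : ψ ∅ = v
  face_iff : ∀ t ⊆ s, (t ∈ K.cubes ↔ ∃ M A : Finset (Fin q), ∀ x, x ∈ t ↔ ∃ X ⊆ M, x = ψ (X ∆ A))

/-- Taking the coordinatewise xor with the coordinates of `v` moves `v` to the empty set. A face,
given by fixing some coordinates, becomes a translate `X ∆ A` of a power set, where `M` is the set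
of free directions. -/
theorem nonempty_cubeChart {s : Finset V} (hs : s ∈ K.cubes) {v : V} (hv : v ∈ s) :
    Nonempty (CubeChart K s v) := by
  classical
  obtain ⟨q, φ, hφ, hr, hf⟩ := K.exists_chart s hs
  obtain ⟨x0, hx0⟩ : v ∈ Set.range φ := by rw [hr]; exact hv
  let T : Finset (Fin q) → (Fin q → Bool) := fun X i => xor (x0 i) (decide (i ∈ X))
  have hT : Function.Injective T := by
    intro X Y h
    ext i
    have := congrFun h i
    simp only [T] at this
    cases h0 : x0 i <;> simp [h0] at this <;> tauto
  let U : (Fin q → Bool) → Finset (Fin q) := fun x => Finset.univ.filter fun i => x i ≠ x0 i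
  have hU : ∀ x, T (U x) = x := by
    intro x
    funext i
    simp only [T, U, Finset.mem_filter, Finset.mem_univ, true_and]
    cases x i <;> cases x0 i <;> simp
  refine ⟨⟨q, φ ∘ T, hφ.comp hT, ?_, ?_, ?_⟩⟩
  · intro x
    have : x ∈ s ↔ x ∈ Set.range φ := by rw [hr]; exact Iff.rfl
    rw [this]
    constructor
    · rintro ⟨y, rfl⟩
      exact ⟨U y, by simp [hU]⟩
    · rintro ⟨X, rfl⟩
      exact ⟨_, rfl⟩
  · simp only [Function.comp, T, ← hx0]
    congr 1
    funext i
    simp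
  · intro t ht
    rw [hf t ht]
    constructor
    · rintro ⟨J, a, h⟩
      refine ⟨Jᶜ, U a, fun x => ?_⟩
      rw [← Finset.mem_coe, h]
      constructor
      · rintro ⟨y, hy, rfl⟩
        refine ⟨U y ∆ U a, ?_, ?_⟩
        · intro i hi
          rw [Finset.mem_compl]
          intro hiJ
          have := hy i hiJ
          simp [Finset.mem_symmDiff, U, this] at hi
        · simp [symmDiff_symmDiff_cancel_right, hU]
      · rintro ⟨X, hX, rfl⟩
        refine ⟨T (X ∆ U a), ?_, rfl⟩
        intro i hi
        have h1 : i ∉ X := fun h => by simpa [hi] using hX h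
        simp only [T, Finset.mem_symmDiff, h1, U, Finset.mem_filter, Finset.mem_univ, true_and]
        cases a i <;> cases x0 i <;> simp
    · rintro ⟨M, A, h⟩
      refine ⟨Mᶜ, T A, ?_⟩
      ext x
      rw [Finset.mem_coe, h]
      constructor
      · rintro ⟨X, hX, rfl⟩
        refine ⟨T (X ∆ A), fun i hi => ?_, rfl⟩
        have h1 : i ∉ X := fun h => by simpa using (Finset.mem_compl.1 hi) (hX h)
        simp [T, Finset.mem_symmDiff, h1]
      · rintro ⟨y, hy, rfl⟩
        refine ⟨U y ∆ A, ?_, ?_⟩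
        · intro i hi
          by_contra hiM
          have := hy i (Finset.mem_compl.2 hiM)
          rw [Finset.mem_symmDiff] at hi
          simp only [U, Finset.mem_filter, Finset.mem_univ, true_and, this, T] at hi
          by_cases h2 : i ∈ A <;> simp [h2] at hi
        · simp [symmDiff_symmDiff_cancel_right, hU]

namespace CubeChart

variable {s : Finset V} {v : V} (c : CubeChart K s v)

theorem mem (X : Finset (Fin c.q)) : c.ψ X ∈ s := (c.mem_iff _).2 ⟨X, rfl⟩

theorem card_eq : s.card = 2 ^ c.q := by
  classical
  have : s = Finset.univ.image c.ψ := by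
    ext x; simp [c.mem_iff]
  have h2 := congrArg Finset.card this
  rw [Finset.card_image_of_injective _ c.inj] at h2
  simpa using h2

theorem exists_face (M A : Finset (Fin c.q)) : ∃ t ∈ K.cubes, t ⊆ s ∧ t.card = 2 ^ M.card ∧
    ∀ x, x ∈ t ↔ ∃ X ⊆ M, x = c.ψ (X ∆ A) := by
  classical
  have hi : Function.Injective fun X : Finset (Fin c.q) => c.ψ (X ∆ A) :=
    c.inj.comp (symmDiff_left_injective A)
  have hm : ∀ x, x ∈ M.powerset.image (fun X => c.ψ (X ∆ A)) ↔ ∃ X ⊆ M, x = c.ψ (X ∆ A) := by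
    intro x; simp [eq_comm]
  have hsub : M.powerset.image (fun X => c.ψ (X ∆ A)) ⊆ s := by
    intro x hx
    obtain ⟨X, _, rfl⟩ := (hm x).1 hx
    exact c.mem _
  refine ⟨M.powerset.image fun X => c.ψ (X ∆ A), (c.face_iff _ hsub).2 ⟨M, A, hm⟩, hsub, ?_, hm⟩
  rw [Finset.card_image_of_injective _ hi, Finset.card_powerset]

theorem exists_edge (X : Finset (Fin c.q)) (i : Fin c.q) :
    ∃ e : K.Edge, e.1 ⊆ s ∧ c.ψ X ∈ e.1 ∧ c.ψ (X ∆ {i}) ∈ e.1 := by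
  obtain ⟨t, ht, hts, hc, hm⟩ := c.exists_face {i} X
  refine ⟨⟨t, ht, by simpa using hc⟩, hts, (hm _).2 ⟨∅, by simp, by rw [empty_symmDiff_finset]⟩, (hm _).2 ⟨{i}, by simp, ?_⟩⟩
  rw [symmDiff_comm]

theorem ne_symmDiff_singleton (X : Finset (Fin c.q)) (i : Fin c.q) : X ≠ X ∆ {i} := by
  intro h
  have := congrArg (X ∆ ·) h
  simp at this

theorem adj_symmDiff (X : Finset (Fin c.q)) (i : Fin c.q) :
    K.graph.Adj (c.ψ X) (c.ψ (X ∆ {i})) := by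
  obtain ⟨e, _, h1, h2⟩ := c.exists_edge X i
  exact ⟨fun h => c.ne_symmDiff_singleton X i (c.inj h), e, h1, h2⟩

end CubeChart

/-! ### Edges, squares, and the 3-cube supplied by the flag condition -/

theorem edge_eq {e e' : K.Edge} {u v : V} (h : u ≠ v) (hu : u ∈ e.1) (hv : v ∈ e.1)
    (hu' : u ∈ e'.1) (hv' : v ∈ e'.1) : e = e' := by
  classical
  have key : ∀ f : K.Edge, u ∈ f.1 → v ∈ f.1 → f.1 = {u, v} := fun f h1 h2 => by
    refine (Finset.eq_of_subset_of_card_le ?_ ?_).symm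
    · intro x hx; simp at hx; rcases hx with rfl | rfl <;> assumption
    · rw [f.2.2, Finset.card_pair h]
  exact Subtype.ext ((key e hu hv).trans (key e' hu' hv').symm)

theorem edge_mem_iff {e : K.Edge} {u v : V} (h : u ≠ v) (hu : u ∈ e.1) (hv : v ∈ e.1) (x : V) :
    x ∈ e.1 ↔ x = u ∨ x = v := by
  classical
  have : e.1 = {u, v} := by
    refine (Finset.eq_of_subset_of_card_le ?_ ?_).symm
    · intro x hx; simp at hx; rcases hx with rfl | rfl <;> assumption
    · rw [e.2.2, Finset.card_pair h]
  simp [this]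

/-- The edge is a face of the cube, a translate of the power set of some `M`. Its two ends differ in
some direction `i` of `M`, so the face also contains the first end with only `i` changed; an edge
has no third vertex. -/
theorem CubeChart.eq_symmDiff_of_adj {s : Finset V} {v : V} (c : CubeChart K s v)
    {X Y : Finset (Fin c.q)} (h : K.graph.Adj (c.ψ X) (c.ψ Y)) : ∃ i, Y = X ∆ {i} := by
  classical
  obtain ⟨hne, e, hX, hY⟩ := h
  have hsub : e.1 ⊆ s := fun x hx => by
    rcases (edge_mem_iff hne hX hY x).1 hx with rfl | rfl <;> exact c.mem _
  obtain ⟨M, A, hm⟩ := (c.face_iff _ hsub).1 e.2.1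
  obtain ⟨X', hX', hXe⟩ := (hm _).1 hX
  obtain ⟨Y', hY', hYe⟩ := (hm _).1 hY
  have hXe := c.inj hXe
  have hYe := c.inj hYe
  have hXY : X' ≠ Y' := fun h => hne (by rw [hXe, hYe, h])
  obtain ⟨i, hi⟩ : (X' ∆ Y').Nonempty := by
    rw [Finset.nonempty_iff_ne_empty]
    intro h
    exact hXY (symmDiff_eq_bot.1 h)
  have hiM : i ∈ M := by
    rcases Finset.mem_symmDiff.1 hi with h | h
    · exact hX' h.1
    · exact hY' h.1
  have hmem : c.ψ ((X' ∆ {i}) ∆ A) ∈ e.1 := (hm _).2 ⟨X' ∆ {i}, by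
    intro j hj
    rcases Finset.mem_symmDiff.1 hj with h | h
    · exact hX' h.1
    · have := h.1; simp at this; subst this; exact hiM, rfl⟩
  have he : X' ∆ {i} ∆ A = X ∆ {i} := by
    rw [hXe, symmDiff_assoc, symmDiff_comm {i} A, ← symmDiff_assoc]
  rw [he] at hmem
  rcases (edge_mem_iff hne hX hY _).1 hmem with h | h
  · exact absurd (c.inj h).symm (c.ne_symmDiff_singleton X i)
  · exact ⟨i, (c.inj h).symm⟩

/-- `a`, `b`, `c`, `d` are the consecutive vertices of a square. -/
def IsSquare (K : CubicalComplex V) (a b c d : V) : Prop :=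
  K.graph.Adj a b ∧ K.graph.Adj b c ∧ K.graph.Adj a d ∧ K.graph.Adj d c ∧ a ≠ c ∧ b ≠ d ∧
    ∃ s ∈ K.cubes, s.card = 4 ∧ a ∈ s ∧ b ∈ s ∧ c ∈ s ∧ d ∈ s

namespace IsSquare

variable {a b c d : V}

theorem swap (h : IsSquare K a b c d) : IsSquare K a d c b := by
  obtain ⟨h1, h2, h3, h4, h5, h6, s, hs, hc, ha, hb, hc', hd⟩ := h
  exact ⟨h3, h4, h1, h2, h5, h6.symm, s, hs, hc, ha, hd, hc', hb⟩

theorem rev (h : IsSquare K a b c d) : IsSquare K c b a d := by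
  obtain ⟨h1, h2, h3, h4, h5, h6, s, hs, hc, ha, hb, hc', hd⟩ := h
  exact ⟨h2.symm, h1.symm, h4.symm, h3.symm, h5.symm, h6, s, hs, hc, hc', hb, ha, hd⟩

theorem rot (h : IsSquare K a b c d) : IsSquare K b c d a := by
  obtain ⟨h1, h2, h3, h4, h5, h6, s, hs, hc, ha, hb, hc', hd⟩ := h
  exact ⟨h2, h4.symm, h1.symm, h3, h6, h5.symm, s, hs, hc, hb, hc', hd, ha⟩

end IsSquare

/-- The intersection of the two squares is a cube, so its cardinality is a power of two; being at
least three, it is four. -/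
theorem eq_of_three_mem {s t : Finset V} (hs : s ∈ K.cubes) (ht : t ∈ K.cubes) (hsc : s.card = 4)
    (htc : t.card = 4) {a b c : V} (hab : a ≠ b) (hbc : b ≠ c) (hac : a ≠ c) (has : a ∈ s)
    (hbs : b ∈ s) (hcs : c ∈ s) (hat : a ∈ t) (hbt : b ∈ t) (hct : c ∈ t) : s = t := by
  classical
  obtain ⟨r, hr, hrst⟩ := K.exists_inter s hs t ht ⟨a, has, hat⟩
  have hr' : r = s ∩ t := by
    apply Finset.coe_injective; rw [hrst, Finset.coe_inter]
  have har : a ∈ r := by rw [hr']; simp [has, hat]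
  obtain ⟨ch⟩ := nonempty_cubeChart hr har
  have h3 : 3 ≤ r.card := by
    rw [← Finset.card_eq_three.2 ⟨a, b, c, hab, hac, hbc, rfl⟩]
    refine Finset.card_le_card fun x hx => ?_
    rw [hr']
    simp at hx
    rcases hx with rfl | rfl | rfl <;> simp [*]
  have h4 : r.card ≤ 4 := by
    rw [← hsc, hr']; exact Finset.card_le_card Finset.inter_subset_left
  have h5 : r.card = 4 := by
    rw [ch.card_eq] at h3 h4 ⊢
    rcases Nat.lt_or_ge ch.q 2 with h | h
    · interval_cases ch.q <;> simp at h3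
    · have : 2 ^ 2 ≤ 2 ^ ch.q := Nat.pow_le_pow_right (by norm_num) h
      omega
  have e1 : r = s := Finset.eq_of_subset_of_card_le (by rw [hr']; exact Finset.inter_subset_left)
    (by omega)
  have e2 : r = t := Finset.eq_of_subset_of_card_le (by rw [hr']; exact Finset.inter_subset_right)
    (by omega)
  exact e1.symm.trans e2

/-- By `eq_of_three_mem` both squares have the same vertex set, which has no room for a fifth
vertex. -/
theorem IsSquare.unique {a b c d d' : V} (h : IsSquare K a b c d) (h' : IsSquare K a b c d') :
    d = d' := by
  classical
  obtain ⟨h1, h2, h3, h4, h5, h6, s, hs, hc, ha, hb, hc', hd⟩ := h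
  obtain ⟨_, _, g3, g4, _, g6, t, ht, gc, ga, gb, gc', gd⟩ := h'
  have hst := eq_of_three_mem hs ht hc gc h1.1 h2.1 h5 ha hb hc' ga gb gc'
  subst hst
  by_contra hne
  have : ({a, b, c, d, d'} : Finset V).card ≤ s.card := by
    refine Finset.card_le_card fun x hx => ?_
    simp at hx
    rcases hx with rfl | rfl | rfl | rfl | rfl <;> assumption
  have h5' : ({a, b, c, d, d'} : Finset V).card = 5 := by
    rw [Finset.card_insert_of_notMem, Finset.card_insert_of_notMem, Finset.card_insert_of_notMem,
      Finset.card_pair hne]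
    · simp only [Finset.mem_insert, Finset.mem_singleton]
      rintro (h | h)
      · exact h4.1 h.symm
      · exact g4.1 h.symm
    · simp only [Finset.mem_insert, Finset.mem_singleton]
      rintro (h | h | h)
      · exact h2.1 h
      · exact h6 h
      · exact g6 h
    · simp only [Finset.mem_insert, Finset.mem_singleton]
      rintro (h | h | h | h)
      · exact h1.1 h
      · exact h5 h
      · exact h3.1 h
      · exact g3.1 h
  omega

theorem CubeChart.isSquare {s : Finset V} {v : V} (c : CubeChart K s v) (X : Finset (Fin c.q))
    {i j : Fin c.q} (hij : i ≠ j) :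
    IsSquare K (c.ψ X) (c.ψ (X ∆ {i})) (c.ψ (X ∆ {i} ∆ {j})) (c.ψ (X ∆ {j})) := by
  classical
  obtain ⟨t, ht, hts, hcard, hm⟩ := c.exists_face {i, j} X
  rw [Finset.card_pair hij] at hcard
  have hij' : ({i} : Finset (Fin c.q)) ≠ {j} := fun h => hij (Finset.singleton_injective h)
  refine ⟨c.adj_symmDiff _ _, c.adj_symmDiff _ _, c.adj_symmDiff _ _, ?_, ?_, ?_, t, ht, hcard,
    (hm _).2 ⟨∅, by simp, by rw [empty_symmDiff_finset]⟩, (hm _).2 ⟨{i}, by simp, by rw [symmDiff_comm]⟩,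
    (hm _).2 ⟨{i} ∆ {j}, ?_, by rw [symmDiff_assoc, symmDiff_comm]⟩,
    (hm _).2 ⟨{j}, by simp, by rw [symmDiff_comm]⟩⟩
  · have := c.adj_symmDiff (X ∆ {j}) i
    rwa [symmDiff_right_comm] at this
  · intro h
    have := c.inj h
    rw [symmDiff_assoc] at this
    exact hij' (symmDiff_eq_bot.1 (symmDiff_eq_left.1 this.symm))
  · intro h
    exact hij' (symmDiff_right_injective X (c.inj h))
  · intro k hk
    rw [Finset.mem_symmDiff] at hk
    simp at hk ⊢
    tauto

theorem CubeChart.exists_eq_singleton {s : Finset V} {v : V} (c : CubeChart K s v) {a : V}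
    (ha : a ∈ s) (h : K.graph.Adj v a) : ∃ i, c.ψ {i} = a := by
  obtain ⟨X, rfl⟩ := (c.mem_iff a).1 ha
  have h' : K.graph.Adj (c.ψ ∅) (c.ψ X) := by rw [c.base]; exact h
  obtain ⟨i, rfl⟩ := c.eq_symmDiff_of_adj h'
  exact ⟨i, by rw [empty_symmDiff_finset]⟩

/-- The `3`-cube spanned by three edges that pairwise span squares. -/
theorem HasFlagLinks.exists_cube (hK : K.HasFlagLinks) {v a b c ab ac bc : V}
    (hab : IsSquare K a v b ab) (hac : IsSquare K a v c ac) (hbc : IsSquare K b v c bc) :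
    ∃ t, IsSquare K ab a ac t ∧ IsSquare K ab b bc t ∧ IsSquare K ac c bc t := by
  classical
  have key : ∀ x y : V, (∃ z, IsSquare K x v y z) →
      ∃ s ∈ K.cubes, s.card = 4 ∧ v ∈ s ∧ x ∈ s ∧ y ∈ s := by
    rintro x y ⟨z, _, _, _, _, _, _, s, h1, h2, h3, h4, h5, _⟩
    exact ⟨s, h1, h2, h4, h3, h5⟩
  obtain ⟨s, hs, hv, hA, -⟩ := hK v {a, b, c}
    (by
      intro x hx
      simp at hx
      rcases hx with rfl | rfl | rfl
      exacts [hab.1.symm, hab.2.1, hac.2.1])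
    (by
      intro x hx y hy hxy
      simp at hx hy
      rcases hx with rfl | rfl | rfl <;> rcases hy with rfl | rfl | rfl
      · exact absurd rfl hxy
      · exact key _ _ ⟨_, hab⟩
      · exact key _ _ ⟨_, hac⟩
      · exact key _ _ ⟨_, hab.rev⟩
      · exact absurd rfl hxy
      · exact key _ _ ⟨_, hbc⟩
      · exact key _ _ ⟨_, hac.rev⟩
      · exact key _ _ ⟨_, hbc.rev⟩
      · exact absurd rfl hxy)
  obtain ⟨ch⟩ := nonempty_cubeChart hs hv
  obtain ⟨i, rfl⟩ := ch.exists_eq_singleton (hA (by simp)) hab.1.symm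
  obtain ⟨j, rfl⟩ := ch.exists_eq_singleton (a := b) (hA (by simp)) hab.2.1
  obtain ⟨k, rfl⟩ := ch.exists_eq_singleton (a := c) (hA (by simp)) hac.2.1
  have hij : i ≠ j := fun h => hab.2.2.2.2.1 (by rw [h])
  have hik : i ≠ k := fun h => hac.2.2.2.2.1 (by rw [h])
  have hjk : j ≠ k := fun h => hbc.2.2.2.2.1 (by rw [h])
  have sq : ∀ {i j : Fin ch.q}, i ≠ j →
      IsSquare K (ch.ψ {i}) v (ch.ψ {j}) (ch.ψ ({i} ∆ {j})) := by
    intro i j hij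
    have h := ch.isSquare ∅ hij
    simp only [ch.base] at h
    have h2 := h.rot.rot.rot.rev
    simpa only [empty_symmDiff_finset] using h2
  -- The given fourth vertices agree with those of the chart, and the vertex opposite to `v` is the
  -- one labelled by all three directions.
  obtain rfl := hab.unique (sq hij)
  obtain rfl := hac.unique (sq hik)
  obtain rfl := hbc.unique (sq hjk)
  refine ⟨ch.ψ ({i} ∆ {j} ∆ {k}), ?_, ?_, ?_⟩
  · have := ch.isSquare ({i} ∆ {j}) hjk
    rwa [symmDiff_symmDiff_cancel_right] at this
  · have := ch.isSquare ({i} ∆ {j}) hik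
    rwa [symmDiff_symmDiff_self'] at this
  · have := ch.isSquare ({i} ∆ {k}) hij
    rw [symmDiff_symmDiff_self', symmDiff_right_comm] at this
    convert this using 2
    rw [symmDiff_comm]

end CubicalComplex

end

noncomputable section

set_option linter.unusedSectionVars false

/-! ### Edge paths up to moves across squares

Edge paths are recorded as lists of vertices in reverse order: the head of the list is the end point
of the path. -/

namespace CubicalComplex

variable {V : Type*} {K : CubicalComplex V}

/-- Replacing two consecutive edges of a square by the other two. -/
inductive Move (K : CubicalComplex V) : List V → List V → Prop
  | sq {x v z w : V} {l : List V} : IsSquare K x v z w → Move K (z :: v :: x :: l) (z :: w :: x :: l)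
  | cons (a : V) {l m : List V} : Move K l m → Move K (a :: l) (a :: m)

/-- The equivalence relation generated by moves across squares. -/
def Eqv (K : CubicalComplex V) : List V → List V → Prop := Relation.ReflTransGen (Move K)

theorem Move.symm {l l' : List V} (h : Move K l l') : Move K l' l := by
  induction h with
  | sq h => exact .sq h.swap
  | cons a _ ih => exact .cons a ih

namespace Eqv

theorem refl (l : List V) : Eqv K l l := Relation.ReflTransGen.refl

theorem symm {l l' : List V} (h : Eqv K l l') : Eqv K l' l := by
  induction h with
  | refl => exact refl _
  | tail _ h ih => exact Relation.ReflTransGen.head h.symm ih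

theorem trans {l l' l'' : List V} (h : Eqv K l l') (h' : Eqv K l' l'') : Eqv K l l'' :=
  Relation.ReflTransGen.trans h h'

theorem cons (a : V) {l l' : List V} (h : Eqv K l l') : Eqv K (a :: l) (a :: l') :=
  Relation.ReflTransGen.lift (List.cons a) (fun _ _ => Move.cons a) _ _ h

theorem sq {x v z w : V} (l : List V) (h : IsSquare K x v z w) :
    Eqv K (z :: v :: x :: l) (z :: w :: x :: l) :=
  Relation.ReflTransGen.single (.sq h)

theorem _root_.CubicalComplex.Move.length_eq {l l' : List V} (h : Move K l l') :
    l.length = l'.length := by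
  induction h with
  | sq _ => rfl
  | cons a _ ih => simp [ih]

theorem length_eq {l l' : List V} (h : Eqv K l l') : l.length = l'.length := by
  induction h with
  | refl => rfl
  | tail _ h ih => rw [ih, h.length_eq]

theorem head_eq {l l' : List V} (h : Eqv K l l') : l.head? = l'.head? := by
  induction h with
  | refl => rfl
  | tail _ h ih => rw [ih]; cases h <;> rfl

theorem cons_head_eq {a b : V} {l l' : List V} (h : Eqv K (a :: l) (b :: l')) : a = b := by
  simpa using h.head_eq

theorem exists_cons {a : V} {l m : List V} (h : Eqv K (a :: l) m) : ∃ m', m = a :: m' := by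
  have := h.head_eq
  cases m with
  | nil => simp at this
  | cons b m => simp at this; exact ⟨m, by rw [this]⟩

end Eqv

/-- The paths `l` and `l'` become equivalent after the last step to `z` by at most one move across
a square at the end. -/
def Fork (K : CubicalComplex V) (z : V) (l l' : List V) : Prop :=
  Eqv K l l' ∨ ∃ v w x s, IsSquare K x v z w ∧ Eqv K l (v :: x :: s) ∧ Eqv K l' (w :: x :: s)

/-- Confluence of square moves. A chain of moves is followed one move at a time, so it suffices that
forks over `z` compose. Two consecutive forks give two forms of the same shorter path, to which
induction on the length applies. -/
theorem fork_of_eqv (hK : K.HasFlagLinks) {z : V} {l l' : List V} (h : Eqv K (z :: l) (z :: l')) :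
    Fork K z l l' := by
  have main : ∀ n : ℕ, ∀ (z : V) (l m : List V), l.length = n → Eqv K (z :: l) m →
      ∃ l', m = z :: l' ∧ Fork K z l l' := by
    intro n
    induction n using Nat.strong_induction_on with
    | _ n IH =>
    intro z l m hl hm
    have trans : ∀ l1 l2 : List V, Fork K z l l1 → Fork K z l1 l2 → Fork K z l l2 := by
      rintro l1 l2 (h | ⟨v0, v1, x1, s1, sq1, e1, e2⟩) (h' | ⟨v1', v2, x2, s2, sq2, e3, e4⟩)
      · exact .inl (h.trans h')
      · exact .inr ⟨_, _, _, _, sq2, h.trans e3, e4⟩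
      · exact .inr ⟨_, _, _, _, sq1, e1, h'.symm.trans e2⟩
      · have e5 := e2.symm.trans e3
        obtain rfl := e5.cons_head_eq
        have hlen : (x1 :: s1).length < n := by
          rw [← hl, e1.length_eq]; simp
        obtain ⟨l', hl', hf⟩ := IH _ hlen v1 _ _ rfl e5
        obtain rfl : x2 :: s2 = l' := by simpa using hl'
        rcases hf with h | ⟨y1, y2, y, s, sq3, e6, e7⟩
        · obtain rfl := h.cons_head_eq
          obtain rfl : v0 = v2 := sq1.rot.rot.unique sq2.rev
          exact .inl (e1.trans ((h.cons v0).trans e4.symm))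
        · obtain rfl := e6.cons_head_eq
          obtain rfl := e7.cons_head_eq
          -- The neighbours `z`, `x1`, `x2` of `v1` pairwise span squares with it, so the flag
          -- condition gives a 3-cube. Its vertex `t` opposite to `v1` is the foot of a single
          -- square that leads from `v0` to `v2` over `z`.
          obtain ⟨t, t1, t2, t3⟩ := hK.exists_cube sq1.swap.rev sq2.rev sq3.rot
          refine .inr ⟨v0, v2, t, y :: s, t1.rot.rot.rot, ?_, ?_⟩
          · exact (e1.trans (e6.cons v0)).trans (.sq _ t2.rev)
          · exact (e4.trans (e7.cons v2)).trans (.sq _ t3.rev)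
    induction hm with
    | refl => exact ⟨l, rfl, .inl (.refl _)⟩
    | tail _ h ih =>
      obtain ⟨l1, rfl, hf⟩ := ih
      cases h with
      | sq h => exact ⟨_, rfl, trans _ _ hf (.inr ⟨_, _, _, _, h, .refl _, .refl _⟩)⟩
      | cons _ h => exact ⟨_, rfl, trans _ _ hf (.inl (Relation.ReflTransGen.single h))⟩
  obtain ⟨m, hm, hf⟩ := main _ z l _ rfl h
  obtain rfl : l' = m := by simpa using hm
  exact hf

/-- Cancellation of the last step: the two neighbours of `z` in a square are distinct, so a genuine
fork cannot join `v` to itself. -/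
theorem eqv_of_eqv_cons_cons (hK : K.HasFlagLinks) {z v : V} {l l' : List V}
    (h : Eqv K (z :: v :: l) (z :: v :: l')) : Eqv K (v :: l) (v :: l') := by
  rcases fork_of_eqv hK h with h | ⟨a, b, x, s, sq, h1, h2⟩
  · exact h
  · obtain rfl := h1.cons_head_eq
    obtain rfl := h2.cons_head_eq
    exact absurd rfl sq.2.2.2.2.2.1

theorem fork_of_ne (hK : K.HasFlagLinks) {z v w : V} {l l' : List V}
    (h : Eqv K (z :: v :: l) (z :: w :: l')) (hvw : v ≠ w) :
    ∃ x s, IsSquare K x v z w ∧ Eqv K (v :: l) (v :: x :: s) ∧ Eqv K (w :: l') (w :: x :: s) := by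
  rcases fork_of_eqv hK h with h | ⟨a, b, x, s, sq, h1, h2⟩
  · exact absurd h.cons_head_eq hvw
  · obtain rfl := h1.cons_head_eq
    obtain rfl := h2.cons_head_eq
    exact ⟨x, s, sq, h1, h2⟩

/-- The path contains an edge followed by its inverse. -/
inductive HasBacktrack : List V → Prop
  | here (a b : V) (l : List V) : HasBacktrack (a :: b :: a :: l)
  | cons (a : V) {l : List V} : HasBacktrack l → HasBacktrack (a :: l)

/-- No equivalent path contains a backtrack. -/
def Reduced (K : CubicalComplex V) (l : List V) : Prop := ∀ l', Eqv K l l' → ¬ HasBacktrack l'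

theorem Reduced.eqv {l l' : List V} (h : Reduced K l) (h' : Eqv K l l') : Reduced K l' :=
  fun _ hm => h _ (h'.trans hm)

theorem Reduced.tail {a : V} {l : List V} (h : Reduced K (a :: l)) : Reduced K l :=
  fun _ hm hb => h _ (hm.cons a) (.cons a hb)

/-- If a further step creates a backtrack somewhere, the path can be rearranged so that this step
itself backtracks. A fork over a foot `x` moves a hidden backtrack into the path through `w`; by
induction the path to `x` may be taken to arrive from `w`, and one move across the square makes the
original path arrive from `z`. -/
theorem exists_eqv_of_not_reduced (hK : K.HasFlagLinks) : ∀ {v z : V} {l : List V},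
    Reduced K (v :: l) → ¬ Reduced K (z :: v :: l) → ∃ q, Eqv K (v :: l) (v :: z :: q) := by
  have main : ∀ n : ℕ, ∀ (v z : V) (l : List V), l.length = n →
      Reduced K (v :: l) → ¬ Reduced K (z :: v :: l) → ∃ q, Eqv K (v :: l) (v :: z :: q) := by
    intro n
    induction n using Nat.strong_induction_on with
    | _ n IH =>
    intro v z l hl hr hn
    simp only [Reduced, not_forall, not_not] at hn
    obtain ⟨m, hm, hb⟩ := hn
    obtain ⟨m', rfl⟩ := hm.exists_cons
    rcases fork_of_eqv hK hm with h | ⟨a, w, x, s, sq, h1, h2⟩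
    · cases hb with
      | here _ b l' =>
        obtain rfl := h.cons_head_eq
        exact ⟨_, h⟩
      | cons _ hb => exact absurd hb (hr _ h)
    · obtain rfl := h1.cons_head_eq
      cases hb with
      | here _ b l' =>
        obtain rfl := h2.cons_head_eq
        obtain ⟨y, s', sq', -, h4⟩ := fork_of_ne hK h2 sq.2.2.2.2.1.symm
        obtain rfl : v = y := sq.rot.rot.unique sq'.rot
        exact absurd (.here _ _ _) (hr _ (h1.trans (h4.cons v)))
      | cons _ hb =>
        have hx : Reduced K (x :: s) := (hr.eqv h1).tail
        have hlen : s.length < n := by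
          have := h1.length_eq
          simp at this
          omega
        obtain ⟨q, hq⟩ := IH _ hlen x w s rfl hx fun h => h _ h2.symm hb
        exact ⟨_, (h1.trans (hq.cons v)).trans (.sq q sq.rot.rot.rot)⟩
  intro v z l
  exact main _ v z l rfl

/-- `m` is obtained from `l` by a further step to `z`, followed by the removal of a backtrack. -/
def StepRel (K : CubicalComplex V) (z : V) (l m : List V) : Prop :=
  (Reduced K (z :: l) ∧ Eqv K m (z :: l)) ∨ (m.head? = some z ∧ ∃ v, Eqv K l (v :: m))

namespace StepRel

variable {z : V} {l m m' : List V}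

theorem head_eq (h : StepRel K z l m) : m.head? = some z := by
  rcases h with ⟨_, h⟩ | ⟨h, _⟩
  · rw [h.head_eq]; rfl
  · exact h

theorem reduced (h : StepRel K z l m) (hl : Reduced K l) : Reduced K m := by
  rcases h with ⟨h1, h⟩ | ⟨_, v, h⟩
  · exact h1.eqv h.symm
  · exact (hl.eqv h).tail

/-- The two clauses of `StepRel` exclude each other, since a path that can be made to arrive from
`z` backtracks when extended to `z`. In the second clause, uniqueness is cancellation of the last
step. -/
theorem unique (hK : K.HasFlagLinks) {l' : List V} (hll : Eqv K l l')
    (h : StepRel K z l m) (h' : StepRel K z l' m') : Eqv K m m' := by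
  have aux : ∀ {l l' m m' : List V}, Eqv K l l' → Reduced K (z :: l) → m'.head? = some z →
      ∀ v, Eqv K l' (v :: m') → False := by
    intro l l' m m' hll hr hm v hv
    cases m' with
    | nil => simp at hm
    | cons a m' =>
      simp at hm
      subst hm
      exact hr _ ((hll.trans hv).cons a) (.here _ _ _)
  rcases h with ⟨h1, h2⟩ | ⟨h1, v, h2⟩ <;> rcases h' with ⟨h3, h4⟩ | ⟨h3, v', h4⟩
  · exact (h2.trans (hll.cons z)).trans h4.symm
  · exact (aux (m := m) hll h1 h3 v' h4).elim
  · exact (aux (m := m) hll.symm h3 h1 v h2).elim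
  · have h5 := (h2.symm.trans hll).trans h4
    obtain rfl := h5.cons_head_eq
    cases m with
    | nil => simp at h1
    | cons a m =>
      cases m' with
      | nil => simp at h3
      | cons b m' =>
        simp at h1 h3
        subst h1 h3
        exact eqv_of_eqv_cons_cons hK h5

/-- Going back exchanges the two clauses of `StepRel`. -/
theorem back {v : V} (h : StepRel K z l m) (hl : Reduced K l) (hv : l.head? = some v) :
    StepRel K v m l := by
  rcases h with ⟨_, h⟩ | ⟨_, a, h⟩
  · exact .inr ⟨hv, z, h⟩
  · have : v = a := by simpa [hv] using h.head_eq
    subst this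
    exact .inl ⟨hl.eqv h, h⟩

end StepRel

theorem exists_stepRel (hK : K.HasFlagLinks) (z : V) {v : V} {l : List V} (hl : Reduced K l)
    (hv : l.head? = some v) : ∃ m, StepRel K z l m := by
  cases l with
  | nil => simp at hv
  | cons a l =>
    by_cases h : Reduced K (z :: a :: l)
    · exact ⟨_, .inl ⟨h, .refl _⟩⟩
    · obtain ⟨q, hq⟩ := exists_eqv_of_not_reduced hK hl h
      exact ⟨z :: q, .inr ⟨rfl, a, hq⟩⟩

/-- The two ways round a square act alike on reduced paths. If `b` and `d` both extend `l`, the two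
paths to `c` differ by one move, and a cancellation at `c` would force `l` to arrive from `d`. If
only the step to `d` cancels, the extension to `b` can be rerouted through `c`, so that the step
from `b` to `c` cancels. If both cancel, `l` ends with this very square, and both second steps
cancel down to the same path. -/
theorem stepRel_square (hK : K.HasFlagLinks) {a b c d : V} (sq : IsSquare K a b c d)
    {l m1 m n1 n : List V} (hl : Reduced K l) (ha : l.head? = some a)
    (hm1 : StepRel K b l m1) (hm : StepRel K c m1 m) (hn1 : StepRel K d l n1)
    (hn : StepRel K c n1 n) : Eqv K m n := by
  obtain ⟨l0, rfl⟩ : ∃ l0, l = a :: l0 := by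
    cases l with
    | nil => simp at ha
    | cons x l => simp at ha; exact ⟨l, by rw [ha]⟩
  have mixed : ∀ {b d : V} {m1 m n1 n : List V}, IsSquare K a b c d → StepRel K c m1 m →
      StepRel K c n1 n → Reduced K (b :: a :: l0) → Eqv K m1 (b :: a :: l0) →
      n1.head? = some d → ∀ v, Eqv K (a :: l0) (v :: n1) → Eqv K m n := by
    intro b d m1 m n1 n sq hm hn h1 h2 h3 v h4
    obtain rfl := h4.cons_head_eq
    obtain ⟨n2, rfl⟩ : ∃ n2, n1 = d :: n2 := by
      cases n1 with
      | nil => simp at h3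
      | cons x l => simp at h3; exact ⟨l, by rw [h3]⟩
    have h5 : Eqv K m1 (b :: c :: d :: n2) :=
      (h2.trans (h4.cons b)).trans (.sq n2 sq.rot.rot.rot)
    have h6 : Reduced K (c :: d :: n2) := ((h1.eqv h2.symm).eqv h5).tail
    have e1 : Eqv K m (c :: d :: n2) := hm.unique hK (.refl _) (.inr ⟨rfl, b, h5⟩)
    have e2 : Eqv K n (c :: d :: n2) := hn.unique hK (.refl _) (.inl ⟨h6, .refl _⟩)
    exact e1.trans e2.symm
  rcases id hm1 with ⟨h1, h2⟩ | ⟨h1, v, h2⟩ <;> rcases id hn1 with ⟨h3, h4⟩ | ⟨h3, v', h4⟩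
  · have hcc : Eqv K (c :: m1) (c :: n1) :=
      ((h2.cons c).trans (.sq l0 sq)).trans (h4.symm.cons c)
    rcases id hm with ⟨h5, h6⟩ | ⟨h5, v, h6⟩
    · exact h6.trans (hcc.trans (hn.unique hK (.refl _) (.inl ⟨h5.eqv hcc, .refl _⟩)).symm)
    · exfalso
      obtain ⟨m', rfl⟩ : ∃ m', m = c :: m' := by
        cases m with
        | nil => simp at h5
        | cons x l => simp at h5; exact ⟨l, by rw [h5]⟩
      have h7 := h2.symm.trans h6
      obtain rfl := h7.cons_head_eq
      obtain ⟨y, s, sq', h8, -⟩ := fork_of_ne hK h7 sq.2.2.2.2.1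
      obtain rfl : d = y := sq.unique sq'.rot
      exact h3 _ (h8.cons d) (.here _ _ _)
  · exact mixed sq hm hn h1 h2 h3 v' h4
  · exact (mixed sq.swap hn hm h3 h4 h1 v h2).symm
  · obtain rfl := h2.cons_head_eq
    obtain rfl := h4.cons_head_eq
    obtain ⟨m2, rfl⟩ : ∃ m', m1 = b :: m' := by
      cases m1 with
      | nil => simp at h1
      | cons x l => simp at h1; exact ⟨l, by rw [h1]⟩
    obtain ⟨n2, rfl⟩ : ∃ m', n1 = d :: m' := by
      cases n1 with
      | nil => simp at h3
      | cons x l => simp at h3; exact ⟨l, by rw [h3]⟩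
    obtain ⟨y, s, sq', h5, h6⟩ := fork_of_ne hK (h2.symm.trans h4) sq.2.2.2.2.2.1
    obtain rfl : c = y := sq.swap.rot.rot.rot.unique sq'.rot
    exact (hm.unique hK (.refl _) (.inr ⟨rfl, b, h5⟩)).trans
      (hn.unique hK (.refl _) (.inr ⟨rfl, d, h6⟩)).symm

/-- The step to `z` followed by the removal of a backtrack. -/
def stepTo (K : CubicalComplex V) (z : V) (l : List V) : List V := Classical.epsilon (StepRel K z l)

/-- The extension of a reduced path by a walk, followed by reduction. -/
def extend (K : CubicalComplex V) : ∀ {u v : V}, K.graph.Walk u v → List V → List V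
  | _, _, .nil, l => l
  | _, _, .cons (v := v) _ p, l => extend K p (stepTo K v l)

/-! ### The action of walks on reduced paths and its homotopy invariance -/

section extend

variable (hK : K.HasFlagLinks)
include hK

theorem stepRel_stepTo (z : V) {v : V} {l : List V} (hl : Reduced K l) (hv : l.head? = some v) :
    StepRel K z l (stepTo K z l) :=
  Classical.epsilon_spec (exists_stepRel hK z hl hv)

theorem stepTo_congr (z : V) {v : V} {l l' : List V} (hl : Reduced K l) (hv : l.head? = some v)
    (h : Eqv K l l') : Eqv K (stepTo K z l) (stepTo K z l') :=
  (stepRel_stepTo hK z hl hv).unique hK h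
    (stepRel_stepTo hK z (hl.eqv h) (h.head_eq ▸ hv))

theorem extend_congr {u v : V} (p : K.graph.Walk u v) : ∀ {l l' : List V}, Reduced K l →
    l.head? = some u → Eqv K l l' → Eqv K (extend K p l) (extend K p l') := by
  induction p with
  | nil => intro l l' _ _ h; exact h
  | @cons _ v _ h p ih =>
    intro l l' hl hu hll
    have := stepRel_stepTo hK v hl hu
    exact ih (this.reduced hl) this.head_eq (stepTo_congr hK _ hl hu hll)

theorem reduced_extend {u v : V} (p : K.graph.Walk u v) : ∀ {l : List V}, Reduced K l →
    l.head? = some u → Reduced K (extend K p l) ∧ (extend K p l).head? = some v := by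
  induction p with
  | nil => intro l hl hu; exact ⟨hl, hu⟩
  | @cons _ v _ h p ih =>
    intro l hl hu
    have := stepRel_stepTo hK v hl hu
    exact ih (this.reduced hl) this.head_eq

theorem extend_append {u v z : V} (p : K.graph.Walk u v) (q : K.graph.Walk v z) (l : List V) :
    extend K (p.append q) l = extend K q (extend K p l) := by
  induction p generalizing l with
  | nil => rfl
  | cons h p ih => exact ih q _

theorem stepTo_stepTo {u : V} (z : V) {l : List V} (hl : Reduced K l) (hu : l.head? = some u) :
    Eqv K (stepTo K u (stepTo K z l)) l := by
  have h := stepRel_stepTo hK z hl hu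
  exact (stepRel_stepTo hK u (h.reduced hl) h.head_eq).unique hK (.refl _) (h.back hl hu)

theorem Homotopic.extend_eqv {u v : V} {p q : K.graph.Walk u v} (h : K.Homotopic p q) :
    ∀ {l : List V}, Reduced K l → l.head? = some u → Eqv K (extend K p l) (extend K q l) := by
  induction h with
  | refl p => intro l _ _; exact .refl _
  | symm _ ih => intro l hl hu; exact (ih hl hu).symm
  | trans _ _ ih1 ih2 => intro l hl hu; exact (ih1 hl hu).trans (ih2 hl hu)
  | @cons _ v _ h _ _ _ ih =>
    intro l hl hu
    have := stepRel_stepTo hK v hl hu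
    exact ih (this.reduced hl) this.head_eq
  | @backtrack u v z h p =>
    intro l hl hu
    have h1 := stepRel_stepTo hK v hl hu
    have h2 := stepRel_stepTo hK u (h1.reduced hl) h1.head_eq
    exact extend_congr hK p (h2.reduced (h1.reduced hl)) h2.head_eq (stepTo_stepTo hK v hl hu)
  | @square a b c d z s hs hcard ha hb hc hd hab hbc had hdc p =>
    intro l hl hu
    have h1 := stepRel_stepTo hK b hl hu
    have h2 := stepRel_stepTo hK c (h1.reduced hl) h1.head_eq
    have h3 := stepRel_stepTo hK d hl hu
    have h4 := stepRel_stepTo hK c (h3.reduced hl) h3.head_eq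
    refine extend_congr hK p (h2.reduced (h1.reduced hl)) h2.head_eq ?_
    -- The homotopy move does not require four distinct vertices. When it degenerates, both routes
    -- are backtracks or they coincide.
    by_cases hac : a = c
    · subst hac
      exact (stepTo_stepTo hK b hl hu).trans (stepTo_stepTo hK d hl hu).symm
    by_cases hbd : b = d
    · subst hbd
      exact .refl _
    exact stepRel_square hK ⟨hab, hbc, had, hdc, hac, hbd, s, hs, hcard, ha, hb, hc, hd⟩ hl hu
      h1 h2 h3 h4

theorem extend_reverse {u v : V} (p : K.graph.Walk u v) : ∀ {l : List V}, Reduced K l →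
    l.head? = some u → Eqv K (extend K p.reverse (extend K p l)) l := by
  induction p with
  | nil => intro l _ _; exact .refl _
  | @cons u v w h p ih =>
    intro l hl hu
    have h1 := stepRel_stepTo hK v hl hu
    have h2 := ih (h1.reduced hl) h1.head_eq
    rw [SimpleGraph.Walk.reverse_cons, extend_append hK]
    have h3 : (extend K p.reverse (extend K p (stepTo K v l))).head? = some v := by
      rw [h2.head_eq]; exact h1.head_eq
    refine .trans ?_ (stepTo_stepTo hK v hl hu)
    exact stepTo_congr hK u ((h1.reduced hl).eqv h2.symm) h3 h2

end extend

/-- `l` is an edge path that starts at `P`. -/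
inductive PathFrom (K : CubicalComplex V) (P : V) : List V → Prop
  | nil : PathFrom K P [P]
  | cons {v z : V} {l : List V} : K.graph.Adj v z → PathFrom K P (v :: l) →
      PathFrom K P (z :: v :: l)

/-! ### Paths from the base vertex, geodesics and the quadrangle condition -/

namespace PathFrom

variable {P : V}

theorem move {l l' : List V} (h : Move K l l') : PathFrom K P l → PathFrom K P l' := by
  induction h with
  | sq h =>
    intro hl
    cases hl with
    | cons h1 h2 =>
      cases h2 with
      | cons h3 h4 => exact .cons h.2.2.2.1 (.cons h.2.2.1 h4)
  | @cons a l l' h ih =>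
    intro hl
    cases hl with
    | nil => cases h
    | cons h1 h2 =>
      have h3 := ih h2
      obtain ⟨m, rfl⟩ := Eqv.exists_cons (Relation.ReflTransGen.single h)
      exact .cons h1 h3

theorem eqv {l l' : List V} (hl : PathFrom K P l) (h : Eqv K l l') : PathFrom K P l' := by
  induction h with
  | refl => exact hl
  | tail _ h ih => exact move h ih

theorem exists_shorter {l : List V} (hb : HasBacktrack l) : PathFrom K P l →
    ∃ l', PathFrom K P l' ∧ l'.head? = l.head? ∧ l'.length + 2 = l.length := by
  induction hb with
  | here a b l =>
    intro h
    cases h with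
    | cons _ h =>
      cases h with
      | cons _ h => exact ⟨_, h, rfl, rfl⟩
  | cons a hb ih =>
    intro h
    cases h with
    | nil => cases hb
    | cons h1 h2 =>
      obtain ⟨l', h3, h4, h5⟩ := ih h2
      cases l' with
      | nil => cases h3
      | cons b l' =>
        simp at h4
        subst h4
        exact ⟨_, .cons h1 h3, rfl, by simpa using h5⟩

theorem exists_walk {v : V} {l : List V} (h : PathFrom K P (v :: l)) :
    ∃ p : K.graph.Walk v P, p.length = l.length := by
  induction l generalizing v with
  | nil => cases h; exact ⟨.nil, rfl⟩
  | cons a l ih =>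
    cases h with
    | cons h1 h2 =>
      obtain ⟨p, hp⟩ := ih h2
      exact ⟨.cons h1.symm p, by simp [hp]⟩

theorem of_walk {v : V} (p : K.graph.Walk v P) :
    ∃ l, PathFrom K P (v :: l) ∧ l.length = p.length := by
  induction p with
  | nil => exact ⟨[], .nil, rfl⟩
  | cons h p ih =>
    obtain ⟨l, hl, hlen⟩ := ih
    exact ⟨_, .cons h.symm hl, by simp [hlen]⟩

theorem dist_le {v : V} {l : List V} (h : PathFrom K P (v :: l)) : K.graph.dist P v ≤ l.length := by
  obtain ⟨p, hp⟩ := h.exists_walk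
  rw [← hp, SimpleGraph.dist_comm]
  exact SimpleGraph.dist_le p

/-- Deleting a backtrack from an equivalent path would give a path shorter than the distance. -/
theorem reduced_of_length_eq_dist {v : V} {l : List V} (h : PathFrom K P (v :: l))
    (hd : l.length = K.graph.dist P v) : Reduced K (v :: l) := by
  intro m hm hb
  obtain ⟨m', h1, h2, h3⟩ := exists_shorter hb (h.eqv hm)
  rw [← hm.head_eq] at h2
  rw [← hm.length_eq] at h3
  cases m' with
  | nil => simp at h2
  | cons a m' =>
    simp at h2
    subst h2
    have := h1.dist_le
    simp at h3
    omega

end PathFrom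

theorem exists_geodesic (hK : K.IsCAT0) (P v : V) :
    ∃ l, PathFrom K P (v :: l) ∧ l.length = K.graph.dist P v := by
  obtain ⟨p, hp⟩ := hK.1.1.exists_walk_length_eq_dist v P
  obtain ⟨l, h1, h2⟩ := PathFrom.of_walk p
  exact ⟨l, h1, by rw [h2, hp, SimpleGraph.dist_comm]⟩

theorem reduced_singleton (P : V) : Reduced K [P] := by
  intro m hm hb
  have := hm.length_eq
  cases hb with
  | here _ _ _ => simp at this
  | cons _ hb => cases hb <;> simp at this

/-- Tracing a reduced path from its start never cancels anything, so each reduced path is the value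
of the action of some walk on the trivial path. -/
theorem PathFrom.exists_extend (hK : K.HasFlagLinks) {P : V} {v : V} {l : List V}
    (h : PathFrom K P (v :: l)) (hr : Reduced K (v :: l)) :
    ∃ p : K.graph.Walk P v, Eqv K (extend K p [P]) (v :: l) := by
  induction l generalizing v with
  | nil => cases h; exact ⟨.nil, .refl _⟩
  | cons a l ih =>
    cases h with
    | cons h1 h2 =>
      obtain ⟨p, hp⟩ := ih h2 hr.tail
      refine ⟨p.append (.cons h1 .nil), ?_⟩
      rw [extend_append hK]
      have h3 := reduced_extend hK p (reduced_singleton P) rfl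
      exact (stepRel_stepTo hK v h3.1 h3.2).unique hK hp (.inl ⟨hr, .refl _⟩)

/-- Reduced paths with the same end points differ only by moves across squares. -/
theorem PathFrom.eqv_of_reduced (hK : K.IsCAT0) {P v : V} {l l' : List V}
    (h : PathFrom K P (v :: l)) (hr : Reduced K (v :: l)) (h' : PathFrom K P (v :: l'))
    (hr' : Reduced K (v :: l')) : Eqv K (v :: l) (v :: l') := by
  obtain ⟨p, hp⟩ := h.exists_extend hK.2 hr
  obtain ⟨q, hq⟩ := h'.exists_extend hK.2 hr'
  refine hp.symm.trans (.trans ?_ hq)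
  have h0 := reduced_singleton (K := K) P
  have hp1 := reduced_extend hK.2 p h0 rfl
  have hq1 := reduced_extend hK.2 q h0 rfl
  -- The loop formed by `p` and the reverse of `q` is null-homotopic, so it acts trivially on the
  -- trivial path; acting by `q` then identifies the results of `p` and `q`.
  have e1 : Eqv K (extend K q.reverse (extend K p [P])) [P] := by
    have := (hK.1.2 P (p.append q.reverse)).extend_eqv hK.2 h0 rfl
    rwa [extend_append hK.2] at this
  have e2 := extend_reverse hK.2 q.reverse hp1.1 hp1.2
  rw [SimpleGraph.Walk.reverse_reverse] at e2
  have hp2 := reduced_extend hK.2 q.reverse hp1.1 hp1.2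
  exact e2.symm.trans (extend_congr hK.2 q hp2.1 hp2.2 e1)

/-- A geodesic is reduced too, and square moves preserve the length. -/
theorem PathFrom.length_eq_dist (hK : K.IsCAT0) {P v : V} {l : List V}
    (h : PathFrom K P (v :: l)) (hr : Reduced K (v :: l)) : l.length = K.graph.dist P v := by
  obtain ⟨m, h1, h2⟩ := exists_geodesic hK P v
  have := (h.eqv_of_reduced hK hr h1 (h1.reduced_of_length_eq_dist h2)).length_eq
  simp at this
  omega

/-- The `1`-skeleton is bipartite. -/
theorem IsCAT0.dist_of_adj (hK : K.IsCAT0) (P : V) {v z : V} (h : K.graph.Adj v z) :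
    K.graph.dist P v + 1 = K.graph.dist P z ∨ K.graph.dist P z + 1 = K.graph.dist P v := by
  obtain ⟨l, h1, h2⟩ := exists_geodesic hK P v
  have hr := h1.reduced_of_length_eq_dist h2
  -- Either the geodesic to `v` stays reduced after the step to `z`, or it can be rearranged to
  -- arrive from `z`.
  by_cases hz : Reduced K (z :: v :: l)
  · have := (PathFrom.cons h h1).length_eq_dist hK hz
    simp at this
    omega
  · obtain ⟨q, hq⟩ := exists_eqv_of_not_reduced hK.2 hr hz
    have h3 := h1.eqv hq
    have h4 := h3.length_eq_dist hK (hr.eqv hq)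
    cases h3 with
    | cons _ h3 =>
      have := h3.length_eq_dist hK (hr.eqv hq).tail
      simp at h4
      omega

/-- The quadrangle condition: two neighbours of `z` that are closer to `P` than `z` span a square
with `z`, whose fourth vertex is closer still. -/
theorem IsCAT0.quadrangle (hK : K.IsCAT0) (P : V) {v w z : V} (hv : K.graph.Adj v z)
    (hw : K.graph.Adj w z) (hvd : K.graph.dist P v < K.graph.dist P z)
    (hwd : K.graph.dist P w < K.graph.dist P z) (hvw : v ≠ w) :
    ∃ x, IsSquare K x v z w ∧ K.graph.dist P x + 2 = K.graph.dist P z := by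
  obtain ⟨l, h1, h2⟩ := exists_geodesic hK P v
  obtain ⟨m, h3, h4⟩ := exists_geodesic hK P w
  have hv1 := hK.dist_of_adj P hv
  have hw1 := hK.dist_of_adj P hw
  have rv := (PathFrom.cons hv h1).reduced_of_length_eq_dist (by simp; omega)
  have rw' := (PathFrom.cons hw h3).reduced_of_length_eq_dist (by simp; omega)
  -- Two geodesics to `z`, arriving from `v` and from `w`, are equivalent; the fork at their ends is
  -- the required square.
  have he := (PathFrom.cons hv h1).eqv_of_reduced hK rv (PathFrom.cons hw h3) rw'
  obtain ⟨x, s, sq, e1, -⟩ := fork_of_ne hK.2 he hvw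
  refine ⟨x, sq, ?_⟩
  have h5 := h1.eqv e1
  have h6 := h5.length_eq_dist hK (rv.tail.eqv e1)
  cases h5 with
  | cons h7 h8 =>
    have := h8.length_eq_dist hK (rv.tail.eqv e1).tail
    simp at h6
    omega

end CubicalComplex

end

noncomputable section

set_option linter.unusedSectionVars false

/-! ### Hyperplanes and half-spaces -/

namespace CubicalComplex

open scoped symmDiff

variable {V : Type*} {K : CubicalComplex V}

/-- The hyperplane that cuts the edge `{u, v}`. -/
def hyp {u v : V} (h : K.graph.Adj u v) : K.Hyperplane := Quot.mk _ h.2.choose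

theorem mk_eq_hyp {e : K.Edge} {u v : V} (h : K.graph.Adj u v) (hu : u ∈ e.1) (hv : v ∈ e.1) :
    (Quot.mk _ e : K.Hyperplane) = hyp h :=
  congrArg _ (edge_eq h.1 hu hv h.2.choose_spec.1 h.2.choose_spec.2)

theorem hyp_symm {u v : V} (h : K.graph.Adj u v) : hyp h.symm = hyp h :=
  mk_eq_hyp h h.symm.2.choose_spec.2 h.symm.2.choose_spec.1

theorem Edge.exists_adj (e : K.Edge) : ∃ u v, u ∈ e.1 ∧ v ∈ e.1 ∧ K.graph.Adj u v := by
  classical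
  obtain ⟨u, v, huv, he⟩ := Finset.card_eq_two.1 e.2.2
  have hu : u ∈ e.1 := by rw [he]; simp
  have hv : v ∈ e.1 := by rw [he]; simp
  exact ⟨u, v, hu, hv, huv, e, hu, hv⟩

theorem exists_hyp_eq (H : K.Hyperplane) : ∃ u v, ∃ h : K.graph.Adj u v, hyp h = H := by
  obtain ⟨e, rfl⟩ := Quot.exists_rep H
  obtain ⟨u, v, hu, hv, h⟩ := e.exists_adj
  exact ⟨u, v, h, (mk_eq_hyp h hu hv).symm⟩

theorem IsSquare.hyp_eq {a b c d : V} (h : IsSquare K a b c d) :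
    hyp h.1 = hyp h.2.2.2.1 := by
  obtain ⟨h1, h2, h3, h4, h5, h6, s, hs, hc, ha, hb, hc', hd⟩ := h
  have e1 := h1.2.choose_spec
  have e2 := h4.2.choose_spec
  refine Quot.sound ⟨s, hs, hc, ?_, ?_, ?_⟩
  · intro x hx
    rcases (edge_mem_iff h1.1 e1.1 e1.2 x).1 hx with rfl | rfl <;> assumption
  · intro x hx
    rcases (edge_mem_iff h4.1 e2.1 e2.2 x).1 hx with rfl | rfl <;> assumption
  · rw [Finset.disjoint_left]
    intro x hx hx'
    rcases (edge_mem_iff h1.1 e1.1 e1.2 x).1 hx with rfl | rfl <;>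
      rcases (edge_mem_iff h4.1 e2.1 e2.2 _).1 hx' with h | h
    exacts [h3.1 h, h5 h, h6 h, h2.1 h]

theorem Opposite.exists_isSquare {e e' : K.Edge} (h : K.Opposite e e') :
    ∃ a b c d, IsSquare K a b c d ∧ a ∈ e.1 ∧ b ∈ e.1 ∧ c ∈ e'.1 ∧ d ∈ e'.1 := by
  classical
  obtain ⟨s, hs, hc, he, he', hd⟩ := h
  obtain ⟨u, v, hu, hv, huv⟩ := e.exists_adj
  obtain ⟨ch⟩ := nonempty_cubeChart hs (he hu)
  obtain ⟨i, hi⟩ := ch.exists_eq_singleton (he hv) huv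
  have hq : ch.q = 2 := by
    have := ch.card_eq
    rw [hc] at this
    exact (Nat.pow_right_injective (le_refl 2) (by simpa using this)).symm
  obtain ⟨j, hj⟩ : ∃ j : Fin ch.q, i ≠ j := by
    have : Nontrivial (Fin ch.q) := by rw [hq]; infer_instance
    obtain ⟨j, hj⟩ := exists_ne i
    exact ⟨j, hj.symm⟩
  have sq := ch.isSquare ∅ hj
  simp only [empty_symmDiff_finset, ch.base, hi] at sq
  have hun : e.1 ∪ e'.1 = s := by
    refine Finset.eq_of_subset_of_card_le (Finset.union_subset he he') ?_
    rw [Finset.card_union_of_disjoint hd, hc, e.2.2, e'.2.2]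
  have key : ∀ x, x ∈ s → x ≠ u → x ≠ v → x ∈ e'.1 := by
    intro x hx h1 h2
    rw [← hun, Finset.mem_union] at hx
    rcases hx with hx | hx
    · rcases (edge_mem_iff huv.1 hu hv x).1 hx with h | h
      exacts [absurd h h1, absurd h h2]
    · exact hx
  exact ⟨_, _, _, _, sq, hu, hv, key _ (ch.mem _) sq.2.2.2.2.1.symm sq.2.1.1.symm,
    key _ (ch.mem _) sq.2.2.1.1.symm sq.2.2.2.2.2.1.symm⟩

/-- Opposite edges of a square point the same way as seen from `x`. Otherwise, since distances
change by exactly one along edges, `b` is farther than both `a` and `c`. The quadrangle condition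
and uniqueness of the fourth vertex then put `d` at distance two below `b`, although `d` is farther
than `c`. -/
theorem IsCAT0.lt_iff_of_isSquare (hK : K.IsCAT0) (x : V) {a b c d : V} (h : IsSquare K a b c d) :
    K.graph.dist x a < K.graph.dist x b ↔ K.graph.dist x d < K.graph.dist x c := by
  have main : ∀ {a b c d : V}, IsSquare K a b c d → K.graph.dist x a < K.graph.dist x b →
      K.graph.dist x d < K.graph.dist x c := by
    intro a b c d h hab
    by_contra hcd
    have h1 := hK.dist_of_adj x h.1
    have h2 := hK.dist_of_adj x h.2.1
    have h3 := hK.dist_of_adj x h.2.2.1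
    have h4 := hK.dist_of_adj x h.2.2.2.1
    obtain ⟨y, sq, hy⟩ := hK.quadrangle x h.1 h.2.1.symm hab (by omega) h.2.2.2.2.1
    obtain rfl : d = y := h.unique sq.rot
    omega
  exact ⟨main h, main h.rot.rot.rot.swap⟩

/-- Parallel edges cut the vertex set into the same two classes, up to the names of the classes. For
opposite edges of a square this is `lt_iff_of_isSquare`; reversing an edge swaps the classes because
parity excludes ties. -/
theorem IsCAT0.lt_iff_of_hyp_eq (hK : K.IsCAT0) {u v u' v' : V} (h : K.graph.Adj u v)
    (h' : K.graph.Adj u' v') (heq : hyp h = hyp h') :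
    (∀ x, K.graph.dist x u < K.graph.dist x v ↔ K.graph.dist x u' < K.graph.dist x v') ∨
    (∀ x, K.graph.dist x u < K.graph.dist x v ↔ ¬ K.graph.dist x u' < K.graph.dist x v') := by
  have key : ∀ e e' : K.Edge, Relation.EqvGen K.Opposite e e' → ∀ u ∈ e.1, ∀ v ∈ e.1, ∀ u' ∈ e'.1,
      ∀ v' ∈ e'.1, K.graph.Adj u v → K.graph.Adj u' v' →
      (∀ x, K.graph.dist x u < K.graph.dist x v ↔ K.graph.dist x u' < K.graph.dist x v') ∨
      (∀ x, K.graph.dist x u < K.graph.dist x v ↔ ¬ K.graph.dist x u' < K.graph.dist x v') := by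
    have same : ∀ e : K.Edge, ∀ u ∈ e.1, ∀ v ∈ e.1, ∀ u' ∈ e.1,
      ∀ v' ∈ e.1, K.graph.Adj u v → K.graph.Adj u' v' →
      (∀ x, K.graph.dist x u < K.graph.dist x v ↔ K.graph.dist x u' < K.graph.dist x v') ∨
      (∀ x, K.graph.dist x u < K.graph.dist x v ↔ ¬ K.graph.dist x u' < K.graph.dist x v') := by
      intro e u hu v hv u' hu' v' hv' h h'
      rcases (edge_mem_iff h.1 hu hv u').1 hu' with rfl | rfl <;>
        rcases (edge_mem_iff h.1 hu hv v').1 hv' with rfl | rfl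
      · exact absurd rfl h'.1
      · exact .inl fun x => Iff.rfl
      · refine .inr fun x => ?_
        have := hK.dist_of_adj x h
        omega
      · exact absurd rfl h'.1
    intro e e' hee
    induction hee with
    | rel e e' ho =>
      intro u hu v hv u' hu' v' hv' h h'
      obtain ⟨a, b, c, d, sq, ha, hb, hc, hd⟩ := ho.exists_isSquare
      have h1 := fun x => hK.lt_iff_of_isSquare x sq
      have h2 := same e u hu v hv a ha b hb h sq.1
      have h3 := same e' d hd c hc u' hu' v' hv' sq.2.2.2.1 h'
      rcases h2 with h2 | h2 <;> rcases h3 with h3 | h3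
      · exact .inl fun x => by rw [h2, h1, h3]
      · exact .inr fun x => by rw [h2, h1, h3]
      · exact .inr fun x => by rw [h2, h1, h3]
      · exact .inl fun x => by rw [h2, h1, h3, not_not]
    | refl e => exact same e
    | symm e e' _ ih =>
      intro u hu v hv u' hu' v' hv' h h'
      rcases ih u' hu' v' hv' u hu v hv h' h with h1 | h1
      · exact .inl fun x => (h1 x).symm
      · exact .inr fun x => by rw [h1 x, not_not]
    | trans e e' e'' _ _ ih1 ih2 =>
      intro u hu v hv u' hu' v' hv' h h'
      obtain ⟨a, b, ha, hb, hab⟩ := e'.exists_adj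
      rcases ih1 u hu v hv a ha b hb h hab with h1 | h1 <;>
        rcases ih2 a ha b hb u' hu' v' hv' hab h' with h2 | h2
      · exact .inl fun x => by rw [h1, h2]
      · exact .inr fun x => by rw [h1, h2]
      · exact .inr fun x => by rw [h1, h2]
      · exact .inl fun x => by rw [h1, h2, not_not]
  exact key _ _ (Quot.eqvGen_exact heq) u h.2.choose_spec.1 v h.2.choose_spec.2 u'
    h'.2.choose_spec.1 v' h'.2.choose_spec.2 h h'

theorem IsCAT0.dist_eq_one (hK : K.IsCAT0) {u v : V} (h : K.graph.Adj u v) :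
    K.graph.dist u v = 1 := by
  have := hK.dist_of_adj u h
  simp at this
  omega

/-- An edge whose end points lie on different sides of another edge is cut by the same
hyperplane. -/
theorem IsCAT0.hyp_eq_of_crossing (hK : K.IsCAT0) {x y : V} (hxy : K.graph.Adj x y) :
    ∀ {u v : V} (h : K.graph.Adj u v), K.graph.dist x u < K.graph.dist x v →
    K.graph.dist y v < K.graph.dist y u → hyp h = hyp hxy := by
  have main : ∀ n : ℕ, ∀ {u v : V} (h : K.graph.Adj u v), K.graph.dist x u = n →
      K.graph.dist x u < K.graph.dist x v →
      K.graph.dist y v < K.graph.dist y u → hyp h = hyp hxy := by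
    intro n
    induction n with
    | zero =>
      intro u v h hn h1 h2
      have hxu := (hK.1.1 x u).dist_eq_zero_iff.1 hn
      subst hxu
      have h3 := hK.dist_eq_one hxy.symm
      have hyv : K.graph.dist y v = 0 := by omega
      have := (hK.1.1 y v).dist_eq_zero_iff.1 hyv
      subst this
      rfl
    | succ n ih =>
      intro u v h hn h1 h2
      obtain ⟨l, hl, hlen⟩ := exists_geodesic hK x u
      cases hl with
      | nil => simp at hn
      | @cons u' _ l' ha hl' =>
        have e1 := hl'.dist_le
        simp at hlen
        have a1 := hK.dist_of_adj x ha
        have a2 := hK.dist_of_adj x h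
        have a3 := hK.dist_of_adj y h
        have a4 := hK.dist_of_adj y ha
        have b1 := hK.dist_of_adj u hxy
        have b2 := hK.dist_of_adj v hxy
        have b3 := hK.dist_of_adj u' hxy
        simp only [K.graph.dist_comm (v := x), K.graph.dist_comm (v := y)] at b1 b2 b3
        have hlt : K.graph.dist y u' < K.graph.dist y u := by omega
        -- The edge is pushed across the square that it spans with the last step of a geodesic from
        -- `x` to `u`; the opposite edge is one step closer to `x`.
        obtain ⟨v', sq, hv'⟩ := hK.quadrangle y ha h.symm hlt h2 (by rintro rfl; omega)
        have side2 := hK.lt_iff_of_isSquare x sq.rot.rot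
        have e3 : hyp sq.rot.rot.1 = hyp sq.rot.rot.2.2.2.1 := sq.rot.rot.hyp_eq
        have := ih (u := u') (v := v') sq.1.symm (by omega) (by omega) (by
          have := hK.dist_of_adj y sq.1
          omega)
        exact e3.trans this
  intro u v h
  exact main _ h rfl

/-- One of the two sides of the hyperplane `H`. -/
def side (H : K.Hyperplane) (x : V) : Prop :=
  K.graph.dist x (exists_hyp_eq H).choose < K.graph.dist x (exists_hyp_eq H).choose_spec.choose

theorem IsCAT0.side_iff (hK : K.IsCAT0) {u v : V} (h : K.graph.Adj u v) :
    (∀ x, side (hyp h) x ↔ K.graph.dist x u < K.graph.dist x v) ∨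
    (∀ x, side (hyp h) x ↔ ¬ K.graph.dist x u < K.graph.dist x v) :=
  hK.lt_iff_of_hyp_eq (exists_hyp_eq (hyp h)).choose_spec.choose_spec.choose h
    (exists_hyp_eq (hyp h)).choose_spec.choose_spec.choose_spec

/-- An edge separates its own ends, by distances 0 and 1; that no other hyperplane separates them is
`hyp_eq_of_crossing`. All later separation arguments rest on this. -/
theorem IsCAT0.side_ne_iff (hK : K.IsCAT0) {x y : V} (h : K.graph.Adj x y) (H : K.Hyperplane) :
    ¬ (side H x ↔ side H y) ↔ hyp h = H := by
  constructor
  · intro hs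
    obtain ⟨u, v, huv, rfl⟩ := exists_hyp_eq H
    have h1 := hK.dist_of_adj x huv
    have h2 := hK.dist_of_adj y huv
    have hne : ¬ (K.graph.dist x u < K.graph.dist x v ↔ K.graph.dist y u < K.graph.dist y v) := by
      rcases hK.side_iff huv with h3 | h3 <;> rw [h3, h3] at hs <;> tauto
    by_cases h4 : K.graph.dist x u < K.graph.dist x v
    · exact (hK.hyp_eq_of_crossing h huv h4 (by by_contra; exact hne ⟨fun _ => by omega, fun _ => h4⟩)).symm
    · rw [← hyp_symm huv]
      exact (hK.hyp_eq_of_crossing h huv.symm (by omega)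
        (by by_contra; exact hne ⟨fun h => absurd h h4, fun h => absurd h (by omega)⟩)).symm
  · rintro rfl
    have e1 := hK.dist_eq_one h
    have e2 := hK.dist_eq_one h.symm
    rcases hK.side_iff h with h3 | h3 <;> rw [h3, h3] <;> simp [e1, e2]

/-- The hyperplane `H` lies between `x` and `P`. -/
def Far (P : V) (H : K.Hyperplane) (x : V) : Prop := ¬ (side H x ↔ side H P)

theorem IsCAT0.far_iff (hK : K.IsCAT0) (P : V) {u v : V} (h : K.graph.Adj u v) :
    Far P (hyp h) u ↔ K.graph.dist P v < K.graph.dist P u := by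
  have e1 := hK.dist_eq_one h
  have e2 := hK.dist_of_adj P h
  unfold Far
  rcases hK.side_iff h with h3 | h3 <;> rw [h3, h3] <;> simp [e1] <;> omega

/-- By parity, a neighbour `b ≠ a` of `v` is farther from `a` than from `v`. So the edge from `v` to
`b` stays on the side of `v` and does not cross the hyperplane of the edge from `v` to `a`. -/
theorem IsCAT0.eq_of_hyp_eq (hK : K.IsCAT0) {v a b : V} (ha : K.graph.Adj v a)
    (hb : K.graph.Adj v b) (h : hyp ha = hyp hb) : a = b := by
  by_contra hne
  have h1 := (hK.side_ne_iff hb (hyp ha)).2 h.symm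
  have e1 := hK.dist_eq_one ha
  have e2 := hK.dist_eq_one hb.symm
  have e3 := hK.dist_of_adj b ha
  have e4 : K.graph.dist b a ≠ 0 := fun h0 => hne ((hK.1.1 b a).dist_eq_zero_iff.1 h0).symm
  rcases hK.side_iff ha with h3 | h3 <;> rw [h3, h3] at h1 <;> simp [e1] at h1 <;> omega

theorem IsCAT0.exists_closer (hK : K.IsCAT0) (P : V) {v : V} (h : v ≠ P) :
    ∃ a, K.graph.Adj v a ∧ K.graph.dist P a < K.graph.dist P v := by
  obtain ⟨l, hl, hlen⟩ := exists_geodesic hK P v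
  cases hl with
  | nil => exact absurd rfl h
  | @cons a _ l' ha hl' =>
    have := hl'.dist_le
    simp at hlen
    exact ⟨a, ha.symm, by omega⟩

/-- A path that avoids `H` never changes sides. Conversely, a vertex on the side of `P` can descend
to `P`: a descending edge cut by `H` would start on the far side. -/
theorem IsCAT0.reachable_iff (hK : K.IsCAT0) (H : K.Hyperplane) (v P : V) :
    (avoid H).Reachable v P ↔ ¬ Far P H v := by
  constructor
  · rintro ⟨p⟩
    induction p with
    | nil => simp [Far]
    | cons h p ih =>
      obtain ⟨hne, e, hu, hv, heH⟩ := h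
      have hadj : K.graph.Adj _ _ := ⟨hne, e, hu, hv⟩
      rw [mk_eq_hyp hadj hu hv] at heH
      have := mt (hK.side_ne_iff hadj H).1 heH
      simp only [Far, not_not] at ih this ⊢
      exact this.trans ih
  · intro hf
    have main : ∀ n : ℕ, ∀ v, K.graph.dist P v = n → ¬ Far P H v → (avoid H).Reachable v P := by
      intro n
      induction n using Nat.strong_induction_on with
      | _ n ih =>
      intro v hn hf
      by_cases hv : v = P
      · subst hv; exact SimpleGraph.Reachable.refl _
      obtain ⟨a, ha, hd⟩ := hK.exists_closer P hv
      have hne : hyp ha ≠ H := by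
        rintro rfl
        exact hf ((hK.far_iff P ha).2 hd)
      have hs := mt (hK.side_ne_iff ha H).1 hne
      have hadj : (avoid H).Adj v a := by
        obtain ⟨e, hv', ha'⟩ := ha.2
        exact ⟨ha.1, e, hv', ha', by rwa [mk_eq_hyp ha hv' ha']⟩
      refine hadj.reachable.trans (ih _ (by omega) a rfl ?_)
      simp only [Far, not_not] at hf hs ⊢
      exact hs.symm.trans hf
    exact main _ v rfl hf

theorem IsCAT0.separates_iff (hK : K.IsCAT0) (H : K.Hyperplane) (C : K.Cube) (P : V) :
    Separates H C P ↔ H ∉ Mid C ∧ ∀ v ∈ C.1, Far P H v := by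
  simp only [Separates, hK.reachable_iff, not_not]

theorem mid_vertex (v : V) : Mid (vertex v : K.Cube) = ∅ := by
  ext H
  simp only [Mid, vertex, Set.mem_ofPred_eq, Set.mem_empty_iff_false, iff_false, not_exists, not_and]
  intro e he
  have := Finset.card_le_card he
  rw [e.2.2] at this
  simp at this

/-! ### The hyperplanes that cut a cube -/

namespace CubeChart

variable {s : Finset V} {v : V} (c : CubeChart K s v)

theorem adj_singleton (i : Fin c.q) : K.graph.Adj v (c.ψ {i}) := by
  have := c.adj_symmDiff ∅ i
  rwa [c.base, empty_symmDiff_finset] at this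

/-- Adding one direction to `X` moves the edge across a square, or reverses it if that direction is
`i`. -/
theorem hyp_eq_of_symmDiff (i : Fin c.q) (X : Finset (Fin c.q)) :
    hyp (c.adj_symmDiff X i) = hyp (c.adj_singleton i) := by
  classical
  have congr : ∀ {a b a' b' : V} (h : K.graph.Adj a b) (h' : K.graph.Adj a' b'), a = a' → b = b' →
      hyp h = hyp h' := by rintro a b _ _ h h' rfl rfl; rfl
  induction X using Finset.induction_on with
  | empty => exact congr _ _ c.base (by rw [empty_symmDiff_finset])
  | insert j X hj ih =>
    have hX : insert j X = X ∆ {j} := by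
      ext k
      simp only [Finset.mem_insert, Finset.mem_symmDiff, Finset.mem_singleton]
      by_cases hk : k = j
      · subst hk; simp [hj]
      · simp [hk]
    rw [← ih]
    by_cases hij : i = j
    · subst hij
      rw [← hyp_symm (c.adj_symmDiff X i)]
      exact congr _ _ (by rw [hX]) (by rw [hX, symmDiff_symmDiff_cancel_right])
    · have := (c.isSquare X hij).hyp_eq
      rw [this]
      exact congr _ _ (by rw [hX]) (by rw [hX, symmDiff_right_comm])

end CubeChart

theorem mem_mid_iff {C : K.Cube} {v : V} (c : CubeChart K C.1 v) (H : K.Hyperplane) :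
    H ∈ Mid C ↔ ∃ i, hyp (c.adj_singleton i) = H := by
  constructor
  · rintro ⟨e, he, rfl⟩
    obtain ⟨a, b, ha, hb, hab⟩ := e.exists_adj
    obtain ⟨X, rfl⟩ := (c.mem_iff a).1 (he ha)
    obtain ⟨Y, rfl⟩ := (c.mem_iff b).1 (he hb)
    obtain ⟨i, rfl⟩ := c.eq_symmDiff_of_adj hab
    exact ⟨i, by rw [mk_eq_hyp hab ha hb, ← c.hyp_eq_of_symmDiff i X]⟩
  · rintro ⟨i, rfl⟩
    obtain ⟨e, he, h1, h2⟩ := c.exists_edge ∅ i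
    rw [c.base] at h1
    rw [empty_symmDiff_finset] at h2
    exact ⟨e, he, mk_eq_hyp _ h1 h2⟩

theorem mem_mid_iff_exists_adj {C : K.Cube} {v : V} (hv : v ∈ C.1)
    (H : K.Hyperplane) : H ∈ Mid C ↔ ∃ a ∈ C.1, ∃ h : K.graph.Adj v a, hyp h = H := by
  obtain ⟨c⟩ := nonempty_cubeChart C.2 hv
  rw [mem_mid_iff c]
  constructor
  · rintro ⟨i, h⟩
    exact ⟨_, c.mem _, _, h⟩
  · rintro ⟨a, ha, h, rfl⟩
    obtain ⟨i, rfl⟩ := c.exists_eq_singleton ha h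
    exact ⟨i, rfl⟩

/-- The directions of a chart at a vertex are cut by different hyperplanes, by `eq_of_hyp_eq`, so
the dimension counts hyperplanes. -/
theorem IsCAT0.card_eq (hK : K.IsCAT0) (C : K.Cube) : C.1.card = 2 ^ (Mid C).ncard := by
  obtain ⟨v, hv⟩ : ∃ v, v ∈ C.1 := by
    obtain ⟨q, φ, _, h, _⟩ := K.exists_chart C.1 C.2
    exact ⟨φ fun _ => true, by rw [← Finset.mem_coe, ← h]; exact ⟨_, rfl⟩⟩
  obtain ⟨c⟩ := nonempty_cubeChart C.2 hv
  have hinj : Function.Injective fun i => hyp (c.adj_singleton i) := fun i j h =>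
    Finset.singleton_injective (c.inj (hK.eq_of_hyp_eq _ _ h))
  have : Mid C = Set.range fun i => hyp (c.adj_singleton i) := by
    ext H; rw [mem_mid_iff c]; rfl
  rw [this, ← Set.image_univ, Set.ncard_image_of_injective _ hinj, Set.ncard_univ, Nat.card_fin,
    c.card_eq]

theorem exists_mem_cube (C : K.Cube) : ∃ v, v ∈ C.1 := by
  obtain ⟨q, φ, _, h, _⟩ := K.exists_chart C.1 C.2
  exact ⟨φ fun _ => true, by rw [← Finset.mem_coe, ← h]; exact ⟨_, rfl⟩⟩

theorem IsCAT0.side_iff_of_notMem_mid (hK : K.IsCAT0) {C : K.Cube} {H : K.Hyperplane}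
    (hH : H ∉ Mid C) {x y : V} (hx : x ∈ C.1) (hy : y ∈ C.1) : side H x ↔ side H y := by
  classical
  obtain ⟨c⟩ := nonempty_cubeChart C.2 hx
  obtain ⟨Y, rfl⟩ := (c.mem_iff y).1 hy
  clear hy
  induction Y using Finset.induction_on with
  | empty => rw [c.base]
  | insert j X hj ih =>
    have hX : insert j X = X ∆ {j} := by
      ext k
      simp only [Finset.mem_insert, Finset.mem_symmDiff, Finset.mem_singleton]
      by_cases hk : k = j
      · subst hk; simp [hj]
      · simp [hk]
    rw [hX]
    refine ih.trans (not_not.1 (mt (hK.side_ne_iff (c.adj_symmDiff X j) H).1 fun h => hH ?_))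
    rw [c.hyp_eq_of_symmDiff] at h
    exact (mem_mid_iff c H).2 ⟨j, h⟩

theorem IsCAT0.exists_side_ne (hK : K.IsCAT0) {x y : V} (h : x ≠ y) :
    ∃ H : K.Hyperplane, ¬ (side H x ↔ side H y) := by
  obtain ⟨a, ha, hd⟩ := hK.exists_closer y h
  exact ⟨hyp ha, (hK.far_iff y ha).2 hd⟩

/-! ### The cubes that lead a vertex to the base vertex -/

theorem IsCAT0.mem_sah_vertex_iff (hK : K.IsCAT0) (P Q : V) (H : K.Hyperplane) :
    H ∈ SAH P (vertex Q) ↔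
      ∃ a, ∃ h : K.graph.Adj Q a, hyp h = H ∧ K.graph.dist P a < K.graph.dist P Q := by
  have hsep : Separates H (vertex Q : K.Cube) P ↔ Far P H Q := by
    rw [hK.separates_iff, mid_vertex]
    simp [vertex]
  simp only [SAH, Set.mem_ofPred_eq, hsep, IsAdjacent, mid_vertex, Set.mem_empty_iff_false,
    not_false_eq_true, true_and]
  constructor
  · rintro ⟨⟨D, ⟨hD1, hD2⟩, hD3⟩, hf⟩
    have hQ : Q ∈ D.1 := hD1 (by simp [vertex])
    obtain ⟨a, ha, h, rfl⟩ := (mem_mid_iff_exists_adj hQ H).1 hD3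
    exact ⟨a, h, rfl, (hK.far_iff P h).1 hf⟩
  · rintro ⟨a, h, rfl, hd⟩
    refine ⟨?_, (hK.far_iff P h).2 hd⟩
    obtain ⟨e, hQ, ha⟩ := h.2
    exact ⟨⟨e.1, e.2.1⟩, ⟨by simpa [vertex] using hQ, by simp [vertex, e.2.2]⟩, e, subset_rfl,
      mk_eq_hyp h hQ ha⟩

theorem IsCAT0.far_of_mem_sah (hK : K.IsCAT0) {P Q : V} {H : K.Hyperplane}
    (h : H ∈ SAH P (vertex Q)) : Far P H Q := by
  obtain ⟨a, h', rfl, hd⟩ := (hK.mem_sah_vertex_iff P Q H).1 h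
  exact (hK.far_iff P h').2 hd

theorem IsCAT0.mem_sah_of_far (hK : K.IsCAT0) {P Q : V} {C : K.Cube} (hQ : Q ∈ C.1)
    {H : K.Hyperplane} (hH : H ∈ Mid C) (hf : Far P H Q) : H ∈ SAH P (vertex Q) := by
  obtain ⟨a, _, h, rfl⟩ := (mem_mid_iff_exists_adj hQ H).1 hH
  exact (hK.mem_sah_vertex_iff P Q _).2 ⟨a, h, rfl, (hK.far_iff P h).1 hf⟩

/-- A vertex of `C` farthest from `P` works, since every edge of `C` at it descends. -/
theorem IsCAT0.exists_leads (hK : K.IsCAT0) (P : V) (C : K.Cube) : ∃ Q, Leads P Q C := by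
  obtain ⟨Q, hQ, hmax⟩ := C.1.exists_max_image (fun v => K.graph.dist P v) (exists_mem_cube C)
  refine ⟨Q, hQ, fun H hH => ?_⟩
  obtain ⟨a, ha, h, rfl⟩ := (mem_mid_iff_exists_adj hQ H).1 hH
  refine (hK.mem_sah_vertex_iff P Q _).2 ⟨a, h, rfl, ?_⟩
  have := hmax a ha
  have := hK.dist_of_adj P h
  omega

/-- A hyperplane between two such vertices would have to cut `C`, hence separate both of them from
`P`; but only one of them can lie on the side away from `P`. -/
theorem IsCAT0.leads_unique (hK : K.IsCAT0) {P Q Q' : V} {C : K.Cube} (h : Leads P Q C)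
    (h' : Leads P Q' C) : Q = Q' := by
  by_contra hne
  obtain ⟨H, hH⟩ := hK.exists_side_ne hne
  by_cases hC : H ∈ Mid C
  · have h1 := hK.far_of_mem_sah (h.2 hC)
    have h2 := hK.far_of_mem_sah (h'.2 hC)
    unfold Far at h1 h2
    tauto
  · exact hH (hK.side_iff_of_notMem_mid hC h.1 h'.1)

/-- A hyperplane determines its edge at `Q`, so the face `C ∩ D` of `C` contains all edges of `C` at
`Q`. A face that contains a vertex and all edges at it is the whole cube. -/
theorem IsCAT0.subset_of_mid_subset (hK : K.IsCAT0) {C D : K.Cube} {Q : V} (hC : Q ∈ C.1)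
    (hD : Q ∈ D.1) (h : Mid C ⊆ Mid D) : C.1 ⊆ D.1 := by
  classical
  obtain ⟨c⟩ := nonempty_cubeChart C.2 hC
  obtain ⟨r, hr, hrCD⟩ := K.exists_inter C.1 C.2 D.1 D.2 ⟨Q, hC, hD⟩
  have hmem : ∀ x, x ∈ r ↔ x ∈ C.1 ∧ x ∈ D.1 := fun x => by
    rw [← Finset.mem_coe, hrCD]; rfl
  obtain ⟨M, A, hM⟩ := (c.face_iff r fun x hx => ((hmem x).1 hx).1).1 hr
  have hA : A ⊆ M := by
    obtain ⟨X, hX, hXA⟩ := (hM (c.ψ ∅)).1 ((hmem _).2 ⟨c.mem _, by rw [c.base]; exact hD⟩)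
    have := c.inj hXA
    rwa [← symmDiff_eq_bot.1 this.symm]
  have huniv : ∀ i, i ∈ M := by
    intro i
    obtain ⟨b, hb, hadj, hbH⟩ := (mem_mid_iff_exists_adj hD _).1 (h ((mem_mid_iff c _).2 ⟨i, rfl⟩))
    have hbi := hK.eq_of_hyp_eq _ _ hbH
    subst hbi
    obtain ⟨X, hX, hXA⟩ := (hM _).1 ((hmem _).2 ⟨c.mem {i}, hb⟩)
    have hi : i ∈ X ∆ A := by rw [← c.inj hXA]; simp
    rcases Finset.mem_symmDiff.1 hi with h | h
    exacts [hX h.1, hA h.1]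
  intro x hx
  obtain ⟨X, rfl⟩ := (c.mem_iff x).1 hx
  exact ((hmem _).1 ((hM _).2 ⟨X ∆ A, fun i _ => huniv i, by
    rw [symmDiff_symmDiff_cancel_right]⟩)).2

theorem IsCAT0.cube_eq_of_mid_eq (hK : K.IsCAT0) {C D : K.Cube} {Q : V} (hC : Q ∈ C.1)
    (hD : Q ∈ D.1) (h : Mid C = Mid D) : C = D :=
  Subtype.ext ((hK.subset_of_mid_subset hC hD h.subset).antisymm
    (hK.subset_of_mid_subset hD hC h.symm.subset))

/-- The hyperplanes in `S` cut descending edges at `Q`, any two of which span a square by the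
quadrangle condition; flag links fill in the cube. The number of vertices leaves no room for further
directions. -/
theorem IsCAT0.exists_cube (hK : K.IsCAT0) {P Q : V} {S : Finset K.Hyperplane}
    (hS : ↑S ⊆ SAH P (vertex Q : K.Cube)) : ∃ C : K.Cube, Q ∈ C.1 ∧ Mid C = S := by
  classical
  have hch := fun H : S => (hK.mem_sah_vertex_iff P Q H).1 (hS H.2)
  choose a ha haH had using hch
  have hinj : Function.Injective a := fun H H' h => by
    apply Subtype.ext
    rw [← haH H, ← haH H']
    congr 1
  let A : Finset V := Finset.univ.image a
  have hA : ∀ x ∈ A, ∃ H, a H = x := fun x hx => by simpa [A] using hx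
  obtain ⟨s, hs, hQ, hAs, hcard⟩ := hK.2 Q A
    (by
      intro x hx
      obtain ⟨H, rfl⟩ := hA x hx
      exact ha H)
    (by
      intro x hx y hy hxy
      obtain ⟨H, rfl⟩ := hA x hx
      obtain ⟨H', rfl⟩ := hA y hy
      obtain ⟨z, ⟨_, _, _, _, _, _, s, hs, hc, _, h1, h2, h3⟩, _⟩ :=
        hK.quadrangle P (ha H).symm (ha H').symm (had H) (had H') hxy
      exact ⟨s, hs, hc, h2, h1, h3⟩)
  refine ⟨⟨s, hs⟩, hQ, ?_⟩
  obtain ⟨c⟩ := nonempty_cubeChart hs hQ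
  have hcq : c.q = A.card := by
    have := c.card_eq
    rw [hcard] at this
    exact (Nat.pow_right_injective (le_refl 2) this).symm
  have himg : A = Finset.univ.image fun i => c.ψ {i} := by
    refine Finset.eq_of_subset_of_card_le ?_ ?_
    · intro x hx
      obtain ⟨H, rfl⟩ := hA x hx
      obtain ⟨i, hi⟩ := c.exists_eq_singleton (hAs hx) (ha H)
      simp only [Finset.mem_image, Finset.mem_univ, true_and]
      exact ⟨i, hi⟩
    · refine Finset.card_image_le.trans ?_
      simp [hcq]
  have hyp_congr : ∀ {x y : V} (h : K.graph.Adj Q x) (h' : K.graph.Adj Q y), x = y →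
      hyp h = hyp h' := by rintro x _ h h' rfl; rfl
  ext H
  rw [mem_mid_iff_exists_adj (C := ⟨s, hs⟩) hQ, Finset.mem_coe]
  constructor
  · rintro ⟨x, hx, h, rfl⟩
    obtain ⟨i, rfl⟩ := c.exists_eq_singleton hx h
    have : c.ψ {i} ∈ A := by rw [himg]; simp
    obtain ⟨H, hH⟩ := hA _ this
    rw [← hyp_congr (ha H) h hH, haH]
    exact H.2
  · intro hH
    exact ⟨a ⟨H, hH⟩, hAs (by simp [A]), ha _, haH _⟩

theorem HasBoundedGeometry.finite_sah (hK' : K.HasBoundedGeometry) (hK : K.IsCAT0) (P Q : V) :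
    (SAH P (vertex Q : K.Cube)).Finite := by
  obtain ⟨N, hN⟩ := hK'
  have hf : {e : K.Edge | Q ∈ e.1}.Finite :=
    Set.finite_of_encard_le_coe (hN Q)
  refine (hf.image fun e => (Quot.mk _ e : K.Hyperplane)).subset fun H hH => ?_
  obtain ⟨a, h, rfl, _⟩ := (hK.mem_sah_vertex_iff P Q H).1 hH
  exact ⟨_, h.2.choose_spec.1, rfl⟩

/-- The hypothesis says that `x` is not on a geodesic from `P` to `y`. Take a step from `x` towards
`y`. If it descends towards `P`, it is the answer; if it ascends, the new vertex has a common
descent by induction, and the quadrangle condition there carries this descent back to `x`. -/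
theorem IsCAT0.exists_common_closer (hK : K.IsCAT0) (P y : V) : ∀ {x : V},
    K.graph.dist P y < K.graph.dist P x + K.graph.dist y x →
    ∃ a, K.graph.Adj x a ∧ K.graph.dist P a < K.graph.dist P x ∧
      K.graph.dist y a < K.graph.dist y x := by
  have main : ∀ n : ℕ, ∀ x, K.graph.dist y x = n →
      K.graph.dist P y < K.graph.dist P x + K.graph.dist y x →
      ∃ a, K.graph.Adj x a ∧ K.graph.dist P a < K.graph.dist P x ∧
      K.graph.dist y a < K.graph.dist y x := by
    intro n
    induction n using Nat.strong_induction_on with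
    | _ n ih =>
    intro x hn hlt
    by_cases hxy : x = y
    · subst hxy; simp at hlt
    obtain ⟨b, hb, hbd⟩ := hK.exists_closer y hxy
    rcases hK.dist_of_adj P hb with h1 | h1
    · have h2 := hK.dist_of_adj y hb
      obtain ⟨c, hc, hcP, hcy⟩ := ih _ (by omega) b rfl (by omega)
      obtain ⟨a, sq, ha⟩ := hK.quadrangle P hb hc.symm (by omega) hcP (by rintro rfl; omega)
      have h3 := hK.dist_of_adj y sq.2.2.1
      have h4 := hK.dist_of_adj y hc
      have h5 := hK.dist_of_adj y sq.1
      exact ⟨a, sq.1.symm, by omega, by omega⟩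
    · exact ⟨b, hb, by omega, hbd⟩
  intro x
  exact main _ x rfl

/-- If the two sets agree, no edge at `Q` can approach both `P` and `Q'`: its hyperplane would
separate `Q` from `Q'` and yet separate both from `P`. So `Q` lies on a geodesic from `P` to `Q'`,
and by symmetry conversely. Finiteness of the low spectrum depends on this. -/
theorem IsCAT0.sah_vertex_injective (hK : K.IsCAT0) (P : V) :
    Function.Injective fun Q : V => SAH P (vertex Q : K.Cube) := by
  have main : ∀ Q Q' : V, SAH P (vertex Q : K.Cube) = SAH P (vertex Q') →
      K.graph.dist P Q + K.graph.dist Q' Q ≤ K.graph.dist P Q' := by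
    intro Q Q' h
    by_contra hlt
    obtain ⟨a, ha, h1, h2⟩ := hK.exists_common_closer P Q' (not_le.1 hlt)
    have hm : hyp ha ∈ SAH P (vertex Q) := (hK.mem_sah_vertex_iff P Q _).2 ⟨a, ha, rfl, h1⟩
    have f1 := hK.far_of_mem_sah hm
    rw [h] at hm
    have f2 := hK.far_of_mem_sah hm
    have f3 := (hK.far_iff Q' ha).2 h2
    unfold Far at f1 f2 f3
    tauto
  intro Q Q' h
  have h1 := main Q Q' h
  have h2 := main Q' Q h.symm
  exact ((hK.1.1 Q' Q).dist_eq_zero_iff.1 (by omega)).symm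

/-! ### Steps between cubes of a block -/

namespace Step

variable {P Q : V} {C D : K.Cube}

theorem mid_eq (hK : K.IsCAT0) (s : Step P C D) : Mid D = insert s.H (Mid C) := by
  have hsub : Mid C ⊆ Mid D := fun H ⟨e, he, h⟩ => ⟨e, he.trans s.facet.1, h⟩
  have hn : s.H ∉ Mid C := s.mem_sah.1.1
  symm
  refine Set.eq_of_subset_of_ncard_le (Set.insert_subset s.mem_mid hsub) ?_ (finite_mid D)
  rw [Set.ncard_insert_of_notMem hn (finite_mid C)]
  have := s.facet.2
  rw [hK.card_eq, hK.card_eq, ← pow_succ'] at this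
  exact (Nat.pow_right_injective (le_refl 2) this).le

theorem notMem_mid (s : Step P C D) : s.H ∉ Mid C := s.mem_sah.1.1

theorem mem_sah_vertex (hK : K.IsCAT0) (s : Step P C D) (h : Leads P Q C) :
    s.H ∈ SAH P (vertex Q) :=
  hK.mem_sah_of_far (s.facet.1 h.1) s.mem_mid (((hK.separates_iff _ _ _).1 s.mem_sah.2).2 Q h.1)

theorem leads (hK : K.IsCAT0) (s : Step P C D) (h : Leads P Q C) : Leads P Q D := by
  refine ⟨s.facet.1 h.1, ?_⟩
  rw [s.mid_eq hK]
  exact Set.insert_subset (s.mem_sah_vertex hK h) h.2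

/-- The summands `e_w` and `e_w^⋄` respect the blocks. Backwards, the vertex that `C` leads is also
led by `D`, hence it is `Q` by uniqueness. -/
theorem leads_iff (hK : K.IsCAT0) (s : Step P C D) : Leads P Q D ↔ Leads P Q C := by
  refine ⟨fun h => ?_, s.leads hK⟩
  obtain ⟨Q', hQ'⟩ := hK.exists_leads P C
  rwa [hK.leads_unique h (s.leads hK hQ')]

theorem eq_of_H_eq {s s' : Step P C D} (h : s.H = s'.H) : s = s' := by
  cases s; cases s'; cases h; rfl

theorem subsingleton (hK : K.IsCAT0) : Subsingleton (Step P C D) := by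
  refine ⟨fun s s' => eq_of_H_eq ?_⟩
  have : s.H ∈ insert s'.H (Mid C) := by rw [← s'.mid_eq hK]; exact s.mem_mid
  exact this.resolve_right s.notMem_mid

theorem injective_out (hK : K.IsCAT0) (P : V) (C : K.Cube) :
    Function.Injective fun s : (Σ D : K.Cube, Step P C D) => s.2.H := by
  rintro ⟨D, s⟩ ⟨D', s'⟩ h
  dsimp only at h
  obtain ⟨v, hv⟩ := exists_mem_cube C
  have : D = D' := hK.cube_eq_of_mid_eq (s.facet.1 hv) (s'.facet.1 hv)
    (by rw [s.mid_eq hK, s'.mid_eq hK, h])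
  subst this
  rw [eq_of_H_eq h]

theorem injective_in (hK : K.IsCAT0) (P : V) (D : K.Cube) :
    Function.Injective fun s : (Σ C : K.Cube, Step P C D) => s.2.H := by
  rintro ⟨C, s⟩ ⟨C', s'⟩ h
  dsimp only at h
  obtain ⟨Q, hQ⟩ := hK.exists_leads P D
  have hm : Mid C = Mid C' := by
    rw [← Set.insert_sdiff_self_of_notMem s.notMem_mid, ← s.mid_eq hK,
      ← Set.insert_sdiff_self_of_notMem s'.notMem_mid, ← s'.mid_eq hK, h]
  have : C = C' := hK.cube_eq_of_mid_eq ((s.leads_iff hK).1 hQ).1 ((s'.leads_iff hK).1 hQ).1 hm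
  subst this
  rw [eq_of_H_eq h]

end Step

theorem IsCAT0.exists_step (hK : K.IsCAT0) {P Q : V} {C D : K.Cube} (hC : Leads P Q C)
    (hD : Leads P Q D) {H : K.Hyperplane} (hH : H ∉ Mid C) (h : Mid D = insert H (Mid C)) :
    ∃ s : Step P C D, s.H = H := by
  have hf : IsFacet C D := by
    refine ⟨hK.subset_of_mid_subset hC.1 hD.1 (by rw [h]; exact Set.subset_insert _ _), ?_⟩
    rw [hK.card_eq, hK.card_eq, h, Set.ncard_insert_of_notMem hH (finite_mid C), pow_succ']
  have hm : H ∈ Mid D := by rw [h]; exact Set.mem_insert _ _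
  refine ⟨⟨H, ⟨⟨hH, D, hf, hm⟩, (hK.separates_iff _ _ _).2 ⟨hH, fun v hv => ?_⟩⟩, hm, hf⟩, rfl⟩
  have := hK.far_of_mem_sah (hD.2 hm)
  unfold Far at this ⊢
  rwa [hK.side_iff_of_notMem_mid hH hv hC.1]

/-- The cube `D_H` exists for each unused `H` in SAH(`Q`), since every subset of SAH(`Q`) is
realized by a cube. -/
theorem IsCAT0.range_step_out (hK : K.IsCAT0) (hK' : K.HasBoundedGeometry) {P Q : V} {C : K.Cube}
    (hC : Leads P Q C) :
    Set.range (fun s : (Σ D : K.Cube, Step P C D) => s.2.H) = SAH P (vertex Q) \ Mid C := by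
  ext H
  constructor
  · rintro ⟨⟨D, s⟩, rfl⟩
    exact ⟨s.mem_sah_vertex hK hC, s.notMem_mid⟩
  · rintro ⟨h1, h2⟩
    have hsub : insert H (Mid C) ⊆ SAH P (vertex Q) := Set.insert_subset h1 hC.2
    obtain ⟨D, hQ, hD⟩ := hK.exists_cube (S := ((hK'.finite_sah hK P Q).subset hsub).toFinset)
      (by simpa using hsub)
    rw [Set.Finite.coe_toFinset] at hD
    obtain ⟨s, hs⟩ := hK.exists_step hC ⟨hQ, by rw [hD]; exact hsub⟩ h2 hD
    exact ⟨⟨D, s⟩, hs⟩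

/-- Removing `H` from `Mid D` leaves a subset of SAH(`Q`), realized by the face of `D` at `Q` in the
remaining directions. -/
theorem IsCAT0.range_step_in (hK : K.IsCAT0) {P Q : V} {D : K.Cube}
    (hD : Leads P Q D) :
    Set.range (fun s : (Σ C : K.Cube, Step P C D) => s.2.H) = Mid D := by
  ext H
  constructor
  · rintro ⟨⟨C, s⟩, rfl⟩
    exact s.mem_mid
  · intro h
    have hsub : Mid D \ {H} ⊆ SAH P (vertex Q) := Set.sdiff_subset.trans hD.2
    obtain ⟨C, hQ, hC⟩ := hK.exists_cube (S := ((finite_mid D).subset Set.sdiff_subset).toFinset)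
      (by rw [Set.Finite.coe_toFinset]; exact hsub)
    rw [Set.Finite.coe_toFinset] at hC
    obtain ⟨s, hs⟩ := hK.exists_step (H := H) ⟨hQ, by rw [hC]; exact hsub⟩ hD
      (by rw [hC]; exact fun h => h.2 rfl)
      (by rw [hC, Set.insert_sdiff_singleton, Set.insert_eq_of_mem h])
    exact ⟨⟨C, s⟩, hs⟩

end CubicalComplex

end

noncomputable section

set_option linter.unusedSectionVars false

/-! ### Operators with an orthonormal basis of eigenvectors -/

namespace UnboundedOp

variable {E : Type*} [NormedAddCommGroup E] [InnerProductSpace ℂ E] [CompleteSpace E]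
  {ι : Type*}

theorem hasSum_norm_inner_sq (b : HilbertBasis ι ℂ E) (x : E) :
    HasSum (fun i => ‖inner ℂ (b i) x‖ ^ 2) (‖x‖ ^ 2) := by
  have h := Complex.hasSum_re (b.hasSum_inner_mul_inner x x)
  rw [inner_self_eq_norm_sq_to_K] at h
  convert h using 1
  · funext i
    rw [← inner_conj_symm x (b i), Complex.conj_mul', ← Complex.ofReal_pow, Complex.ofReal_re]
  · norm_cast

theorem norm_le_of_norm_inner_le (b : HilbertBasis ι ℂ E) {x y : E} {c : ℝ} (hc : 0 ≤ c)
    (h : ∀ i, ‖inner ℂ (b i) x‖ ≤ c * ‖inner ℂ (b i) y‖) : ‖x‖ ≤ c * ‖y‖ := by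
  have h1 := hasSum_norm_inner_sq b x
  have h2 := (hasSum_norm_inner_sq b y).mul_left (c ^ 2)
  refine le_of_sq_le_sq ?_ (by positivity)
  rw [mul_pow]
  refine hasSum_le (fun i => ?_) h1 h2
  rw [← mul_pow]
  exact pow_le_pow_left₀ (norm_nonneg _) (h i) 2

theorem ext_inner_basis (b : HilbertBasis ι ℂ E) {x y : E}
    (h : ∀ i, inner ℂ (b i) x = inner ℂ (b i) y) : x = y := by
  apply b.repr.injective
  ext i
  rw [b.repr_apply_apply, b.repr_apply_apply, h]

/-- The bounded operator that multiplies the coefficients by a bounded family of scalars. -/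
theorem exists_diagonal (b : HilbertBasis ι ℂ E) (c : ι → ℂ) {M : ℝ} (hM : ∀ i, ‖c i‖ ≤ M) :
    ∃ R : E →L[ℂ] E, ∀ x i, inner ℂ (b i) (R x) = c i * inner ℂ (b i) x := by
  have hex : ∀ x : E, ∃ y : E, ∀ i, inner ℂ (b i) y = c i * inner ℂ (b i) x := by
    intro x
    have hmem : Memℓp (fun i => c i * b.repr x i) 2 := by
      have hx := (b.repr x).2
      refine memℓp_gen ?_
      have h2 : (2 : ENNReal).toReal = (2 : ℕ) := by norm_num
      have hs := (memℓp_gen_iff (p := 2) (by norm_num)).1 hx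
      simp only [h2, Real.rpow_natCast] at hs ⊢
      refine Summable.of_nonneg_of_le (fun i => by positivity) (fun i => ?_) (hs.mul_left (M ^ 2))
      rw [norm_mul, mul_pow]
      gcongr
      exact hM i
    refine ⟨b.repr.symm ⟨_, hmem⟩, fun i => ?_⟩
    rw [← b.repr_apply_apply, LinearIsometryEquiv.apply_symm_apply, ← b.repr_apply_apply]
  choose R hR using hex
  let L : E →ₗ[ℂ] E :=
    { toFun := R
      map_add' := fun x y => ext_inner_basis b fun i => by
        simp only [inner_add_right, hR, mul_add]
      map_smul' := fun a x => ext_inner_basis b fun i => by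
        simp only [inner_smul_right, hR, RingHom.id_apply]; ring }
  refine ⟨L.mkContinuous |M| fun x => ?_, hR⟩
  refine norm_le_of_norm_inner_le b (abs_nonneg M) fun i => ?_
  change ‖inner ℂ (b i) (R x)‖ ≤ _
  rw [hR, norm_mul]
  gcongr
  exact (hM i).trans (le_abs_self M)

variable {T : E →ₗ.[ℂ] E} (b : HilbertBasis ι ℂ E) (l : ι → ℝ)

/-- The graph of the diagonal operator with eigenvalues `l i`. -/
def diagGraph : Submodule ℂ (E × E) where
  carrier := {p | ∀ i, inner ℂ (b i) p.2 = l i * inner ℂ (b i) p.1}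
  add_mem' hx hy i := by simp only [Prod.fst_add, Prod.snd_add, inner_add_right, hx i, hy i, mul_add]
  zero_mem' i := by simp
  smul_mem' a x hx i := by
    simp only [Prod.smul_fst, Prod.smul_snd, inner_smul_right, hx i]; ring

theorem mem_diagGraph (p : E × E) :
    p ∈ diagGraph b l ↔ ∀ i, inner ℂ (b i) p.2 = l i * inner ℂ (b i) p.1 := Iff.rfl

theorem isClosed_diagGraph : IsClosed (diagGraph b l : Set (E × E)) := by
  have : (diagGraph b l : Set (E × E)) =
      ⋂ i, {p | inner ℂ (b i) p.2 = l i * inner ℂ (b i) p.1} := by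
    ext p; simp [mem_diagGraph]
  rw [this]
  exact isClosed_iInter fun i => isClosed_eq (by fun_prop) (by fun_prop)

theorem basis_mem_diagGraph (i : ι) : (b i, (l i : ℂ) • b i) ∈ diagGraph b l := by
  intro j
  simp only [inner_smul_right]
  by_cases h : j = i
  · subst h; rfl
  · simp [b.orthonormal.2 h]

variable {b l}

/-! ### Symmetric operators with an orthonormal basis of eigenvectors -/

section Symmetric

variable (hb : ∀ i, ∃ h : b i ∈ T.domain, T ⟨b i, h⟩ = (l i : ℂ) • b i)
  (hT : ∀ x y : T.domain, inner ℂ (T x) (y : E) = inner ℂ (x : E) (T y))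
include hb hT

/-- Symmetry tested against the basis vectors puts the graph of `T` inside the closed diagonal
graph. Conversely, partial sums of the expansions of a pair in the diagonal graph lie in the graph
of `T`. -/
theorem topologicalClosure_graph : T.graph.topologicalClosure = diagGraph b l := by
  apply le_antisymm
  · refine Submodule.topologicalClosure_minimal _ ?_ (isClosed_diagGraph b l)
    rintro ⟨x, y⟩ hxy i
    obtain ⟨h, rfl⟩ : ∃ h : x ∈ T.domain, T ⟨x, h⟩ = y := by
      obtain ⟨z, rfl, rfl⟩ := (LinearPMap.mem_graph_iff T).1 hxy
      exact ⟨z.2, rfl⟩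
    obtain ⟨hi, hl⟩ := hb i
    have := hT ⟨b i, hi⟩ ⟨x, h⟩
    rw [hl, inner_smul_left, Complex.conj_ofReal] at this
    exact this.symm
  · rintro ⟨x, y⟩ hxy
    have h1 := b.hasSum_repr x
    have h2 := b.hasSum_repr y
    have h3 := h1.prodMk h2
    refine mem_closure_of_tendsto h3 (Filter.Eventually.of_forall fun s => ?_)
    refine Submodule.sum_mem _ fun i _ => ?_
    obtain ⟨hi, hl⟩ := hb i
    have h4 : (b i, (l i : ℂ) • b i) ∈ T.graph := by
      rw [← hl]; exact T.mem_graph ⟨b i, hi⟩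
    have h5 := T.graph.smul_mem (b.repr x i) h4
    have h6 : b.repr y i = l i * b.repr x i := by
      rw [b.repr_apply_apply, b.repr_apply_apply]; exact hxy i
    rw [h6]
    rwa [Prod.smul_mk, smul_smul, mul_comm] at h5

theorem isClosable_of_basis : T.IsClosable := by
  refine ⟨(diagGraph b l).toLinearPMap, ?_⟩
  rw [topologicalClosure_graph hb hT, Submodule.toLinearPMap_graph_eq]
  rintro ⟨x, y⟩ hxy h0
  refine ext_inner_basis b fun i => ?_
  dsimp only at h0 ⊢
  rw [hxy i]
  simp [h0]

theorem graph_closure_of_basis : T.closure.graph = diagGraph b l := by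
  rw [← (isClosable_of_basis hb hT).graph_closure_eq_closure_graph, topologicalClosure_graph hb hT]

theorem dense_domain_of_basis : Dense (T.domain : Set E) := by
  have h : (Submodule.span ℂ (Set.range b)) ≤ T.domain := by
    rw [Submodule.span_le]
    rintro _ ⟨i, rfl⟩
    exact (hb i).1
  have hd := b.dense_span
  rw [← Submodule.dense_iff_topologicalClosure_eq_top] at hd
  exact hd.mono h

/-- The closure is the maximal diagonal operator with real eigenvalues. Membership in the adjoint
graph, tested on basis vectors, is the same diagonal condition; the converse is Parseval's identity.
-/
theorem isEssentiallySelfAdjoint_of_basis : IsEssentiallySelfAdjoint T := by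
  have hd := dense_domain_of_basis hb hT
  refine ⟨hd, isClosable_of_basis hb hT, ?_⟩
  have hd' : Dense (T.closure.domain : Set E) := hd.mono T.le_closure.1
  rw [LinearPMap.isSelfAdjoint_def]
  apply LinearPMap.eq_of_eq_graph
  rw [LinearPMap.adjoint_graph_eq_graph_adjoint hd', graph_closure_of_basis hb hT]
  ext ⟨x, y⟩
  rw [Submodule.mem_adjoint_iff]
  constructor
  · intro h i
    have := h _ _ (basis_mem_diagGraph b l i)
    rw [inner_smul_left, Complex.conj_ofReal, sub_eq_zero] at this
    exact this.symm
  · intro hxy a c hac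
    rw [sub_eq_zero]
    dsimp only
    rw [← (b.hasSum_inner_mul_inner c x).tsum_eq, ← (b.hasSum_inner_mul_inner a y).tsum_eq]
    refine tsum_congr fun i => ?_
    rw [← inner_conj_symm c (b i), hac i, hxy i, ← inner_conj_symm a (b i)]
    simp only [map_mul, Complex.conj_ofReal]
    ring

theorem inner_resolvent {z : ℂ} {R : E →L[ℂ] E} (hR : IsResolventAt T.closure z R) (y : E) (i : ι) :
    ((l i : ℂ) - z) * inner ℂ (b i) (R y) = inner ℂ (b i) y := by
  obtain ⟨h, hy⟩ := hR.1 y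
  have hg := T.closure.mem_graph ⟨R y, h⟩
  rw [graph_closure_of_basis hb hT] at hg
  have := hg i
  conv_rhs => rw [← hy]
  rw [inner_sub_right, inner_smul_right, this]
  ring

theorem exists_resolvent : ∃ z R, IsResolventAt T.closure z R := by
  -- At the point `I` every real eigenvalue is at distance at least 1, so the inverse multipliers
  -- are bounded by 1.
  have him : ∀ i, (1 : ℝ) ≤ ‖(l i : ℂ) - Complex.I‖ := fun i => by
    have := Complex.abs_im_le_norm ((l i : ℂ) - Complex.I)
    simpa using this
  have hne : ∀ i, (l i : ℂ) - Complex.I ≠ 0 := fun i h => by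
    have := him i
    rw [h] at this
    simp at this
    linarith
  obtain ⟨R, hR⟩ := exists_diagonal b (fun i => ((l i : ℂ) - Complex.I)⁻¹) (M := 1) fun i => by
    rw [norm_inv]
    exact inv_le_one_of_one_le₀ (him i)
  refine ⟨Complex.I, R, fun y => ?_, fun x => ?_⟩
  · have hmem : (R y, y + Complex.I • R y) ∈ T.closure.graph := by
      rw [graph_closure_of_basis hb hT]
      intro i
      have h := hne i
      simp only [inner_add_right, inner_smul_right, hR]
      field_simp
      ring
    obtain ⟨w, hw1, hw2⟩ := (LinearPMap.mem_graph_iff _).1 hmem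
    dsimp only at hw1 hw2
    refine ⟨hw1 ▸ w.2, ?_⟩
    have : (⟨R y, hw1 ▸ w.2⟩ : T.closure.domain) = w := Subtype.ext hw1.symm
    rw [this, hw2]
    abel
  · have hg := T.closure.mem_graph x
    rw [graph_closure_of_basis hb hT] at hg
    refine ext_inner_basis b fun i => ?_
    rw [hR, inner_sub_right, inner_smul_right, hg i]
    have h := hne i
    field_simp

/-- The resolvent is a norm limit of its compositions with the finite rank projections onto the
eigenvectors with small `|l i|`, because its multipliers tend to zero. -/
theorem isCompactOperator_resolvent (hl : ∀ r : ℝ, {i | |l i| ≤ r}.Finite)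
    {z : ℂ} {R : E →L[ℂ] E} (hR : IsResolventAt T.closure z R) : IsCompactOperator R := by
  classical
  have hcl := isClosed_setOfPred_isCompactOperator (σ₁₂ := RingHom.id ℂ) (M₁ := E) (M₂ := E)
  have : R ∈ closure {f : E →L[ℂ] E | IsCompactOperator f} := by
    rw [Metric.mem_closure_iff]
    intro ε hε
    -- Outside `s` one has `‖l i - z‖ ≥ 2 / ε`, so the remainder has norm at most `ε / 2`.
    let s := (hl (‖z‖ + 2 / ε)).toFinset
    let F : E →L[ℂ] E := ∑ i ∈ s, (innerSL ℂ (b i)).smulRight (b i)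
    refine ⟨R ∘L F, ?_, ?_⟩
    · have hF : IsCompactOperator F := by
        have key : ∀ s : Finset ι,
            IsCompactOperator (∑ i ∈ s, (innerSL ℂ (b i)).smulRight (b i) : E →L[ℂ] E) := by
          classical
          intro s
          induction s using Finset.induction_on with
          | empty => rw [Finset.sum_empty]; exact isCompactOperator_zero
          | insert i s hi ih =>
            rw [Finset.sum_insert hi]
            refine IsCompactOperator.add ?_ ih
            have h1 : IsCompactOperator (innerSL ℂ (b i)) :=
              isCompactOperator_of_locallyCompactSpace_dom (innerSL ℂ (b i))
            exact h1.clm_comp (ContinuousLinearMap.toSpanSingleton ℂ (b i))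
        exact key s
      exact hF.clm_comp R
    · rw [dist_eq_norm]
      refine lt_of_le_of_lt (ContinuousLinearMap.opNorm_le_bound _ (M := ε / 2) (by positivity)
        fun x => ?_) (half_lt_self hε)
      refine norm_le_of_norm_inner_le b (by positivity) fun i => ?_
      have hF : inner ℂ (b i) (F x) = if i ∈ s then inner ℂ (b i) x else 0 := by
        simp only [F, sum_apply, ContinuousLinearMap.smulRight_apply,
          innerSL_apply_apply, inner_sum, inner_smul_right, orthonormal_iff_ite.1 b.orthonormal]
        simp
      have e1 := inner_resolvent hb hT hR x i
      have e2 := inner_resolvent hb hT hR (F x) i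
      have e3 : ((l i : ℂ) - z) * inner ℂ (b i) ((R - R ∘L F) x) =
          inner ℂ (b i) x - inner ℂ (b i) (F x) := by
        rw [← e1, ← e2, ← mul_sub, ← inner_sub_right]
        rfl
      by_cases hi : i ∈ s
      · rw [hF, if_pos hi, sub_self] at e3
        rcases mul_eq_zero.1 e3 with h0 | h0
        -- If `z` were the eigenvalue `l i`, the resolvent identity at `b i` would say that a unit
        -- vector has norm 0.
        · exfalso
          have := inner_resolvent hb hT hR (b i) i
          rw [h0, zero_mul, inner_self_eq_norm_sq_to_K, b.orthonormal.1] at this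
          simp at this
        · rw [h0, norm_zero]; positivity
      · rw [hF, if_neg hi, sub_zero] at e3
        have hi' : ‖z‖ + 2 / ε < |l i| := by
          simpa [s] using hi
        have h4 : 2 / ε ≤ ‖(l i : ℂ) - z‖ := by
          have := norm_sub_norm_le (l i : ℂ) z
          rw [Complex.norm_real, Real.norm_eq_abs] at this
          linarith
        rw [← e3, norm_mul]
        calc ‖inner ℂ (b i) ((R - R ∘L F) x)‖
            = ε / 2 * (2 / ε * ‖inner ℂ (b i) ((R - R ∘L F) x)‖) := by field_simp
          _ ≤ _ := by gcongr
  rw [hcl.closure_eq] at this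
  exact this

theorem hasCompactResolvent_of_basis (hl : ∀ r : ℝ, {i | |l i| ≤ r}.Finite) :
    HasCompactResolvent T.closure :=
  ⟨exists_resolvent hb hT, fun _ _ hR => isCompactOperator_resolvent hb hT hl hR⟩

end Symmetric

/-- A symmetric operator that preserves pairwise orthogonal finite dimensional subspaces with dense
span, and whose square is a scalar on each of them, is diagonalizable. -/
theorem exists_eigenbasis_of_blocks {α : Type*} (T : E →ₗ.[ℂ] E)
    (hT : ∀ x y : T.domain, inner ℂ (T x) (y : E) = inner ℂ (x : E) (T y))
    (W : α → Submodule ℂ E) [∀ a, FiniteDimensional ℂ (W a)] (μ : α → ℝ)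
    (hdom : ∀ a, W a ≤ T.domain)
    (hinv : ∀ a, ∀ x (hx : x ∈ W a), T ⟨x, hdom a hx⟩ ∈ W a)
    (hsq : ∀ a, ∀ x (hx : x ∈ W a), T ⟨_, hdom a (hinv a x hx)⟩ = (μ a : ℂ) • x)
    (horth : ∀ a a', a ≠ a' → ∀ x ∈ W a, ∀ y ∈ W a', inner ℂ x y = 0)
    (hdense : (⨆ a, W a).topologicalClosure = ⊤)
    (hμ : ∀ M : ℝ, {a | μ a ≤ M}.Finite) :
    IsEssentiallySelfAdjoint T ∧ HasCompactResolvent T.closure ∧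
    ∃ B : Set E, Orthonormal ℂ (fun b : B => (b : E)) ∧
      (Submodule.span ℂ B).topologicalClosure = ⊤ ∧
      ∀ b ∈ B, ∃ a, b ∈ W a ∧ ∃ (hb : b ∈ T.domain) (l : ℝ), T ⟨b, hb⟩ = (l : ℂ) • b ∧
        l ^ 2 = μ a := by
  let S : ∀ a, W a →ₗ[ℂ] W a := fun a =>
    { toFun := fun x => ⟨T ⟨x, hdom a x.2⟩, hinv a x x.2⟩
      map_add' := fun x y => Subtype.ext (T.map_add ⟨x, hdom a x.2⟩ ⟨y, hdom a y.2⟩)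
      map_smul' := fun c x => Subtype.ext (T.map_smul c ⟨x, hdom a x.2⟩) }
  have hS : ∀ a, (S a).IsSymmetric := fun a x y => hT ⟨x, hdom a x.2⟩ ⟨y, hdom a y.2⟩
  let e := fun a => (hS a).eigenvectorBasis rfl
  let I := Σ a, Fin (Module.finrank ℂ (W a))
  let v : I → E := fun i => e i.1 i.2
  let l : I → ℝ := fun i => (hS i.1).eigenvalues rfl i.2
  have hv : Orthonormal ℂ v := by
    refine ⟨fun i => (e i.1).orthonormal.1 i.2, ?_⟩
    rintro ⟨a, i⟩ ⟨a', i'⟩ hne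
    by_cases h : a = a'
    · subst h
      exact (e a).orthonormal.2 fun h => hne (congrArg (Sigma.mk a) h)
    · exact horth a a' h _ (e a i).2 _ (e a' i').2
  have hspan : Submodule.span ℂ (Set.range v) = ⨆ a, W a := by
    apply le_antisymm
    · rw [Submodule.span_le]
      rintro _ ⟨i, rfl⟩
      exact Submodule.mem_iSup_of_mem i.1 (e i.1 i.2).2
    · refine iSup_le fun a x hx => ?_
      have := (e a).sum_repr ⟨x, hx⟩
      have h2 := congrArg Subtype.val this
      rw [← show _ = x from h2]
      rw [Submodule.coe_sum]
      refine Submodule.sum_mem _ fun i _ => ?_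
      exact Submodule.smul_mem _ _ (Submodule.subset_span ⟨⟨a, i⟩, rfl⟩)
  let b : HilbertBasis I ℂ E := HilbertBasis.mk hv (by rw [hspan, hdense])
  have hbv : ∀ i, b i = v i := fun i => congrFun (HilbertBasis.coe_mk hv _) i
  have hTv : ∀ i, T ⟨v i, hdom i.1 (e i.1 i.2).2⟩ = (l i : ℂ) • v i := fun i =>
    congrArg Subtype.val ((hS i.1).apply_eigenvectorBasis rfl i.2)
  have hbT : ∀ i, ∃ h : b i ∈ T.domain, T ⟨b i, h⟩ = (l i : ℂ) • b i := fun i => by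
    rw [hbv]
    exact ⟨_, hTv i⟩
  have hlsq : ∀ i, l i ^ 2 = μ i.1 := fun i => by
    have h1 := hsq i.1 (v i) (e i.1 i.2).2
    have h2 : T ⟨_, hdom i.1 (hinv i.1 (v i) (e i.1 i.2).2)⟩ = ((l i : ℂ) * l i) • v i := by
      have : (⟨T ⟨v i, hdom i.1 (e i.1 i.2).2⟩, hdom i.1 (hinv i.1 (v i) (e i.1 i.2).2)⟩ : T.domain)
          = (l i : ℂ) • ⟨v i, hdom i.1 (e i.1 i.2).2⟩ := Subtype.ext (hTv i)
      rw [this, T.map_smul, hTv, smul_smul]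
    rw [h2] at h1
    have hne : v i ≠ 0 := fun h => by
      have := hv.1 i
      rw [h] at this
      simp at this
    have h3 := smul_left_injective ℂ hne h1
    rw [sq]
    exact_mod_cast h3
  -- Only the square of an eigenvalue is known, so `|l| ≤ r` becomes `μ ≤ r ^ 2`; this leaves
  -- finitely many blocks, each of finite dimension.
  have hfin : ∀ r : ℝ, {i | |l i| ≤ r}.Finite := fun r => by
    refine ((hμ (r ^ 2)).biUnion (t := fun a => Set.range (Sigma.mk a)) fun a _ =>
      Set.finite_range _).subset ?_
    rintro ⟨a, i⟩ hi
    have hi' : |l ⟨a, i⟩| ≤ r := hi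
    refine Set.mem_biUnion (x := a) ?_ ⟨i, rfl⟩
    change μ a ≤ r ^ 2
    rw [← hlsq ⟨a, i⟩, ← sq_abs]
    exact pow_le_pow_left₀ (abs_nonneg _) hi' 2
  refine ⟨isEssentiallySelfAdjoint_of_basis hbT hT, hasCompactResolvent_of_basis hbT hT hfin,
    Set.range v, hv.toSubtypeRange, by rw [hspan, hdense], ?_⟩
  rintro _ ⟨i, rfl⟩
  exact ⟨i.1, (e i.1 i.2).2, _, l i, hTv i, hlsq i⟩

end UnboundedOp

end

noncomputable section

set_option linter.unusedSectionVars false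

/-! ### Eigenfunctions on the unit interval -/

namespace CubeForm

open Real

/-- The Dirichlet eigenfunctions on the unit interval. -/
def sinMode (k : ℕ) (t : ℝ) : ℝ := sin (k * π * t)

/-- The coefficients of the eigenforms of degree one on the unit interval. -/
def cosMode (c : ℝ) (k : ℕ) (t : ℝ) : ℝ :=
  if k = 0 then c * exp (c * (t - 1)) else k * π * cos (k * π * t) + c * sin (k * π * t)

theorem contDiff_sinMode (k : ℕ) : ContDiff ℝ ∞ (sinMode k) := by
  unfold sinMode; fun_prop

theorem contDiff_cosMode (c : ℝ) (k : ℕ) : ContDiff ℝ ∞ (cosMode c k) := by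
  by_cases h : k = 0
  · have : cosMode c k = fun t => c * exp (c * (t - 1)) := by funext t; simp [cosMode, h]
    rw [this]; fun_prop
  · have : cosMode c k = fun t => k * π * cos (k * π * t) + c * sin (k * π * t) := by
      funext t; simp [cosMode, h]
    rw [this]; fun_prop

theorem continuous_sinMode (k : ℕ) : Continuous (sinMode k) := (contDiff_sinMode k).continuous

theorem continuous_cosMode (c : ℝ) (k : ℕ) : Continuous (cosMode c k) :=
  (contDiff_cosMode c k).continuous

theorem sinMode_zero_right (k : ℕ) : sinMode k 0 = 0 := by simp [sinMode]

theorem sinMode_one_right (k : ℕ) : sinMode k 1 = 0 := by simp [sinMode, sin_nat_mul_pi]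

theorem hasDerivAt_linear (a t : ℝ) : HasDerivAt (fun t => a * t) a t := by
  simpa using (hasDerivAt_id t).const_mul a

/-- On functions `d_w` is ∂ + c, and it sends `sinMode k` to `cosMode c k`. -/
theorem hasDerivAt_sinMode (c : ℝ) {k : ℕ} (hk : k ≠ 0) (t : ℝ) :
    HasDerivAt (sinMode k) (cosMode c k t - c * sinMode k t) t := by
  have h := (hasDerivAt_linear (k * π) t).sin
  refine HasDerivAt.congr_deriv h ?_
  simp only [cosMode, hk, if_false, sinMode]
  ring

/-- The eigenvalue of the mode `k` of the second order operator, except that it vanishes for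
`k = 0`. -/
def nu (c : ℝ) (k : ℕ) : ℝ := if k = 0 then 0 else π ^ 2 * k ^ 2 + c ^ 2

/-- The adjoint -∂ + c sends `cosMode c k` back to `nu c k` times `sinMode k`. The exponential,
which is the mode 0, is annihilated; its eigenvalue comes from `e_w`. -/
theorem hasDerivAt_cosMode (c : ℝ) (k : ℕ) (t : ℝ) :
    HasDerivAt (cosMode c k) (c * cosMode c k t - nu c k * sinMode k t) t := by
  by_cases hk : k = 0
  · have : cosMode c k = fun t => c * exp (c * (t - 1)) := by funext t; simp [cosMode, hk]
    rw [this]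
    have h := ((((hasDerivAt_id t).sub_const 1).const_mul c).exp).const_mul c
    refine HasDerivAt.congr_deriv h ?_
    simp only [nu, hk, if_true, id]
    ring
  · have : cosMode c k = fun t => k * π * cos (k * π * t) + c * sin (k * π * t) := by
      funext t; simp [cosMode, hk]
    rw [this]
    have h := (((hasDerivAt_linear (k * π) t).cos).const_mul (k * π)).add
      (((hasDerivAt_linear (k * π) t).sin).const_mul c)
    refine HasDerivAt.congr_deriv h ?_
    simp only [nu, hk, if_false, sinMode]
    ring

/-- This computes `e_w^⋄` on the modes. For `k ≠ 0` the integrand is the derivative of c e^{c(t-1)}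
sin kπt, which vanishes at both ends, so `e_w^⋄` sees only the mode 0. -/
theorem integral_exp_mul_cosMode (c : ℝ) (k : ℕ) :
    ∫ t in (0 : ℝ)..1, c * exp (c * (t - 1)) * cosMode c k t =
      if k = 0 then CubicalComplex.intervalEigenvalueSq c k else 0 := by
  have hE : ∀ a t : ℝ, HasDerivAt (fun t => exp (a * (t - 1))) (a * exp (a * (t - 1))) t := by
    intro a t
    have h := (((hasDerivAt_id t).sub_const 1).const_mul a).exp
    refine HasDerivAt.congr_deriv h ?_
    simp only [id]
    ring
  by_cases hk : k = 0
  · rw [if_pos hk]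
    have hd : ∀ t ∈ Set.uIcc (0 : ℝ) 1, HasDerivAt (fun t => c / 2 * exp (2 * c * (t - 1)))
        (c * exp (c * (t - 1)) * cosMode c k t) t := by
      intro t _
      refine HasDerivAt.congr_deriv ((hE (2 * c) t).const_mul (c / 2)) ?_
      have : exp (2 * c * (t - 1)) = exp (c * (t - 1)) * exp (c * (t - 1)) := by
        rw [← exp_add]; congr 1; ring
      simp only [cosMode, hk, if_true, this]
      ring
    rw [intervalIntegral.integral_eq_sub_of_hasDerivAt hd]
    · simp only [CubicalComplex.intervalEigenvalueSq, hk, if_true, sub_self, mul_zero, exp_zero]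
      have : 2 * c * (0 - 1) = -2 * c := by ring
      rw [this]; ring
    · exact (Continuous.mul (by fun_prop) (continuous_cosMode c k)).intervalIntegrable _ _
  · rw [if_neg hk]
    have hd : ∀ t ∈ Set.uIcc (0 : ℝ) 1, HasDerivAt (fun t => c * (exp (c * (t - 1)) * sinMode k t))
        (c * exp (c * (t - 1)) * cosMode c k t) t := by
      intro t _
      refine HasDerivAt.congr_deriv (((hE c t).mul (hasDerivAt_sinMode c hk t)).const_mul c) ?_
      ring
    rw [intervalIntegral.integral_eq_sub_of_hasDerivAt hd]
    · simp [sinMode_zero_right, sinMode_one_right]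
    · exact (Continuous.mul (by fun_prop) (continuous_cosMode c k)).intervalIntegrable _ _

/-- Integration by parts: the difference of the integrands is the derivative of `sinMode k * cosMode
c m`, which vanishes at both ends. -/
theorem integral_cosMode_mul_cosMode (c : ℝ) {k : ℕ} (hk : k ≠ 0) (m : ℕ) :
    ∫ t in (0 : ℝ)..1, cosMode c k t * cosMode c m t =
      nu c m * ∫ t in (0 : ℝ)..1, sinMode k t * sinMode m t := by
  have h1 : IntervalIntegrable (fun t => cosMode c k t * cosMode c m t) volume 0 1 :=
    ((continuous_cosMode c k).mul (continuous_cosMode c m)).intervalIntegrable _ _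
  have h2 : IntervalIntegrable (fun t => nu c m * (sinMode k t * sinMode m t)) volume 0 1 :=
    (continuous_const.mul ((continuous_sinMode k).mul (continuous_sinMode m))).intervalIntegrable _ _
  rw [← intervalIntegral.integral_const_mul, ← sub_eq_zero, ← intervalIntegral.integral_sub h1 h2]
  have hd : ∀ t ∈ Set.uIcc (0 : ℝ) 1, HasDerivAt (fun t => sinMode k t * cosMode c m t)
      (cosMode c k t * cosMode c m t - nu c m * (sinMode k t * sinMode m t)) t := by
    intro t _
    refine HasDerivAt.congr_deriv ((hasDerivAt_sinMode c hk t).mul (hasDerivAt_cosMode c m t)) ?_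
    ring
  rw [intervalIntegral.integral_eq_sub_of_hasDerivAt hd (h1.sub h2)]
  simp [sinMode_zero_right, sinMode_one_right]

/-- With `c = 0` the previous identity and its version with `k` and `m` exchanged give the same left
side with different eigenvalues. -/
theorem integral_sinMode_mul_sinMode {k m : ℕ} (hk : k ≠ 0) (hm : m ≠ 0) (hkm : k ≠ m) :
    ∫ t in (0 : ℝ)..1, sinMode k t * sinMode m t = 0 := by
  have h1 := integral_cosMode_mul_cosMode 0 hk m
  have h2 := integral_cosMode_mul_cosMode 0 hm k
  simp only [mul_comm (cosMode 0 m _), mul_comm (sinMode m _)] at h2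
  rw [h1] at h2
  have h3 : nu 0 m ≠ nu 0 k := by
    simp only [nu, hm, hk, if_false]
    intro h
    have hpi : (π : ℝ) ^ 2 ≠ 0 := by positivity
    have h4 : (m : ℝ) ^ 2 = k ^ 2 := by
      apply mul_left_cancel₀ hpi; linarith
    have h5 : (m : ℝ) = k := by
      rwa [sq_eq_sq₀ (by positivity) (by positivity)] at h4
    exact hkm (by exact_mod_cast h5.symm)
  by_contra hne
  exact h3 (mul_right_cancel₀ hne h2)

theorem integral_cosMode_mul_cosMode_eq_zero (c : ℝ) {k m : ℕ} (hkm : k ≠ m) :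
    ∫ t in (0 : ℝ)..1, cosMode c k t * cosMode c m t = 0 := by
  have main : ∀ {k m : ℕ}, k ≠ 0 → k ≠ m →
      ∫ t in (0 : ℝ)..1, cosMode c k t * cosMode c m t = 0 := by
    intro k m hk hkm
    rw [integral_cosMode_mul_cosMode c hk]
    by_cases hm : m = 0
    · simp [nu, hm]
    · rw [integral_sinMode_mul_sinMode hk hm hkm, mul_zero]
  by_cases hk : k = 0
  · simp only [mul_comm (cosMode c k _)]
    exact main (fun h => hkm (hk.trans h.symm)) hkm.symm
  · exact main hk hkm

/-! ### Completeness of the eigenfunctions -/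

/-- The span of the functions `cos (k π t)`. -/
def cosSpan : Submodule ℝ (ℝ → ℝ) := Submodule.span ℝ (Set.range fun k : ℕ => fun t => cos (k * π * t))

theorem cos_mul_mem_cosSpan {q : ℝ → ℝ} (hq : q ∈ cosSpan) :
    (fun t => cos (π * t) * q t) ∈ cosSpan := by
  induction hq using Submodule.span_induction with
  | mem q hq =>
    obtain ⟨k, rfl⟩ := hq
    cases k with
    | zero =>
      refine Submodule.subset_span ⟨1, ?_⟩
      funext t; simp
    | succ k =>
      have h1 : (fun t => cos ((k + 2 : ℕ) * π * t)) ∈ cosSpan := Submodule.subset_span ⟨k + 2, rfl⟩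
      have h2 : (fun t => cos ((k : ℕ) * π * t)) ∈ cosSpan := Submodule.subset_span ⟨k, rfl⟩
      convert cosSpan.smul_mem (1 / 2 : ℝ) (cosSpan.add_mem h1 h2) using 1
      funext t
      have e1 : ((k + 2 : ℕ) : ℝ) * π * t = (k + 1 : ℕ) * π * t + π * t := by push_cast; ring
      have e2 : ((k : ℕ) : ℝ) * π * t = (k + 1 : ℕ) * π * t - π * t := by push_cast; ring
      simp only [Pi.smul_apply, Pi.add_apply, smul_eq_mul]
      rw [e1, e2, cos_add, cos_sub]
      ring
  | zero => convert cosSpan.zero_mem using 1; funext t; simp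
  | add p q _ _ hp hq =>
    convert cosSpan.add_mem hp hq using 1
    funext t; simp [mul_add]
  | smul a q _ hq =>
    convert cosSpan.smul_mem a hq using 1
    funext t; simp; ring

theorem eval_cos_mem_cosSpan (p : Polynomial ℝ) : (fun t => p.eval (cos (π * t))) ∈ cosSpan := by
  induction p using Polynomial.induction_on' with
  | add p q hp hq =>
    convert cosSpan.add_mem hp hq using 1
    funext t; simp
  | monomial n a =>
    induction n with
    | zero =>
      have : (fun t => cos ((0 : ℕ) * π * t)) ∈ cosSpan := Submodule.subset_span ⟨0, rfl⟩
      convert cosSpan.smul_mem a this using 1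
      funext t; simp
    | succ n ih =>
      convert cos_mul_mem_cosSpan ih using 1
      funext t
      simp only [Polynomial.eval_monomial]
      ring

/-- Polynomials in cos πt are cosine sums, and t ↦ cos πt is a homeomorphism of [0,1] onto [-1,1];
so this is Weierstrass approximation. -/
theorem exists_cosSpan_near {f : ℝ → ℝ} (hf : Continuous f) {ε : ℝ} (hε : 0 < ε) :
    ∃ q ∈ cosSpan, ∀ t ∈ Set.Icc (0 : ℝ) 1, |q t - f t| < ε := by
  have hc : ContinuousOn (fun y => f (arccos y / π)) (Set.Icc (-1) 1) := by
    have := continuous_arccos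
    exact Continuous.continuousOn (by fun_prop)
  obtain ⟨p, hp⟩ := exists_polynomial_near_of_continuousOn (-1) 1 _ hc ε hε
  refine ⟨_, eval_cos_mem_cosSpan p, fun t ht => ?_⟩
  have := hp (cos (π * t)) ⟨neg_one_le_cos _, cos_le_one _⟩
  rw [arccos_cos (mul_nonneg pi_pos.le ht.1) (by nlinarith [pi_pos, ht.2])] at this
  rwa [mul_div_cancel_left₀ _ pi_ne_zero] at this

/-- The span of the Dirichlet eigenfunctions. -/
def sinSpan : Submodule ℝ (ℝ → ℝ) := Submodule.span ℝ (sinMode '' {k | k ≠ 0})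

theorem sin_mul_mem_sinSpan {q : ℝ → ℝ} (hq : q ∈ cosSpan) :
    (fun t => sin (π * t) * q t) ∈ sinSpan := by
  have hs : ∀ k : ℕ, sinMode k ∈ sinSpan := by
    intro k
    by_cases hk : k = 0
    · convert sinSpan.zero_mem
      funext t; simp [sinMode, hk]
    · exact Submodule.subset_span ⟨k, hk, rfl⟩
  induction hq using Submodule.span_induction with
  | mem q hq =>
    obtain ⟨k, rfl⟩ := hq
    cases k with
    | zero =>
      convert hs 1 using 1
      funext t; simp [sinMode]
    | succ k =>
      convert sinSpan.smul_mem (1 / 2 : ℝ) (sinSpan.sub_mem (hs (k + 2)) (hs k)) using 1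
      funext t
      have e1 : ((k + 2 : ℕ) : ℝ) * π * t = (k + 1 : ℕ) * π * t + π * t := by push_cast; ring
      have e2 : ((k : ℕ) : ℝ) * π * t = (k + 1 : ℕ) * π * t - π * t := by push_cast; ring
      simp only [Pi.smul_apply, Pi.sub_apply, smul_eq_mul, sinMode]
      rw [e1, e2, sin_add, sin_sub]
      ring
  | zero => convert sinSpan.zero_mem using 1; funext t; simp
  | add p q _ _ hp hq =>
    convert sinSpan.add_mem hp hq using 1
    funext t; simp [mul_add]
  | smul a q _ hq =>
    convert sinSpan.smul_mem a hq using 1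
    funext t; simp; ring

theorem continuous_of_mem_span {s : Set (ℝ → ℝ)} (hs : ∀ f ∈ s, Continuous f) {q : ℝ → ℝ}
    (hq : q ∈ Submodule.span ℝ s) : Continuous q := by
  induction hq using Submodule.span_induction with
  | mem q hq => exact hs q hq
  | zero => exact continuous_const
  | add p q _ _ hp hq => exact hp.add hq
  | smul a q _ hq => exact hq.const_smul a

/-- The function `f` need not vanish at the ends, so the approximation is only in mean square. The
regularized quotients `h n` of `f` by sin πt are continuous, and sin πt times `h n` tends to `f` by
dominated convergence. A cosine sum close to `h n` becomes a sine sum when multiplied by sin πt. -/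
theorem exists_sinSpan_near {f : ℝ → ℝ} (hf : Continuous f) {ε : ℝ} (hε : 0 < ε) :
    ∃ q ∈ sinSpan, ∫ t in (0 : ℝ)..1, (f t - q t) ^ 2 < ε := by
  let h : ℕ → ℝ → ℝ := fun n t => f t * sin (π * t) / (sin (π * t) ^ 2 + 1 / (n + 1))
  have hpos : ∀ (n : ℕ) (t : ℝ), 0 < sin (π * t) ^ 2 + 1 / ((n : ℝ) + 1) := fun n t => by positivity
  have hh : ∀ n, Continuous (h n) := fun n =>
    Continuous.div (by fun_prop) (by fun_prop) fun t => (hpos n t).ne'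
  have herr : ∀ n t, f t - sin (π * t) * h n t =
      f t * ((1 / ((n : ℝ) + 1)) / (sin (π * t) ^ 2 + 1 / (n + 1))) := by
    intro n t
    have := (hpos n t).ne'
    simp only [h]
    field_simp
    ring
  have hlim : Filter.Tendsto (fun n : ℕ => ∫ t in (0 : ℝ)..1, (f t - sin (π * t) * h n t) ^ 2)
      Filter.atTop (nhds (∫ t in (0 : ℝ)..1, (0 : ℝ))) := by
    refine intervalIntegral.tendsto_integral_filter_of_dominated_convergence (fun t => f t ^ 2)
      ?_ ?_ ?_ ?_
    · exact Filter.Eventually.of_forall fun n =>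
        Continuous.aestronglyMeasurable (by have := hh n; fun_prop)
    · refine Filter.Eventually.of_forall fun n => Filter.Eventually.of_forall fun t _ => ?_
      rw [herr, Real.norm_eq_abs, abs_of_nonneg (sq_nonneg _), mul_pow]
      have h1 : (1 / ((n : ℝ) + 1)) / (sin (π * t) ^ 2 + 1 / (n + 1)) ≤ 1 := by
        rw [div_le_one (hpos n t)]
        nlinarith [sq_nonneg (sin (π * t))]
      have h2 : 0 ≤ (1 / ((n : ℝ) + 1)) / (sin (π * t) ^ 2 + 1 / (n + 1)) :=
        div_nonneg (by positivity) (hpos n t).le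
      calc f t ^ 2 * ((1 / ((n : ℝ) + 1)) / (sin (π * t) ^ 2 + 1 / (n + 1))) ^ 2
          ≤ f t ^ 2 * 1 := by gcongr; exact pow_le_one₀ h2 h1
        _ = f t ^ 2 := mul_one _
    · exact (hf.pow 2).intervalIntegrable _ _
    · have hne : ∀ᵐ t : ℝ, t ≠ 1 := by simp [ae_iff]
      filter_upwards [hne] with t ht1 ht
      rw [Set.uIoc_of_le zero_le_one] at ht
      have hsin : 0 < sin (π * t) := by
        apply sin_pos_of_pos_of_lt_pi
        · exact mul_pos pi_pos ht.1
        · have := lt_of_le_of_ne ht.2 ht1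
          nlinarith [pi_pos]
      have h0 : Filter.Tendsto (fun n : ℕ => 1 / ((n : ℝ) + 1)) Filter.atTop (nhds 0) :=
        tendsto_one_div_add_atTop_nhds_zero_nat
      have h1 : Filter.Tendsto (fun n : ℕ => (f t * ((1 / ((n : ℝ) + 1)) /
          (sin (π * t) ^ 2 + 1 / (n + 1)))) ^ 2) Filter.atTop
          (nhds ((f t * (0 / (sin (π * t) ^ 2 + 0))) ^ 2)) :=
        ((h0.div (h0.const_add _) (by positivity)).const_mul _).pow 2
      simpa only [herr, zero_div, mul_zero, ne_eq, OfNat.ofNat_ne_zero, not_false_eq_true,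
        zero_pow] using h1
  rw [intervalIntegral.integral_zero] at hlim
  obtain ⟨n, hn⟩ := (hlim.eventually (gt_mem_nhds (show (0 : ℝ) < ε / 4 by positivity))).exists
  -- From `δ ≤ 1` and `δ ≤ ε / 8` follows `2 * δ ^ 2 ≤ ε / 4`.
  obtain ⟨δ, hδ, hδε⟩ : ∃ δ : ℝ, 0 < δ ∧ 2 * δ ^ 2 < ε / 2 :=
    ⟨min 1 (ε / 8), by positivity, by
      have h1 := min_le_left 1 (ε / 8)
      have h2 := min_le_right 1 (ε / 8)
      have h3 : 0 < min 1 (ε / 8) := by positivity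
      nlinarith⟩
  obtain ⟨q, hq, hqn⟩ := exists_cosSpan_near (hh n) hδ
  have hqc : Continuous q := continuous_of_mem_span (by rintro _ ⟨k, rfl⟩; fun_prop) hq
  refine ⟨_, sin_mul_mem_sinSpan hq, ?_⟩
  have hb : ∫ t in (0 : ℝ)..1, (f t - sin (π * t) * q t) ^ 2 ≤
      ∫ t in (0 : ℝ)..1, (2 * (f t - sin (π * t) * h n t) ^ 2 + 2 * δ ^ 2) := by
    refine intervalIntegral.integral_mono_on zero_le_one ?_ ?_ fun t ht => ?_
    · exact Continuous.intervalIntegrable (by fun_prop) _ _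
    · exact Continuous.intervalIntegrable (by have := hh n; fun_prop) _ _
    · have h1 := hqn t ht
      have h2 : (sin (π * t) * (h n t - q t)) ^ 2 ≤ δ ^ 2 := by
        rw [← sq_abs, abs_mul]
        refine pow_le_pow_left₀ (by positivity) ?_ 2
        rw [abs_sub_comm] at h1
        calc _ ≤ 1 * δ := mul_le_mul (abs_sin_le_one _) h1.le (abs_nonneg _) zero_le_one
          _ = δ := one_mul δ
      have h3 : f t - sin (π * t) * q t =
          (f t - sin (π * t) * h n t) + sin (π * t) * (h n t - q t) := by ring
      rw [h3]
      nlinarith [sq_nonneg ((f t - sin (π * t) * h n t) - sin (π * t) * (h n t - q t))]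
  rw [intervalIntegral.integral_add, intervalIntegral.integral_const_mul,
    intervalIntegral.integral_const] at hb
  · simp at hb hn
    linarith
  · exact Continuous.intervalIntegrable (by have := hh n; fun_prop) _ _
  · exact Continuous.intervalIntegrable (by fun_prop) _ _

/-- After removal of its constant term `a`, a cosine sum is the derivative of a sine sum `s`
vanishing at both ends, and ∂ + c maps `s` into the span of the modes. -/
theorem exists_primitive_of_mem_cosSpan (c : ℝ) {q : ℝ → ℝ} (hq : q ∈ cosSpan) :
    ∃ (a : ℝ) (s : ℝ → ℝ), (∀ t, HasDerivAt s (q t - a) t) ∧ s 0 = 0 ∧ s 1 = 0 ∧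
      (fun t => q t - a + c * s t) ∈ Submodule.span ℝ (Set.range (cosMode c)) := by
  induction hq using Submodule.span_induction with
  | mem q hq =>
    obtain ⟨k, rfl⟩ := hq
    by_cases hk : k = 0
    · refine ⟨1, fun _ => 0, fun t => ?_, rfl, rfl, ?_⟩
      · simpa [hk] using hasDerivAt_const t (0 : ℝ)
      · convert Submodule.zero_mem _ using 1
        funext t; simp [hk]
    · have hkp : (k : ℝ) * π ≠ 0 := by
        have : (k : ℝ) ≠ 0 := by exact_mod_cast hk
        positivity
      refine ⟨0, fun t => (k * π)⁻¹ * sinMode k t, fun t => ?_, ?_, ?_, ?_⟩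
      · refine HasDerivAt.congr_deriv ((hasDerivAt_sinMode c hk t).const_mul (k * π)⁻¹) ?_
        simp only [cosMode, hk, if_false, sinMode]
        field_simp
        ring
      · simp [sinMode_zero_right]
      · simp [sinMode_one_right]
      · convert Submodule.smul_mem _ (k * π)⁻¹
          (Submodule.subset_span (R := ℝ) (Set.mem_range_self (f := cosMode c) k)) using 1
        funext t
        simp only [Pi.smul_apply, smul_eq_mul, cosMode, hk, if_false, sinMode]
        field_simp
        ring
  | zero =>
    refine ⟨0, fun _ => 0, fun t => ?_, rfl, rfl, ?_⟩
    · simpa using hasDerivAt_const t (0 : ℝ)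
    · convert Submodule.zero_mem _ using 1
      funext t; simp
  | add p q _ _ hp hq =>
    obtain ⟨a, s, h1, h2, h3, h4⟩ := hp
    obtain ⟨a', s', h1', h2', h3', h4'⟩ := hq
    refine ⟨a + a', fun t => s t + s' t, fun t => ?_, by simp [h2, h2'], by simp [h3, h3'], ?_⟩
    · refine HasDerivAt.congr_deriv ((h1 t).add (h1' t)) ?_
      simp; ring
    · convert Submodule.add_mem _ h4 h4' using 1
      funext t; simp; ring
  | smul b q _ hq =>
    obtain ⟨a, s, h1, h2, h3, h4⟩ := hq
    refine ⟨b * a, fun t => b * s t, fun t => ?_, by simp [h2], by simp [h3], ?_⟩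
    · refine HasDerivAt.congr_deriv ((h1 t).const_mul b) ?_
      simp; ring
    · convert Submodule.smul_mem _ b h4 using 1
      funext t; simp; ring

theorem abs_sub_le_of_hasDerivAt {f f' : ℝ → ℝ} {C : ℝ} (hf : ∀ t, HasDerivAt f (f' t) t)
    (hC : ∀ t ∈ Set.Icc (0 : ℝ) 1, |f' t| ≤ C) {t : ℝ} (ht : t ∈ Set.Icc (0 : ℝ) 1) :
    |f t - f 0| ≤ C := by
  have h0 : (0 : ℝ) ∈ Set.Icc (0 : ℝ) 1 := ⟨le_refl _, zero_le_one⟩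
  have h := (convex_Icc (0 : ℝ) 1).norm_image_sub_le_of_norm_hasDerivWithin_le
    (fun x _ => (hf x).hasDerivWithinAt) hC h0 ht
  have hC0 : 0 ≤ C := (abs_nonneg _).trans (hC 0 h0)
  rw [Real.norm_eq_abs, Real.norm_eq_abs] at h
  refine h.trans ?_
  rw [sub_zero, abs_of_nonneg ht.1]
  nlinarith [ht.2]

/-- The modes with `k ≠ 0` are images under ∂ + c of functions vanishing at the ends, so they miss
one direction, which the mode 0 supplies. After subtracting `r` times this mode, the rest is `u' + c
* u` with `u` zero at both ends. A uniform approximation of `u'` by cosines, integrated,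
approximates `u` as well. -/
theorem exists_cosMode_near {c : ℝ} (hc : 0 < c) {f : ℝ → ℝ} (hf : Continuous f) {ε : ℝ}
    (hε : 0 < ε) : ∃ q ∈ Submodule.span ℝ (Set.range (cosMode c)),
      ∀ t ∈ Set.Icc (0 : ℝ) 1, |f t - q t| < ε := by
  have hg := continuous_cosMode c 0
  have hgpos : ∀ t, 0 < cosMode c 0 t := fun t => by simp only [cosMode, if_true]; positivity
  let N := ∫ t in (0 : ℝ)..1, exp (c * t) * cosMode c 0 t
  have hN : 0 < N := intervalIntegral.intervalIntegral_pos_of_pos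
    (Continuous.intervalIntegrable (by fun_prop) _ _)
    (fun t => mul_pos (exp_pos _) (hgpos t)) zero_lt_one
  -- This value makes the integral of e^{ct} `g` vanish, which is the condition for a solution `u`
  -- with both boundary values zero.
  let r := (∫ t in (0 : ℝ)..1, exp (c * t) * f t) / N
  let g : ℝ → ℝ := fun t => f t - r * cosMode c 0 t
  have hgc : Continuous g := by fun_prop
  have hic : Continuous fun t => exp (c * t) * g t := by fun_prop
  let F : ℝ → ℝ := fun t => ∫ s in (0 : ℝ)..t, exp (c * s) * g s
  have hF : ∀ t, HasDerivAt F (exp (c * t) * g t) t := fun t =>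
    intervalIntegral.integral_hasDerivAt_right (hic.intervalIntegrable _ _)
      hic.aestronglyMeasurable.stronglyMeasurableAtFilter hic.continuousAt
  have hF0 : F 0 = 0 := intervalIntegral.integral_same
  have hF1 : F 1 = 0 := by
    have : ∀ s, exp (c * s) * g s = exp (c * s) * f s - r * (exp (c * s) * cosMode c 0 s) := by
      intro s; simp only [g]; ring
    simp only [F, this]
    rw [intervalIntegral.integral_sub, intervalIntegral.integral_const_mul]
    · simp only [r, N]
      rw [div_mul_cancel₀ _ hN.ne', sub_self]
    · exact Continuous.intervalIntegrable (by fun_prop) _ _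
    · exact Continuous.intervalIntegrable (by fun_prop) _ _
  let u : ℝ → ℝ := fun t => exp (-c * t) * F t
  have hu : ∀ t, HasDerivAt u (g t - c * u t) t := by
    intro t
    have h1 : HasDerivAt (fun t => exp (-c * t)) (exp (-c * t) * -c) t :=
      (hasDerivAt_linear (-c) t).exp
    refine HasDerivAt.congr_deriv (h1.mul (hF t)) ?_
    have : exp (-c * t) * exp (c * t) = 1 := by rw [← exp_add]; simp
    simp only [u]
    linear_combination g t * this
  have huc : Continuous u := continuous_iff_continuousAt.2 fun t => (hu t).continuousAt
  -- The error has four parts, bounded by `δ`, `δ`, `c * δ` and `c * δ`; together at most `ε / 2`.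
  let δ := ε / (4 * (1 + c))
  have hδ : 0 < δ := by positivity
  obtain ⟨q, hq, hqn⟩ := exists_cosSpan_near (f := fun t => g t - c * u t) (by fun_prop) hδ
  obtain ⟨a, s, hs, hs0, hs1, hmem⟩ := exists_primitive_of_mem_cosSpan c hq
  have hu0 : u 0 = 0 := by simp [u, hF0]
  have hu1 : u 1 = 0 := by simp [u, hF1]
  -- This function vanishes at 0 and has derivative `q - u'`. Its value at 1 is `a`, so the constant
  -- term of `q` is small too.
  have key : ∀ t ∈ Set.Icc (0 : ℝ) 1, |s t - u t + a * t| ≤ δ := by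
    intro t ht
    have hd : ∀ t, HasDerivAt (fun t => s t - u t + a * t) (q t - (g t - c * u t)) t := by
      intro t
      refine HasDerivAt.congr_deriv (((hs t).sub (hu t)).add (hasDerivAt_linear a t)) ?_
      ring
    have := abs_sub_le_of_hasDerivAt hd (fun t ht => (hqn t ht).le) ht
    simpa [hs0, hu0] using this
  have ha : |a| ≤ δ := by
    have := key 1 ⟨zero_le_one, le_refl _⟩
    simpa [hs1, hu1] using this
  refine ⟨_, Submodule.add_mem _ hmem (Submodule.smul_mem _ r
    (Submodule.subset_span (Set.mem_range_self 0))), fun t ht => ?_⟩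
  have h1 := abs_lt.1 (hqn t ht)
  have h2 := abs_le.1 (key t ht)
  have h3 := abs_le.1 ha
  have h4 : f t - ((fun t => q t - a + c * s t) + r • cosMode c 0) t =
      -(q t - (g t - c * u t)) + a - c * (s t - u t + a * t) + c * (a * t) := by
    simp only [Pi.add_apply, Pi.smul_apply, smul_eq_mul, g]
    ring
  have h5 : |a * t| ≤ δ := by
    rw [abs_mul, abs_of_nonneg ht.1]
    calc |a| * t ≤ δ * 1 := mul_le_mul ha ht.2 ht.1 hδ.le
      _ = δ := mul_one δ
  have h5' := abs_le.1 h5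
  have h6 : ε = 4 * δ + 4 * (c * δ) := by simp only [δ]; field_simp
  have h7 : 0 < c * δ := by positivity
  have b1 : |c * (s t - u t + a * t)| ≤ c * δ := by
    rw [abs_mul, abs_of_pos hc]; exact mul_le_mul_of_nonneg_left (key t ht) hc.le
  have b2 : |c * (a * t)| ≤ c * δ := by
    rw [abs_mul, abs_of_pos hc]; exact mul_le_mul_of_nonneg_left h5 hc.le
  have b1' := abs_le.1 b1
  have b2' := abs_le.1 b2
  rw [h4, abs_lt]
  constructor <;> linarith [h1.1, h1.2, b1'.1, b1'.2, b2'.1, b2'.2, h3.1, h3.2]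

theorem exists_cosMode_near_sq {c : ℝ} (hc : 0 < c) {f : ℝ → ℝ} (hf : Continuous f) {ε : ℝ}
    (hε : 0 < ε) : ∃ q ∈ Submodule.span ℝ (Set.range (cosMode c)),
      ∫ t in (0 : ℝ)..1, (f t - q t) ^ 2 < ε := by
  obtain ⟨δ, hδ, hδε⟩ : ∃ δ : ℝ, 0 < δ ∧ δ ^ 2 < ε :=
    ⟨min 1 (ε / 2), by positivity, by
      have h1 := min_le_left 1 (ε / 2)
      have h2 := min_le_right 1 (ε / 2)
      have h3 : 0 < min 1 (ε / 2) := by positivity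
      nlinarith⟩
  obtain ⟨q, hq, hqn⟩ := exists_cosMode_near hc hf hδ
  have hqc : Continuous q :=
    continuous_of_mem_span (by rintro _ ⟨k, rfl⟩; exact continuous_cosMode c k) hq
  refine ⟨q, hq, lt_of_le_of_lt ?_ hδε⟩
  calc ∫ t in (0 : ℝ)..1, (f t - q t) ^ 2 ≤ ∫ t in (0 : ℝ)..1, δ ^ 2 := by
        refine intervalIntegral.integral_mono_on zero_le_one
          (Continuous.intervalIntegrable (by fun_prop) _ _) (by simp) fun t ht => ?_
        rw [← sq_abs]
        exact pow_le_pow_left₀ (abs_nonneg _) (hqn t ht).le 2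
    _ = δ ^ 2 := by simp

end CubeForm

end

noncomputable section

set_option linter.unusedSectionVars false

/-! ### Integration on the unit cube -/

namespace CubeForm

variable {ι κ : Type*} [Fintype ι] [LinearOrder ι] [Fintype κ] [LinearOrder κ]

/-- Lebesgue measure on the open unit interval. -/
def unitVol : Measure ℝ := volume.restrict (Set.Ioo 0 1)

instance : IsProbabilityMeasure unitVol := ⟨by simp [unitVol]⟩

theorem cubeVol_eq_pi (ι : Type*) [Fintype ι] : cubeVol ι = Measure.pi fun _ => unitVol := by
  unfold cubeVol openCube unitVol
  rw [volume_pi, Measure.restrict_pi_pi]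

instance (ι : Type*) [Fintype ι] : IsProbabilityMeasure (cubeVol ι) := by
  rw [cubeVol_eq_pi]; infer_instance

theorem integral_unitVol {E : Type*} [NormedAddCommGroup E] [NormedSpace ℝ E] (f : ℝ → E) :
    ∫ t, f t ∂unitVol = ∫ t in (0 : ℝ)..1, f t := by
  rw [intervalIntegral.integral_of_le zero_le_one, integral_Ioc_eq_integral_Ioo]
  rfl

theorem integrable_of_continuous {f : (ι → ℝ) → ℂ} (hf : Continuous f) :
    Integrable f (cubeVol ι) :=
  (memLp_of_continuous hf).integrable (by norm_num)

/-- The coordinate `i` is the only one outside the image of `j`. -/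
structure IsSplit (j : ι ↪ κ) (i : κ) : Prop where
  ne : ∀ a, j a ≠ i
  exists_eq : ∀ k, k ≠ i → ∃ a, j a = k

namespace IsSplit

variable {j : ι ↪ κ} {i : κ} (h : IsSplit j i)
include h

theorem extend_self (y : ι → ℝ) (t : ℝ) : Function.extend j y (fun _ => t) i = t :=
  Function.extend_apply' _ _ _ fun ⟨a, ha⟩ => h.ne a ha

theorem extend_eq_update (y : ι → ℝ) (t : ℝ) :
    Function.extend j y (fun _ => t) = Function.update (Function.extend j y fun _ => 0) i t := by
  funext k
  by_cases hk : k = i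
  · subst hk
    rw [h.extend_self, Function.update_self]
  · obtain ⟨a, rfl⟩ := h.exists_eq k hk
    rw [Function.update_of_ne hk, j.injective.extend_apply, j.injective.extend_apply]

theorem univ_eq : (Finset.univ : Finset κ) = insert i (Finset.univ.map j) := by
  ext k
  simp only [Finset.mem_univ, Finset.mem_insert, Finset.mem_map, true_and, true_iff]
  by_cases hk : k = i
  · exact .inl hk
  · exact .inr (h.exists_eq k hk)

theorem prod_univ {M : Type*} [CommMonoid M] (f : κ → M) : ∏ k, f k = f i * ∏ a, f (j a) := by
  rw [h.univ_eq, Finset.prod_insert, Finset.prod_map]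
  simp only [Finset.mem_map, Finset.mem_univ, true_and, not_exists]
  exact h.ne

theorem measurePreserving : MeasurePreserving
    (fun p : (ι → ℝ) × ℝ => Function.extend j p.1 fun _ => p.2)
    ((cubeVol ι).prod unitVol) (cubeVol κ) := by
  have hm : Measurable (fun p : (ι → ℝ) × ℝ => Function.extend j p.1 fun _ => p.2) :=
    (continuous_extend j).measurable
  refine ⟨hm, ?_⟩
  rw [cubeVol_eq_pi κ]
  refine (Measure.pi_eq fun s hs => ?_).symm
  rw [Measure.map_apply hm (MeasurableSet.univ_pi hs)]
  have : (fun p : (ι → ℝ) × ℝ => Function.extend j p.1 fun _ => p.2) ⁻¹' Set.univ.pi s =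
      (Set.univ.pi fun a => s (j a)) ×ˢ s i := by
    ext ⟨y, t⟩
    simp only [Set.mem_preimage, Set.mem_univ_pi, Set.mem_prod]
    constructor
    · intro hk
      refine ⟨fun a => ?_, ?_⟩
      · simpa [j.injective.extend_apply] using hk (j a)
      · simpa [h.extend_self] using hk i
    · rintro ⟨h1, h2⟩ k
      by_cases hk : k = i
      · subst hk; rwa [h.extend_self]
      · obtain ⟨a, rfl⟩ := h.exists_eq k hk
        rw [j.injective.extend_apply]
        exact h1 a
  rw [this, Measure.prod_prod, cubeVol_eq_pi, Measure.pi_pi, h.prod_univ, mul_comm]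

theorem integral_eq {F : (κ → ℝ) → ℂ} (hF : Continuous F) : ∫ x, F x ∂cubeVol κ =
    ∫ y, (∫ t in (0 : ℝ)..1, F (Function.extend j y fun _ => t)) ∂cubeVol ι := by
  have hmp := h.measurePreserving
  have hint : Integrable (fun p : (ι → ℝ) × ℝ => F (Function.extend j p.1 fun _ => p.2))
      ((cubeVol ι).prod unitVol) :=
    hmp.integrable_comp_of_integrable (integrable_of_continuous hF)
  rw [← hmp.map_eq, integral_map hmp.measurable.aemeasurable hF.aestronglyMeasurable,
    integral_prod _ hint]
  simp only [integral_unitVol]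

end IsSplit

theorem isSplit_subtype (i : κ) :
    IsSplit (Function.Embedding.subtype fun k : κ => k ≠ i) i :=
  ⟨fun a => a.2, fun k hk => ⟨⟨k, hk⟩, rfl⟩⟩

theorem hasDerivAt_comp_update {F : (ι → ℝ) → ℂ} (hF : Differentiable ℝ F) (x : ι → ℝ) (i : ι)
    (t : ℝ) : HasDerivAt (fun t => F (Function.update x i t))
      (fderiv ℝ F (Function.update x i t) (Pi.single i 1)) t :=
  (hF _).hasFDerivAt.comp_hasDerivAt t (hasDerivAt_update x i t)

/-- Integration by parts in the direction `i`. -/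
theorem integral_inner_fderiv_add {f g : (ι → ℝ) → ℂ} (hf : ContDiff ℝ ∞ f) (hg : ContDiff ℝ ∞ g)
    (i : ι) (h0 : ∀ x ∈ Set.Icc (0 : ι → ℝ) 1, (x i = 0 ∨ x i = 1) → f x = 0) :
    ∫ x, (inner ℂ (f x) (fderiv ℝ g x (Pi.single i 1)) +
      inner ℂ (fderiv ℝ f x (Pi.single i 1)) (g x)) ∂cubeVol ι = 0 := by
  have hs := isSplit_subtype i
  have hfd := hf.differentiable (by simp)
  have hgd := hg.differentiable (by simp)
  have hfc := hf.continuous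
  have hgc := hg.continuous
  have hfd' : Continuous fun x => fderiv ℝ f x (Pi.single i 1) :=
    (hf.continuous_fderiv (by simp)).clm_apply continuous_const
  have hgd' : Continuous fun x => fderiv ℝ g x (Pi.single i 1) :=
    (hg.continuous_fderiv (by simp)).clm_apply continuous_const
  have hc : Continuous fun x => (inner ℂ (f x) (fderiv ℝ g x (Pi.single i 1)) +
      inner ℂ (fderiv ℝ f x (Pi.single i 1)) (g x)) := by fun_prop
  rw [hs.integral_eq hc]
  -- On each line in direction `i` the integrand is the derivative of the inner product of `f` and
  -- `g`, and `f` vanishes at the ends of the line.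
  have hz : ∀ y ∈ openCube {k : ι // k ≠ i}, ∫ t in (0 : ℝ)..1,
      (fun x => (inner ℂ (f x) (fderiv ℝ g x (Pi.single i 1)) +
      inner ℂ (fderiv ℝ f x (Pi.single i 1)) (g x)))
        (Function.extend (Function.Embedding.subtype fun k : ι => k ≠ i) y fun _ => t) = 0 := by
    intro y hy
    obtain ⟨x, hx⟩ : ∃ x, x =
      Function.extend (Function.Embedding.subtype fun k : ι => k ≠ i) y fun _ => (0 : ℝ) := ⟨_, rfl⟩
    have hext : ∀ t : ℝ, (Function.extend (Function.Embedding.subtype fun k : ι => k ≠ i) y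
        fun _ => t) = Function.update x i t := fun t => by rw [hx]; exact hs.extend_eq_update y t
    simp only [hext]
    have hd : ∀ t ∈ Set.uIcc (0 : ℝ) 1, HasDerivAt
        (fun t => inner ℂ (f (Function.update x i t)) (g (Function.update x i t)))
        (inner ℂ (f (Function.update x i t)) (fderiv ℝ g (Function.update x i t) (Pi.single i 1)) +
          inner ℂ (fderiv ℝ f (Function.update x i t) (Pi.single i 1)) (g (Function.update x i t))) t :=
      fun t _ => (hasDerivAt_comp_update hfd x i t).inner ℂ (hasDerivAt_comp_update hgd x i t)
    have hu : Continuous fun t : ℝ => Function.update x i t := continuous_const.update i continuous_id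
    rw [intervalIntegral.integral_eq_sub_of_hasDerivAt hd ((hc.comp hu).intervalIntegrable _ _)]
    have hmem : ∀ t ∈ Set.Icc (0 : ℝ) 1, Function.update x i t ∈ Set.Icc (0 : ι → ℝ) 1 := by
      intro t ht
      have : ∀ k, Function.update x i t k ∈ Set.Icc (0 : ℝ) 1 := by
        intro k
        by_cases hk : k = i
        · subst hk; simpa using ht
        · rw [Function.update_of_ne hk]
          obtain ⟨a, rfl⟩ := hs.exists_eq k hk
          rw [hx, Function.Embedding.injective _ |>.extend_apply]
          exact ⟨(hy a trivial).1.le, (hy a trivial).2.le⟩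
      exact ⟨fun k => (this k).1, fun k => (this k).2⟩
    rw [h0 _ (hmem 1 ⟨zero_le_one, le_refl _⟩) (.inr (by simp)),
      h0 _ (hmem 0 ⟨le_refl _, zero_le_one⟩) (.inl (by simp))]
    simp
  exact setIntegral_eq_zero_of_forall_eq_zero hz

/-! ### Inner products of forms -/

theorem inner_toL2 (β γ : contForm ι) :
    inner ℂ (toL2 ι β) (toL2 ι γ) = ∑ I, ∫ x, inner ℂ (β.1 I x) (γ.1 I x) ∂cubeVol ι := by
  rw [PiLp.inner_apply]
  refine Finset.sum_congr rfl fun I _ => ?_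
  rw [L2.inner_def]
  refine integral_congr_ae ?_
  filter_upwards [(memLp_of_continuous (β.2 I)).coeFn_toLp, (memLp_of_continuous (γ.2 I)).coeFn_toLp]
    with x h1 h2
  exact congrArg₂ (inner ℂ) h1 h2

theorem inner_toL2' (β γ : contForm ι) :
    inner ℂ (toL2 ι β) (toL2 ι γ) = ∫ x, ∑ I, inner ℂ (β.1 I x) (γ.1 I x) ∂cubeVol ι := by
  rw [inner_toL2, integral_finsetSum]
  intro I _
  have h1 := β.2 I
  have h2 := γ.2 I
  exact integrable_of_continuous (by fun_prop)

/-- Adding `i` to `I` or removing it. -/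
def toggle {α : Type*} [DecidableEq α] (i : α) (I : Finset α) : Finset α :=
  if i ∈ I then I.erase i else insert i I

section toggle

variable {α : Type*} [DecidableEq α]

theorem mem_toggle_self (i : α) (I : Finset α) : i ∈ toggle i I ↔ i ∉ I := by
  unfold toggle; split_ifs with h <;> simp [h]

theorem mem_toggle_of_ne {i k : α} (h : k ≠ i) (I : Finset α) : k ∈ toggle i I ↔ k ∈ I := by
  unfold toggle; split_ifs <;> simp [h]

theorem toggle_involutive (i : α) : Function.Involutive (toggle i) := by
  intro I
  ext k
  by_cases h : k = i
  · subst h; rw [mem_toggle_self, mem_toggle_self, not_not]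
  · rw [mem_toggle_of_ne h, mem_toggle_of_ne h]

theorem toggle_of_mem {i : α} {I : Finset α} (h : i ∈ I) : toggle i I = I.erase i := if_pos h

theorem toggle_of_notMem {i : α} {I : Finset α} (h : i ∉ I) : toggle i I = insert i I := if_neg h

theorem eq_toggle_iff {i : α} {I J : Finset α} : J = toggle i I ↔ toggle i J = I :=
  ⟨fun h => by rw [h, toggle_involutive], fun h => by rw [← h, toggle_involutive]⟩

end toggle

theorem sgn_toggle {α : Type*} [LinearOrder α] (i : α) (I : Finset α) : sgn i (toggle i I) = sgn i I := by
  unfold sgn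
  congr 2
  ext k
  simp only [Finset.mem_filter]
  refine and_congr_left fun h => mem_toggle_of_ne h.ne I

theorem conj_sgn (i : ι) (I : Finset ι) : (starRingEnd ℂ) (sgn i I) = sgn i I := by
  simp [sgn]

/-- Toggling `i` matches the index sets with `i` on the left to those without it on the right, and
it does not change the sign `sgn i`. -/
theorem sum_inner_wedge (i : ι) (α γ : CubeForm ι) (x : ι → ℝ) :
    ∑ J, inner ℂ (wedge i α J x) (γ J x) = ∑ J, inner ℂ (α J x) (contract i γ J x) := by
  symm
  refine Fintype.sum_bijective (toggle i) (toggle_involutive i).bijective _ _ fun J => ?_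
  unfold wedge contract
  simp only [mem_toggle_self]
  by_cases h : i ∈ J
  · simp [h]
  · simp only [h, if_false, not_false_eq_true, if_true, sgn_toggle]
    rw [toggle_of_notMem h, Finset.erase_insert h]
    simp only [RCLike.inner_apply, map_mul, conj_sgn]
    ring

theorem sum_inner_contract (i : ι) (α γ : CubeForm ι) (x : ι → ℝ) :
    ∑ J, inner ℂ (contract i α J x) (γ J x) = ∑ J, inner ℂ (α J x) (wedge i γ J x) := by
  have h := congrArg (starRingEnd ℂ) (sum_inner_wedge i γ α x)
  simp only [map_sum, inner_conj_symm] at h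
  exact h.symm

/-- Contraction pairs `β J` with `γ (insert i J)` for `i ∉ J` only, and for these `J` the boundary
condition makes `β J` vanish on the two faces. Integration by parts needs no more. -/
theorem integral_sum_inner_contract (β γ : smoothForm₀ ι) (i : ι) :
    ∫ x, ∑ J, (inner ℂ (partialD i β.1 J x) (contract i γ.1 J x) +
      inner ℂ (β.1 J x) (contract i (partialD i γ.1) J x)) ∂cubeVol ι = 0 := by
  have hd := fun J => continuous_partialD β.2.1 i J
  have hb := fun J => (β.2.1 J).continuous
  have h1 := fun J => continuous_contract (fun I => (γ.2.1 I).continuous) i J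
  have h2 := fun J => continuous_contract (fun I => continuous_partialD γ.2.1 i I) i J
  rw [integral_finsetSum]
  swap
  · intro J _
    have a := hd J
    have b := hb J
    have c := h1 J
    have d := h2 J
    exact integrable_of_continuous (by fun_prop)
  refine Finset.sum_eq_zero fun J _ => ?_
  by_cases hJ : i ∈ J
  · simp [contract, hJ]
  · have := integral_inner_fderiv_add (β.2.1 J) (γ.2.1 (insert i J)) i (β.2.2 J i hJ)
    calc _ = ∫ x, sgn i J * (inner ℂ (β.1 J x) (fderiv ℝ (γ.1 (insert i J)) x (Pi.single i 1)) +
        inner ℂ (fderiv ℝ (β.1 J) x (Pi.single i 1)) (γ.1 (insert i J) x)) ∂cubeVol ι := by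
          refine integral_congr_ae (ae_of_all _ fun x => ?_)
          simp only [contract, hJ, if_false, partialD, RCLike.inner_apply]
          ring
      _ = 0 := by rw [integral_const_mul, this, mul_zero]

theorem wittenOp_apply (w : ι → ℝ) (δ : smoothForm₀ ι) (I : Finset ι) (x : ι → ℝ) :
    (wittenOp w δ).1 I x =
      ∑ i, (wedge i (partialD i δ.1) I x + w i * wedge i δ.1 I x -
        contract i (partialD i δ.1) I x + w i * contract i δ.1 I x) := by
  simp only [wittenOp, LinearMap.coe_mk, AddHom.coe_mk, dW, dWAdj, Pi.add_apply, Finset.sum_apply,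
    Pi.smul_apply, Pi.neg_apply, smul_eq_mul, ← Finset.sum_add_distrib]
  exact Finset.sum_congr rfl fun i _ => by ring

/-- `d_w + d_w^⋄` is symmetric. -/
theorem inner_wittenOp (w : ι → ℝ) (β γ : smoothForm₀ ι) :
    inner ℂ (toL2 ι (wittenOp w β)) (toL2 ι (smoothToCont ι γ)) =
      inner ℂ (toL2 ι (smoothToCont ι β)) (toL2 ι (wittenOp w γ)) := by
  have hconj : ∀ i, ∫ x, ∑ J, (inner ℂ (contract i β.1 J x) (partialD i γ.1 J x) +
      inner ℂ (contract i (partialD i β.1) J x) (γ.1 J x)) ∂cubeVol ι = 0 := by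
    intro i
    have h := congrArg (starRingEnd ℂ) (integral_sum_inner_contract γ β i)
    rw [← integral_conj] at h
    simpa only [map_sum, map_add, inner_conj_symm, map_zero] using h
  have hb := fun J => (β.2.1 J).continuous
  have hg := fun J => (γ.2.1 J).continuous
  have hbd := fun i J => continuous_partialD β.2.1 i J
  have hgd := fun i J => continuous_partialD γ.2.1 i J
  rw [← sub_eq_zero, inner_toL2', inner_toL2', ← integral_sub]
  · have hpt : ∀ x, (∑ I, inner ℂ ((wittenOp w β).1 I x) (γ.1 I x)) -
        ∑ I, inner ℂ (β.1 I x) ((wittenOp w γ).1 I x) =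
        ∑ i, ((∑ J, (inner ℂ (partialD i β.1 J x) (contract i γ.1 J x) +
          inner ℂ (β.1 J x) (contract i (partialD i γ.1) J x))) -
          ∑ J, (inner ℂ (contract i β.1 J x) (partialD i γ.1 J x) +
          inner ℂ (contract i (partialD i β.1) J x) (γ.1 J x))) := by
      intro x
      simp only [wittenOp_apply, sum_inner, inner_sum, inner_add_left, inner_add_right, inner_sub_left,
        inner_sub_right]
      rw [Finset.sum_comm, Finset.sum_comm (γ := Finset ι), ← Finset.sum_sub_distrib]
      refine Finset.sum_congr rfl fun i _ => ?_
      have hsm : ∀ (a b c : ℂ), inner ℂ (w i * a * b) c = w i * inner ℂ (a * b) c := by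
        intro a b c
        simp only [RCLike.inner_apply, map_mul, Complex.conj_ofReal]
        ring
      have hl : ∀ (a c : ℂ), inner ℂ (w i * a) c = w i * inner ℂ a c := by
        intro a c
        simp only [RCLike.inner_apply, map_mul, Complex.conj_ofReal]
        ring
      have hr : ∀ (a c : ℂ), inner ℂ a (w i * c) = w i * inner ℂ a c := by
        intro a c
        simp only [RCLike.inner_apply]
        ring
      simp only [hl, hr, Finset.sum_add_distrib, Finset.sum_sub_distrib, ← Finset.mul_sum,
        sum_inner_wedge, sum_inner_contract]
      ring
    change ∫ x, ((∑ I, inner ℂ ((wittenOp w β).1 I x) (γ.1 I x)) -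
        ∑ I, inner ℂ (β.1 I x) ((wittenOp w γ).1 I x)) ∂cubeVol ι = 0
    simp only [hpt]
    have hcc : ∀ (δ : smoothForm₀ ι) i J, Continuous (contract i δ.1 J) := fun δ i J =>
      continuous_contract (fun I => (δ.2.1 I).continuous) i J
    have hcd : ∀ (δ : smoothForm₀ ι) i J, Continuous (contract i (partialD i δ.1) J) := fun δ i J =>
      continuous_contract (fun I => continuous_partialD δ.2.1 i I) i J
    have i1 : ∀ i, Integrable (fun x => ∑ J, (inner ℂ (partialD i β.1 J x) (contract i γ.1 J x) +
          inner ℂ (β.1 J x) (contract i (partialD i γ.1) J x))) (cubeVol ι) := fun i =>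
      integrable_of_continuous (continuous_finsetSum _ fun J _ =>
        ((hbd i J).inner (hcc γ i J)).add ((hb J).inner (hcd γ i J)))
    have i2 : ∀ i, Integrable (fun x => ∑ J, (inner ℂ (contract i β.1 J x) (partialD i γ.1 J x) +
          inner ℂ (contract i (partialD i β.1) J x) (γ.1 J x))) (cubeVol ι) := fun i =>
      integrable_of_continuous (continuous_finsetSum _ fun J _ =>
        ((hcc β i J).inner (hgd i J)).add ((hcd β i J).inner (hg J)))
    rw [integral_finsetSum]
    swap
    · exact fun i _ => (i1 i).sub (i2 i)
    refine Finset.sum_eq_zero fun i _ => ?_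
    rw [integral_sub (i1 i) (i2 i), integral_sum_inner_contract, hconj, sub_zero]
  · exact integrable_of_continuous (continuous_finsetSum _ fun J _ =>
      ((wittenOp w β).2 J).inner (hg J))
  · exact integrable_of_continuous (continuous_finsetSum _ fun J _ =>
      (hb J).inner ((wittenOp w γ).2 J))

theorem filter_map_mem (j : ι ↪ κ) (I : Finset ι) :
    (Finset.univ.filter fun a => j a ∈ I.map j) = I := by
  ext a; simp

/-- `eAdjMap` is the adjoint of `eMap`. -/
theorem inner_eMap {j : ι ↪ κ} {i : κ} (h : IsSplit j i) (c : ℝ) (α : smoothForm₀ ι)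
    (τ : smoothForm₀ κ) :
    inner ℂ (toL2 κ (eMap j i c α)) (toL2 κ (smoothToCont κ τ)) =
      inner ℂ (toL2 ι (smoothToCont ι α)) (toL2 ι (eAdjMap j i c τ)) := by
  have hct := fun J => continuous_contract (fun I => (τ.2.1 I).continuous) i J
  have ha := fun J => (α.2.1 J).continuous
  rw [inner_toL2', inner_toL2]
  have hpt : ∀ x, ∑ J, inner ℂ ((eMap j i c α).1 J x) (τ.1 J x) =
      ∑ I, inner ℂ (α.1 I (x ∘ j))
        (((c * Real.exp (c * (x i - 1)) : ℝ) : ℂ) * contract i τ.1 (I.map j) x) := by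
    intro x
    have hl : ∀ (r : ℝ) (a b : ℂ), inner ℂ ((r : ℂ) * a) b = r * inner ℂ a b := by
      intro r a b
      simp only [RCLike.inner_apply, map_mul, Complex.conj_ofReal]
      ring
    have hr : ∀ (r : ℝ) (a b : ℂ), inner ℂ a ((r : ℂ) * b) = r * inner ℂ a b := by
      intro r a b
      simp only [RCLike.inner_apply]
      ring
    simp only [eMap, LinearMap.coe_mk, AddHom.coe_mk, eOp, hl, hr]
    rw [← Finset.mul_sum, sum_inner_wedge, ← Finset.mul_sum]
    congr 1
    symm
    -- A pulled back form has coefficients only for index sets inside the image of `j`.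
    refine Finset.sum_of_injOn (fun I => I.map j) (Finset.map_injective j).injOn
      (fun _ _ => by simp) (fun J _ hJ => ?_) fun I _ => ?_
    · by_cases hJ' : ∀ k ∈ J, ∃ a, j a = k
      · exfalso
        apply hJ
        refine ⟨Finset.univ.filter fun a => j a ∈ J, by simp, ?_⟩
        ext k
        simp only [Finset.mem_map, Finset.mem_filter, Finset.mem_univ, true_and]
        constructor
        · rintro ⟨a, ha, rfl⟩; exact ha
        · intro hk
          obtain ⟨a, rfl⟩ := hJ' k hk
          exact ⟨a, hk, rfl⟩
      · simp [pull, hJ']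
    · have hI : ∀ k ∈ I.map j, ∃ a, j a = k := fun k hk => by
        obtain ⟨a, _, rfl⟩ := Finset.mem_map.1 hk
        exact ⟨a, rfl⟩
      rw [pull, if_pos hI, filter_map_mem]
  change ∫ x, ∑ J, inner ℂ ((eMap j i c α).1 J x) (τ.1 J x) ∂cubeVol κ = _
  simp only [hpt]
  have hcont : ∀ I, Continuous fun x : κ → ℝ => inner ℂ (α.1 I (x ∘ j))
        (((c * Real.exp (c * (x i - 1)) : ℝ) : ℂ) * contract i τ.1 (I.map j) x) := by
    intro I
    have h1 : Continuous fun x : κ → ℝ => x ∘ j := continuous_pi fun a => continuous_apply _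
    exact ((ha I).comp h1).inner ((Complex.continuous_ofReal.comp (by fun_prop)).mul (hct _))
  rw [integral_finsetSum _ fun I _ => integrable_of_continuous (hcont I)]
  refine Finset.sum_congr rfl fun I _ => ?_
  rw [h.integral_eq (hcont I)]
  refine integral_congr_ae (ae_of_all _ fun y => ?_)
  change _ = inner ℂ (α.1 I y) (∫ t in (0 : ℝ)..1, ((c * Real.exp (c * (t - 1)) : ℝ) : ℂ) *
    contract i τ.1 (I.map j) (Function.extend j y fun _ => t))
  have hr : ∀ a b : ℂ, inner ℂ a b = (starRingEnd ℂ) a * b := by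
    intro a b; simp only [RCLike.inner_apply]; ring
  simp only [hr, ← intervalIntegral.integral_const_mul, h.extend_self,
    Function.extend_comp j.injective]

end CubeForm

end

noncomputable section

set_option linter.unusedSectionVars false

/-! ### Product forms -/

namespace CubeForm

variable {ι κ : Type*} [Fintype ι] [LinearOrder ι] [Fintype κ] [LinearOrder κ]

/-- The factor of a product form in a direction that occurs in it (`p`) or not (`¬ p`). -/
def mode (c : ℝ) (k : ℕ) (p : Prop) [Decidable p] : ℝ → ℝ := if p then cosMode c k else sinMode k

theorem contDiff_mode (c : ℝ) (k : ℕ) (p : Prop) [Decidable p] : ContDiff ℝ ∞ (mode c k p) := by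
  unfold mode; split_ifs
  exacts [contDiff_cosMode c k, contDiff_sinMode k]

/-- The product of functions of one coordinate each. -/
def prodFun (ψ : ι → ℝ → ℝ) (x : ι → ℝ) : ℂ := ((∏ i, ψ i (x i) : ℝ) : ℂ)

theorem contDiff_prodFun {ψ : ι → ℝ → ℝ} (h : ∀ i, ContDiff ℝ ∞ (ψ i)) :
    ContDiff ℝ ∞ (prodFun ψ) :=
  Complex.ofRealCLM.contDiff.comp
    (contDiff_prod fun i _ => (h i).comp (contDiff_apply ℝ ℝ i))

theorem prodFun_eq_mul (ψ : ι → ℝ → ℝ) (i : ι) (x : ι → ℝ) :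
    prodFun ψ x = ψ i (x i) * ((∏ m ∈ Finset.univ.erase i, ψ m (x m) : ℝ) : ℂ) := by
  rw [prodFun, ← Finset.mul_prod_erase _ _ (Finset.mem_univ i), Complex.ofReal_mul]

theorem fderiv_prodFun {ψ : ι → ℝ → ℝ} (h : ∀ i, ContDiff ℝ ∞ (ψ i)) {i : ι} {x : ι → ℝ} {a : ℝ}
    (hd : HasDerivAt (ψ i) a (x i)) : fderiv ℝ (prodFun ψ) x (Pi.single i 1) =
      a * ((∏ m ∈ Finset.univ.erase i, ψ m (x m) : ℝ) : ℂ) := by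
  have h1 := hasDerivAt_comp_update ((contDiff_prodFun h).differentiable (by simp)) x i (x i)
  rw [Function.update_eq_self] at h1
  refine h1.unique ?_
  have h2 := (hd.ofReal_comp).mul_const ((∏ m ∈ Finset.univ.erase i, ψ m (x m) : ℝ) : ℂ)
  refine h2.congr_of_eventuallyEq (Filter.Eventually.of_forall fun t => ?_)
  change prodFun ψ (Function.update x i t) = _
  rw [prodFun_eq_mul ψ i, Function.update_self]
  congr 2
  refine Finset.prod_congr rfl fun m hm => ?_
  rw [Function.update_of_ne (Finset.ne_of_mem_erase hm)]

/-- The coefficient of a product form. -/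
def prodCoeff (c : ι → ℝ) (k : ι → ℕ) (I : Finset ι) : (ι → ℝ) → ℂ :=
  prodFun fun i => mode (c i) (k i) (i ∈ I)

/-- The form `f dx_I` where `f` is a product of eigenfunctions. -/
def prodForm (c : ι → ℝ) (k : ι → ℕ) (I : Finset ι) : CubeForm ι :=
  fun J x => if J = I then prodCoeff c k I x else 0

theorem contDiff_prodCoeff (c : ι → ℝ) (k : ι → ℕ) (I : Finset ι) :
    ContDiff ℝ ∞ (prodCoeff c k I) :=
  contDiff_prodFun fun _ => contDiff_mode _ _ _

theorem contDiff_prodForm (c : ι → ℝ) (k : ι → ℕ) (I J : Finset ι) :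
    ContDiff ℝ ∞ (prodForm c k I J) := by
  by_cases h : J = I
  · have : prodForm c k I J = prodCoeff c k I := by funext x; simp [prodForm, h]
    rw [this]
    exact contDiff_prodCoeff c k I
  · have : prodForm c k I J = fun _ => 0 := by funext x; simp [prodForm, h]
    rw [this]
    exact contDiff_const

/-- A product form, as a form with continuous coefficients. -/
def contProd (c : ι → ℝ) (k : ι → ℕ) (I : Finset ι) : contForm ι :=
  ⟨prodForm c k I, fun J => (contDiff_prodForm c k I J).continuous⟩

/-- A product form that satisfies the boundary conditions. -/
def smoothProd (c : ι → ℝ) (k : ι → ℕ) (I : Finset ι) : smoothForm₀ ι :=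
  ⟨if ∀ i ∉ I, k i ≠ 0 then prodForm c k I else 0, by
    split_ifs with h
    · refine ⟨fun J => contDiff_prodForm c k I J, fun J i hi x _ hx => ?_⟩
      unfold prodForm
      split_ifs with hJ
      · subst hJ
        rw [prodCoeff, prodFun_eq_mul _ i]
        have : mode (c i) (k i) (i ∈ J) (x i) = 0 := by
          simp only [mode, hi, if_false]
          rcases hx with hx | hx <;> simp [hx, sinMode_zero_right, sinMode_one_right]
        rw [this]; simp
      · rfl
    · exact Submodule.zero_mem _⟩

theorem coe_smoothProd {c : ι → ℝ} {k : ι → ℕ} {I : Finset ι} (h : ∀ i ∉ I, k i ≠ 0) :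
    (smoothProd c k I).1 = prodForm c k I := if_pos h

theorem smoothToCont_smoothProd {c : ι → ℝ} {k : ι → ℕ} {I : Finset ι} (h : ∀ i ∉ I, k i ≠ 0) :
    smoothToCont ι (smoothProd c k I) = contProd c k I := Subtype.ext (coe_smoothProd h)

theorem wedge_apply (i : ι) (β : CubeForm ι) (J : Finset ι) (x : ι → ℝ) :
    wedge i β J x = if i ∈ J then sgn i J * β (toggle i J) x else 0 := by
  unfold wedge; split_ifs with h
  · rw [toggle_of_mem h]
  · rfl

theorem contract_apply (i : ι) (β : CubeForm ι) (J : Finset ι) (x : ι → ℝ) :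
    contract i β J x = if i ∈ J then 0 else sgn i J * β (toggle i J) x := by
  unfold contract; split_ifs with h
  · rfl
  · rw [toggle_of_notMem h]

theorem partialD_prodForm (c : ι → ℝ) (k : ι → ℕ) (I : Finset ι) (i : ι) (J : Finset ι)
    (x : ι → ℝ) : partialD i (prodForm c k I) J x =
      if J = I then fderiv ℝ (prodCoeff c k I) x (Pi.single i 1) else 0 := by
  unfold partialD
  by_cases h : J = I
  · have : prodForm c k I J = prodCoeff c k I := by funext x; simp [prodForm, h]
    rw [this, if_pos h]
  · have : prodForm c k I J = fun _ => 0 := by funext x; simp [prodForm, h]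
    rw [this, if_neg h]
    simp

theorem prodCoeff_toggle (c : ι → ℝ) (k : ι → ℕ) (I : Finset ι) (i : ι) (x : ι → ℝ) :
    prodCoeff c k (toggle i I) x = mode (c i) (k i) (i ∉ I) (x i) *
      ((∏ m ∈ Finset.univ.erase i, mode (c m) (k m) (m ∈ I) (x m) : ℝ) : ℂ) := by
  rw [prodCoeff, prodFun_eq_mul _ i]
  congr 2
  · simp only [mode, mem_toggle_self]
  · refine Finset.prod_congr rfl fun m hm => ?_
    simp only [mode, mem_toggle_of_ne (Finset.ne_of_mem_erase hm)]

/-- `d_w + d_w^⋄` on a product form. -/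
theorem wittenOp_smoothProd (c : ι → ℝ) {k : ι → ℕ} {I : Finset ι} (h : ∀ i ∉ I, k i ≠ 0) :
    wittenOp c (smoothProd c k I) =
      ∑ i, (sgn i I * (if i ∈ I then (nu (c i) (k i) : ℂ) else 1)) • contProd c k (toggle i I) := by
  ext1
  funext J x
  rw [wittenOp_apply, coe_smoothProd h]
  simp only [Submodule.coe_sum, Submodule.coe_smul, Finset.sum_apply, Pi.smul_apply, smul_eq_mul]
  refine Finset.sum_congr rfl fun i _ => ?_
  change _ = _ * prodForm c k (toggle i I) J x
  simp only [wedge_apply, contract_apply, partialD_prodForm]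
  by_cases hJ : J = toggle i I
  · subst hJ
    simp only [toggle_involutive i I, if_true, prodForm, mem_toggle_self, sgn_toggle]
    rw [prodCoeff_toggle]
    -- In each direction only one of wedge and contraction survives. For `i ∈ I` the factor becomes
    -- c `cosMode` minus its derivative, that is `nu` times `sinMode`; for `i ∉ I` it becomes the
    -- derivative of `sinMode` plus c `sinMode`, that is `cosMode`.
    by_cases hi : i ∈ I
    · have hd := fderiv_prodFun (ψ := fun i => mode (c i) (k i) (i ∈ I)) (x := x) (i := i)
        (fun _ => contDiff_mode _ _ _) (a := c i * cosMode (c i) (k i) (x i) -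
          nu (c i) (k i) * sinMode (k i) (x i)) (by
            simp only [mode, hi, if_true]
            exact hasDerivAt_cosMode _ _ _)
      rw [prodCoeff, hd, prodFun_eq_mul _ i]
      simp only [hi, not_true_eq_false, if_false, if_true, mode]
      push_cast
      ring
    · have hd := fderiv_prodFun (ψ := fun i => mode (c i) (k i) (i ∈ I)) (x := x) (i := i)
        (fun _ => contDiff_mode _ _ _) (a := cosMode (c i) (k i) (x i) -
          c i * sinMode (k i) (x i)) (by
            simp only [mode, hi, if_false]
            exact hasDerivAt_sinMode _ (h i hi) _)
      rw [prodCoeff, hd, prodFun_eq_mul _ i]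
      simp only [hi, not_false_eq_true, if_false, if_true, mode]
      push_cast
      ring
  · have hJ' : toggle i J ≠ I := fun h => hJ (eq_toggle_iff.2 h)
    simp [prodForm, hJ, hJ']

/-- The preimage of `I` under `j`. -/
def restr (j : ι ↪ κ) (I : Finset κ) : Finset ι := Finset.univ.filter fun a => j a ∈ I

theorem mem_restr {j : ι ↪ κ} {I : Finset κ} {a : ι} : a ∈ restr j I ↔ j a ∈ I := by
  simp [restr]

namespace IsSplit

variable {j : ι ↪ κ} {i : κ} (h : IsSplit j i)
include h

theorem restr_insert (I : Finset κ) : restr j (insert i I) = restr j I := by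
  ext a; simp [mem_restr, h.ne a]

theorem notMem_map (I : Finset ι) : i ∉ I.map j := by
  simp only [Finset.mem_map, not_exists, not_and]
  exact fun a _ => h.ne a

theorem insert_map_restr {I : Finset κ} (hi : i ∈ I) : insert i ((restr j I).map j) = I := by
  ext k
  simp only [Finset.mem_insert, Finset.mem_map, mem_restr]
  constructor
  · rintro (rfl | ⟨a, ha, rfl⟩)
    exacts [hi, ha]
  · intro hk
    by_cases hki : k = i
    · exact .inl hki
    · obtain ⟨a, rfl⟩ := h.exists_eq k hki
      exact .inr ⟨a, hk, rfl⟩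

theorem eq_of_restr_eq {I J : Finset κ} (hI : i ∈ I) (hJ : i ∈ J) (hr : restr j I = restr j J) :
    I = J := by
  rw [← h.insert_map_restr hI, ← h.insert_map_restr hJ, hr]

theorem restr_insert_map (I : Finset ι) : restr j (insert i (I.map j)) = I := by
  rw [h.restr_insert]; ext a; simp [mem_restr]

theorem prodCoeff_eq (c : κ → ℝ) (k : κ → ℕ) {I : Finset κ} (hi : i ∈ I) (x : κ → ℝ) :
    prodCoeff c k I x = cosMode (c i) (k i) (x i) *
      prodCoeff (c ∘ j) (k ∘ j) (restr j I) (x ∘ j) := by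
  rw [prodCoeff, prodFun, h.prod_univ]
  simp only [mode, hi, if_true, prodCoeff, prodFun, mem_restr, Complex.ofReal_mul,
    Function.comp_apply]

/-- `eMap` on a product form. -/
theorem eMap_smoothProd (c : κ → ℝ) {k : κ → ℕ} {I : Finset κ} (hk : k i = 0) (hi : i ∉ I)
    (hI : ∀ a ∉ restr j I, k (j a) ≠ 0) :
    eMap j i (c i) (smoothProd (c ∘ j) (k ∘ j) (restr j I)) =
      sgn i I • contProd c k (insert i I) := by
  ext1
  funext J x
  change eOp j i (c i) (smoothProd (c ∘ j) (k ∘ j) (restr j I)).1 J x =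
    sgn i I * prodForm c k (insert i I) J x
  rw [coe_smoothProd (k := k ∘ j) hI]
  unfold eOp
  have hins : insert i I = toggle i I := (toggle_of_notMem hi).symm
  rw [wedge_apply]
  by_cases hJ : J = insert i I
  · subst hJ
    rw [if_pos (Finset.mem_insert_self i I), hins, sgn_toggle, toggle_involutive i I, ← hins, pull,
      if_pos fun m hm => h.exists_eq m fun hmi => hi (hmi ▸ hm)]
    change _ * (_ * prodForm _ _ _ (restr j I) _) = _
    simp only [prodForm, if_true]
    rw [h.prodCoeff_eq c k (Finset.mem_insert_self i I), h.restr_insert]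
    simp only [cosMode, hk, if_true]
    ring
  · by_cases hiJ : i ∈ J
    · have hne : restr j (toggle i J) ≠ restr j I := by
        intro hr
        apply hJ
        apply h.eq_of_restr_eq hiJ (Finset.mem_insert_self i I)
        rw [h.restr_insert, ← hr]
        ext a
        rw [mem_restr, mem_restr, mem_toggle_of_ne (h.ne a)]
      have : pull j (prodForm (c ∘ j) (k ∘ j) (restr j I)) (toggle i J) x = 0 := by
        unfold pull
        split_ifs
        · change prodForm _ _ _ (restr j (toggle i J)) _ = 0
          simp [prodForm, hne]
        · rfl
      simp [this, prodForm, hJ]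
    · simp [hiJ, prodForm, hJ]

/-- `eAdjMap` on a product form. -/
theorem eAdjMap_smoothProd (c : κ → ℝ) {k : κ → ℕ} {I : Finset κ} (hI : ∀ m ∉ I, k m ≠ 0) :
    eAdjMap j i (c i) (smoothProd c k I) =
      (if i ∈ I then sgn i I * ((if k i = 0 then
        CubicalComplex.intervalEigenvalueSq (c i) (k i) else 0 : ℝ) : ℂ) else 0) •
          contProd (c ∘ j) (k ∘ j) (restr j I) := by
  ext1
  funext J y
  change ∫ t in (0 : ℝ)..1, ((c i * Real.exp (c i * (t - 1)) : ℝ) : ℂ) *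
    contract i (smoothProd c k I).1 (J.map j) (Function.extend j y fun _ => t) =
      _ * prodForm (c ∘ j) (k ∘ j) (restr j I) J y
  rw [coe_smoothProd hI]
  simp only [contract, h.notMem_map J, if_false]
  by_cases hi : i ∈ I
  · rw [if_pos hi]
    by_cases hJ : J = restr j I
    · subst hJ
      simp only [h.insert_map_restr hi, prodForm, if_true]
      have hs : sgn i ((restr j I).map j) = sgn i I := by
        rw [← sgn_toggle, toggle_of_notMem (h.notMem_map _), h.insert_map_restr hi]
      simp only [h.prodCoeff_eq c k hi, h.extend_self, Function.extend_comp j.injective, hs]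
      rw [← integral_exp_mul_cosMode, ← intervalIntegral.integral_ofReal,
        ← intervalIntegral.integral_const_mul, ← intervalIntegral.integral_mul_const]
      refine intervalIntegral.integral_congr fun t _ => ?_
      push_cast
      ring
    · have : insert i (J.map j) ≠ I := by
        rintro rfl
        exact hJ (h.restr_insert_map J).symm
      simp [prodForm, hJ, this]
  · have : insert i (J.map j) ≠ I := by
      rintro rfl
      exact hi (Finset.mem_insert_self _ _)
    simp [prodForm, hi, this]

end IsSplit

/-! ### Orthogonality of product forms -/

theorem integral_prodFun (ψ : ι → ℝ → ℝ) :
    ∫ x, prodFun ψ x ∂cubeVol ι = ((∏ i, ∫ t in (0 : ℝ)..1, ψ i t : ℝ) : ℂ) := by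
  unfold prodFun
  rw [integral_complex_ofReal, cubeVol_eq_pi, integral_fintype_prod_eq_prod]
  simp only [integral_unitVol]

/-- Different `I` give different coefficients. For equal `I` the integral factors over the
coordinates, and a coordinate with different modes contributes zero. -/
theorem inner_contProd_eq_zero {c : ι → ℝ} {k k' : ι → ℕ} {I I' : Finset ι}
    (hI : ∀ i ∉ I, k i ≠ 0) (hI' : ∀ i ∉ I', k' i ≠ 0) (hk : k ≠ k') :
    inner ℂ (toL2 ι (contProd c k I)) (toL2 ι (contProd c k' I')) = 0 := by
  rw [inner_toL2]
  refine Finset.sum_eq_zero fun J _ => ?_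
  change ∫ x, inner ℂ (prodForm c k I J x) (prodForm c k' I' J x) ∂cubeVol ι = 0
  unfold prodForm
  by_cases h1 : J = I
  swap
  · simp [h1]
  by_cases h2 : J = I'
  swap
  · simp [h2]
  subst h1
  subst h2
  have : ∀ x, inner ℂ (prodCoeff c k J x) (prodCoeff c k' J x) = prodFun
      (fun i t => mode (c i) (k i) (i ∈ J) t * mode (c i) (k' i) (i ∈ J) t) x := by
    intro x
    simp only [prodCoeff, prodFun, RCLike.inner_apply, Complex.conj_ofReal,
      Finset.prod_mul_distrib, Complex.ofReal_mul]
    ring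
  simp only [if_true, this]
  rw [integral_prodFun]
  obtain ⟨i, hi⟩ := Function.ne_iff.1 hk
  rw [Finset.prod_eq_zero (Finset.mem_univ i), Complex.ofReal_zero]
  by_cases hiJ : i ∈ J
  · simp only [mode, hiJ, if_true]
    exact integral_cosMode_mul_cosMode_eq_zero _ hi
  · simp only [mode, hiJ, if_false]
    exact integral_sinMode_mul_sinMode (hI i hiJ) (hI' i hiJ) hi

end CubeForm

end

noncomputable section

set_option linter.unusedSectionVars false

/-! ### Density of product forms -/

namespace CubeForm

variable {ι : Type*} [Fintype ι] [LinearOrder ι]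

theorem norm_toLp_sq {α : Type*} [MeasurableSpace α] {μ : Measure α} {f : α → ℂ}
    (h : MemLp f 2 μ) : ‖h.toLp f‖ ^ 2 = ∫ x, ‖f x‖ ^ 2 ∂μ := by
  have h1 : inner ℂ (h.toLp f) (h.toLp f) = ∫ x, ((‖f x‖ ^ 2 : ℝ) : ℂ) ∂μ := by
    rw [L2.inner_def]
    refine integral_congr_ae ?_
    filter_upwards [h.coeFn_toLp] with x hx
    rw [hx, inner_self_eq_norm_sq_to_K]
    push_cast
    rfl
  rw [inner_self_eq_norm_sq_to_K, integral_complex_ofReal] at h1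
  refine Complex.ofReal_injective ?_
  rw [Complex.ofReal_pow]
  exact h1

/-- The functions whose classes lie in a given space of square-integrable functions. -/
def lpSub (M : Submodule ℂ (Lp ℂ 2 (cubeVol ι))) : Submodule ℂ ((ι → ℝ) → ℂ) where
  carrier := {f | ∃ h : MemLp f 2 (cubeVol ι), h.toLp f ∈ M}
  add_mem' := fun ⟨h1, m1⟩ ⟨h2, m2⟩ => ⟨h1.add h2, by rw [MemLp.toLp_add h1 h2]; exact M.add_mem m1 m2⟩
  zero_mem' := ⟨MemLp.zero, by rw [MemLp.toLp_zero]; exact M.zero_mem⟩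
  smul_mem' := fun c _ ⟨h, m⟩ => ⟨h.const_smul c, by
    rw [MemLp.toLp_const_smul c h]; exact M.smul_mem c m⟩

theorem mem_lpSub_of_near {M : Submodule ℂ (Lp ℂ 2 (cubeVol ι))}
    (hM : IsClosed (M : Set (Lp ℂ 2 (cubeVol ι)))) {f : (ι → ℝ) → ℂ} (hf : Continuous f)
    (h : ∀ ε : ℝ, 0 < ε → ∃ g ∈ lpSub M, ∫ x, ‖f x - g x‖ ^ 2 ∂cubeVol ι < ε) : f ∈ lpSub M := by
  refine ⟨memLp_of_continuous hf, ?_⟩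
  rw [← SetLike.mem_coe, ← hM.closure_eq, Metric.mem_closure_iff]
  intro ε hε
  obtain ⟨g, ⟨hg, hgM⟩, hgf⟩ := h (ε ^ 2) (by positivity)
  refine ⟨hg.toLp g, hgM, ?_⟩
  rw [dist_eq_norm, ← MemLp.toLp_sub]
  refine lt_of_pow_lt_pow_left₀ 2 hε.le ?_
  rw [norm_toLp_sq]
  exact hgf

theorem integral_comp_apply {F : ℝ → ℝ} (hF : Continuous F) (a : ι) :
    ∫ x, F (x a) ∂cubeVol ι = ∫ t in (0 : ℝ)..1, F t := by
  rw [cubeVol_eq_pi, ← integral_unitVol]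
  have h := measurePreserving_eval (fun _ : ι => unitVol) a
  conv_rhs => rw [← h.map_eq, integral_map h.measurable.aemeasurable hF.aestronglyMeasurable]

theorem openCube_subset_Icc : openCube ι ⊆ Set.Icc (0 : ι → ℝ) 1 := fun _ hx =>
  ⟨fun i => (hx i trivial).1.le, fun i => (hx i trivial).2.le⟩

theorem ae_cubeVol {p : (ι → ℝ) → Prop} (h : ∀ x ∈ Set.Icc (0 : ι → ℝ) 1, p x) :
    ∀ᵐ x ∂cubeVol ι, p x :=
  (ae_restrict_iff' isOpen_openCube.measurableSet).2
    (ae_of_all _ fun x hx => h x (openCube_subset_Icc hx))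

theorem integrable_real_of_continuous {f : (ι → ℝ) → ℝ} (hf : Continuous f) :
    Integrable f (cubeVol ι) := by
  have := (integrable_of_continuous (Complex.continuous_ofReal.comp hf)).re
  simpa using this

/-- Approximation in the coordinate `a`. -/
theorem mul_mem_lpSub {M : Submodule ℂ (Lp ℂ 2 (cubeVol ι))}
    (hM : IsClosed (M : Set (Lp ℂ 2 (cubeVol ι)))) {r : (ι → ℝ) → ℝ} (hr : Continuous r) (a : ι)
    {s : Set (ℝ → ℝ)} (hs : ∀ g ∈ s, Continuous g)
    (hd : ∀ f : ℝ → ℝ, Continuous f → ∀ ε : ℝ, 0 < ε →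
      ∃ q ∈ Submodule.span ℝ s, ∫ t in (0 : ℝ)..1, (f t - q t) ^ 2 < ε)
    (hmem : ∀ g ∈ s, (fun x : ι → ℝ => ((g (x a) * r x : ℝ) : ℂ)) ∈ lpSub M)
    {f : ℝ → ℝ} (hf : Continuous f) :
    (fun x : ι → ℝ => ((f (x a) * r x : ℝ) : ℂ)) ∈ lpSub M := by
  have hspan : ∀ q ∈ Submodule.span ℝ s,
      (fun x : ι → ℝ => ((q (x a) * r x : ℝ) : ℂ)) ∈ lpSub M := by
    intro q hq
    induction hq using Submodule.span_induction with
    | mem g hg => exact hmem g hg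
    | zero =>
      convert (lpSub M).zero_mem using 1
      funext x; simp
    | add g h _ _ ig ih =>
      convert (lpSub M).add_mem ig ih using 1
      funext x; simp only [Pi.add_apply]; push_cast; ring
    | smul b g _ ig =>
      convert (lpSub M).smul_mem (b : ℂ) ig using 1
      funext x; simp only [Pi.smul_apply, smul_eq_mul]; push_cast; ring
  obtain ⟨A, hA⟩ := (isCompact_Icc (a := (0 : ι → ℝ)) (b := 1)).exists_bound_of_continuousOn
    hr.continuousOn
  refine mem_lpSub_of_near hM (by fun_prop) fun ε hε => ?_
  obtain ⟨q, hq, hqε⟩ := hd f hf (ε / (A ^ 2 + 1)) (by positivity)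
  refine ⟨_, hspan q hq, ?_⟩
  have hqc : Continuous q := continuous_of_mem_span hs hq
  have hval : ∀ x : ι → ℝ, ‖((f (x a) * r x : ℝ) : ℂ) - ((q (x a) * r x : ℝ) : ℂ)‖ ^ 2 =
      (f (x a) - q (x a)) ^ 2 * r x ^ 2 := by
    intro x
    rw [← Complex.ofReal_sub, Complex.norm_real, Real.norm_eq_abs, sq_abs]
    ring
  simp only [hval]
  have hc : Continuous fun t => (f t - q t) ^ 2 := by fun_prop
  calc ∫ x, (f (x a) - q (x a)) ^ 2 * r x ^ 2 ∂cubeVol ι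
      ≤ ∫ x, (f (x a) - q (x a)) ^ 2 * A ^ 2 ∂cubeVol ι := by
        refine integral_mono_ae (integrable_real_of_continuous (by fun_prop))
          (integrable_real_of_continuous (by fun_prop)) (ae_cubeVol fun x hx => ?_)
        refine mul_le_mul_of_nonneg_left ?_ (sq_nonneg _)
        rw [← sq_abs]
        exact pow_le_pow_left₀ (abs_nonneg _) (hA x hx) 2
    _ = (∫ t in (0 : ℝ)..1, (f t - q t) ^ 2) * A ^ 2 := by
        rw [integral_mul_const, integral_comp_apply hc a]
    _ ≤ ε / (A ^ 2 + 1) * A ^ 2 := mul_le_mul_of_nonneg_right hqε.le (sq_nonneg _)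
    _ < ε := by
        rw [div_mul_eq_mul_div, div_lt_iff₀ (by positivity)]
        nlinarith

/-- The factors are freed one coordinate at a time: `T` is the set of coordinates whose factor is
already allowed to be any continuous function. -/
theorem prodFun_mem_lpSub {M : Submodule ℂ (Lp ℂ 2 (cubeVol ι))}
    (hM : IsClosed (M : Set (Lp ℂ 2 (cubeVol ι)))) {s : ι → Set (ℝ → ℝ)}
    (hs : ∀ i, ∀ g ∈ s i, Continuous g)
    (hd : ∀ i, ∀ f : ℝ → ℝ, Continuous f → ∀ ε : ℝ, 0 < ε →
      ∃ q ∈ Submodule.span ℝ (s i), ∫ t in (0 : ℝ)..1, (f t - q t) ^ 2 < ε)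
    (hmem : ∀ ψ : ι → ℝ → ℝ, (∀ i, ψ i ∈ s i) → prodFun ψ ∈ lpSub M) (T : Finset ι) :
    ∀ ψ : ι → ℝ → ℝ, (∀ i ∈ T, Continuous (ψ i)) → (∀ i ∉ T, ψ i ∈ s i) →
      prodFun ψ ∈ lpSub M := by
  induction T using Finset.induction_on with
  | empty => exact fun ψ _ h => hmem ψ fun i => h i (Finset.notMem_empty i)
  | insert a T ha ih =>
    intro ψ h1 h2
    have hc : ∀ i, Continuous (ψ i) := fun i =>
      if hi : i ∈ insert a T then h1 i hi else hs i _ (h2 i hi)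
    have hr : Continuous fun x : ι → ℝ => ∏ m ∈ Finset.univ.erase a, ψ m (x m) :=
      continuous_finsetProd _ fun i _ => (hc i).comp (continuous_apply i)
    have key := mul_mem_lpSub hM hr a (hs a) (hd a) (fun g hg => ?_) (hc a)
    · convert key using 1
      funext x
      rw [prodFun_eq_mul _ a, Complex.ofReal_mul]
    · have := ih (Function.update ψ a g) (fun i hi => ?_) fun i hi => ?_
      · convert this using 1
        funext x
        rw [prodFun_eq_mul _ a, Complex.ofReal_mul, Function.update_self]
        congr 2
        refine Finset.prod_congr rfl fun m hm => ?_
        rw [Function.update_of_ne (Finset.ne_of_mem_erase hm)]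
      · rw [Function.update_of_ne (by rintro rfl; exact ha hi)]
        exact hc i
      · by_cases hia : i = a
        · subst hia; rwa [Function.update_self]
        · rw [Function.update_of_ne hia]
          exact h2 i (by simp [hia, hi])

/-- By Stone–Weierstrass polynomials are uniformly dense on the closed cube, and a polynomial is a
sum of products of functions of one coordinate. -/
theorem ofReal_mem_lpSub {M : Submodule ℂ (Lp ℂ 2 (cubeVol ι))}
    (hM : IsClosed (M : Set (Lp ℂ 2 (cubeVol ι))))
    (hmem : ∀ ψ : ι → ℝ → ℝ, (∀ i, Continuous (ψ i)) → prodFun ψ ∈ lpSub M)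
    {f : (ι → ℝ) → ℝ} (hf : Continuous f) : (fun x => (f x : ℂ)) ∈ lpSub M := by
  have hpoly : ∀ p : MvPolynomial ι ℝ, (fun x => ((MvPolynomial.eval x p : ℝ) : ℂ)) ∈ lpSub M := by
    intro p
    have : (fun x => ((MvPolynomial.eval x p : ℝ) : ℂ)) =
        ∑ d ∈ p.support, ((p.coeff d : ℝ) : ℂ) • prodFun fun i t => t ^ d i := by
      funext x
      rw [MvPolynomial.eval_eq', Finset.sum_apply]
      simp [prodFun]
    rw [this]
    exact Submodule.sum_mem _ fun d _ =>
      Submodule.smul_mem _ _ (hmem _ fun i => continuous_pow _)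
  let X := Set.Icc (0 : ι → ℝ) 1
  let e : MvPolynomial ι ℝ →ₐ[ℝ] C(X, ℝ) := MvPolynomial.aeval fun i =>
    ⟨fun x => x.1 i, (continuous_apply i).comp continuous_subtype_val⟩
  have he : ∀ p (x : X), e p x = MvPolynomial.eval x.1 p := by
    intro p x
    induction p using MvPolynomial.induction_on with
    | C a => simp [e]
    | add p q hp hq => simp only [map_add, ContinuousMap.add_apply, hp, hq]
    | mul_X p i hp =>
      simp only [map_mul, ContinuousMap.mul_apply, hp, MvPolynomial.eval_X]
      simp [e]
  have hsep : e.range.SeparatesPoints := by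
    intro x y hxy
    obtain ⟨i, hi⟩ := Function.ne_iff.1 fun h => hxy (Subtype.ext h)
    refine ⟨_, ⟨e (MvPolynomial.X i), ⟨_, rfl⟩, rfl⟩, ?_⟩
    simpa only [he, MvPolynomial.eval_X] using hi
  refine mem_lpSub_of_near hM (by fun_prop) fun ε hε => ?_
  obtain ⟨δ, hδ, hδε⟩ : ∃ δ : ℝ, 0 < δ ∧ δ ^ 2 < ε :=
    ⟨√(ε / 2), by positivity, by rw [Real.sq_sqrt (by positivity)]; linarith⟩
  obtain ⟨⟨g, p, rfl⟩, hg⟩ := ContinuousMap.exists_mem_subalgebra_near_continuous_of_separatesPoints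
    e.range hsep (fun x => f x.1) (hf.comp continuous_subtype_val) δ hδ
  refine ⟨_, hpoly p, lt_of_le_of_lt ?_ hδε⟩
  have hpc : Continuous fun x : ι → ℝ => MvPolynomial.eval x p := MvPolynomial.continuous_eval p
  calc ∫ x, ‖(f x : ℂ) - ((MvPolynomial.eval x p : ℝ) : ℂ)‖ ^ 2 ∂cubeVol ι
      ≤ ∫ _, δ ^ 2 ∂cubeVol ι := by
        refine integral_mono_ae (integrable_real_of_continuous (by fun_prop))
          (integrable_const _) (ae_cubeVol fun x hx => ?_)
        refine pow_le_pow_left₀ (norm_nonneg _) ?_ 2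
        have := (hg ⟨x, hx⟩).le
        rw [← Complex.ofReal_sub, Complex.norm_real, norm_sub_rev]
        simpa only [RingHom.coe_coe, AlgHom.toRingHom_eq_coe, he] using this
    _ = δ ^ 2 := by simp

theorem eq_top_of_prodFun_mem {M : Submodule ℂ (Lp ℂ 2 (cubeVol ι))}
    (hM : IsClosed (M : Set (Lp ℂ 2 (cubeVol ι))))
    (hmem : ∀ ψ : ι → ℝ → ℝ, (∀ i, Continuous (ψ i)) → prodFun ψ ∈ lpSub M) : M = ⊤ := by
  have hcont : ∀ f : (ι → ℝ) → ℂ, Continuous f → f ∈ lpSub M := by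
    intro f hf
    have h1 := ofReal_mem_lpSub hM hmem (Complex.continuous_re.comp hf)
    have h2 := ofReal_mem_lpSub hM hmem (Complex.continuous_im.comp hf)
    convert (lpSub M).add_mem h1 ((lpSub M).smul_mem Complex.I h2) using 1
    funext x
    simp only [Pi.add_apply, Pi.smul_apply, smul_eq_mul, Function.comp_apply]
    rw [mul_comm, Complex.re_add_im]
  refine eq_top_iff.2 fun v _ => ?_
  rw [← SetLike.mem_coe, ← hM.closure_eq, Metric.mem_closure_iff]
  intro ε hε
  obtain ⟨g, hg, hgm⟩ := (Lp.memLp v).exists_boundedContinuous_eLpNorm_sub_le (by norm_num)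
    (ε := ENNReal.ofReal (ε / 2)) (by simpa using hε)
  obtain ⟨h, hgM⟩ := hcont g g.continuous
  refine ⟨h.toLp g, hgM, ?_⟩
  have hv : v = (Lp.memLp v).toLp v := (Lp.toLp_coeFn v _).symm
  rw [dist_eq_norm, hv, ← MemLp.toLp_sub, Lp.norm_toLp]
  have := ENNReal.toReal_mono ENNReal.ofReal_ne_top hg
  rw [ENNReal.toReal_ofReal (by positivity)] at this
  exact this.trans_lt (by linarith)

/-- The inclusion of the summand of `dx_I`. -/
def singleForm (I : Finset ι) : Lp ℂ 2 (cubeVol ι) →ₗ[ℂ] L2Form ι :=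
  (WithLp.linearEquiv 2 ℂ _).symm.toLinearMap ∘ₗ LinearMap.single ℂ (fun _ : Finset ι => Lp ℂ 2 (cubeVol ι)) I

theorem continuous_singleForm (I : Finset ι) : Continuous (singleForm I) :=
  (PiLp.continuous_toLp 2 _).comp
    (continuous_single (A := fun _ : Finset ι => Lp ℂ 2 (cubeVol ι)) I)

theorem sum_singleForm (v : L2Form ι) : ∑ I, singleForm I (v I) = v := by
  apply (WithLp.linearEquiv 2 ℂ _).injective
  rw [map_sum]
  exact Finset.univ_sum_single (WithLp.ofLp v)

theorem toL2_contProd (c : ι → ℝ) (k : ι → ℕ) (I : Finset ι) : toL2 ι (contProd c k I) =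
    singleForm I ((memLp_of_continuous (contDiff_prodCoeff c k I).continuous).toLp _) := by
  ext1 J
  by_cases h : J = I
  · subst h
    change MemLp.toLp (prodForm c k J J) (memLp_of_continuous ((contProd c k J).2 J)) =
      (Pi.single J _ : Finset ι → Lp ℂ 2 (cubeVol ι)) J
    rw [Pi.single_eq_same]
    congr 1
    funext x
    simp [prodForm]
  · change MemLp.toLp (prodForm c k I J) (memLp_of_continuous ((contProd c k I).2 J)) =
      (Pi.single I _ : Finset ι → Lp ℂ 2 (cubeVol ι)) J
    rw [Pi.single_eq_of_ne h]
    have h0 : prodForm c k I J = 0 := by funext x; simp [prodForm, h]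
    simp only [h0]
    exact MemLp.toLp_zero _

/-- The product forms that satisfy the boundary conditions span a dense space. -/
theorem eq_top_of_contProd_mem {c : ι → ℝ} (hc : ∀ i, 0 < c i) {M : Submodule ℂ (L2Form ι)}
    (hM : IsClosed (M : Set (L2Form ι)))
    (h : ∀ (k : ι → ℕ) (I : Finset ι), (∀ i ∉ I, k i ≠ 0) → toL2 ι (contProd c k I) ∈ M) :
    M = ⊤ := by
  have hI : ∀ I : Finset ι, M.comap (singleForm I) = ⊤ := by
    intro I
    have hcl : IsClosed ((M.comap (singleForm I) : Submodule ℂ _) : Set (Lp ℂ 2 (cubeVol ι))) :=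
      hM.preimage (continuous_singleForm I)
    refine eq_top_of_prodFun_mem hcl fun ψ hψ => ?_
    let s : ι → Set (ℝ → ℝ) := fun i =>
      if i ∈ I then Set.range (cosMode (c i)) else sinMode '' {k | k ≠ 0}
    refine prodFun_mem_lpSub hcl (s := s) ?_ ?_ ?_ Finset.univ ψ (fun i _ => hψ i)
      fun i hi => absurd (Finset.mem_univ i) hi
    · intro i g hg
      simp only [s] at hg
      split_ifs at hg
      · obtain ⟨k, rfl⟩ := hg
        exact continuous_cosMode _ _
      · obtain ⟨k, _, rfl⟩ := hg
        exact continuous_sinMode _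
    · intro i f hf ε hε
      simp only [s]
      split_ifs
      · exact exists_cosMode_near_sq (hc i) hf hε
      · exact exists_sinSpan_near hf hε
    · intro φ hφ
      have : ∀ i, ∃ k, (i ∉ I → k ≠ 0) ∧ φ i = mode (c i) k (i ∈ I) := by
        intro i
        have hi := hφ i
        simp only [s] at hi
        split_ifs at hi with hiI
        · obtain ⟨k, hk⟩ := hi
          exact ⟨k, fun h => absurd hiI h, by simp [mode, hiI, hk]⟩
        · obtain ⟨k, hk0, hk⟩ := hi
          exact ⟨k, fun _ => hk0, by simp [mode, hiI, hk]⟩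
      choose k hk0 hk using this
      have hm := h k I hk0
      rw [toL2_contProd] at hm
      have hφ' : φ = fun i => mode (c i) (k i) (i ∈ I) := funext hk
      rw [hφ']
      exact ⟨_, hm⟩
  refine eq_top_iff.2 fun v _ => ?_
  rw [← sum_singleForm v]
  refine Submodule.sum_mem _ fun I _ => ?_
  have : v I ∈ M.comap (singleForm I) := by rw [hI]; trivial
  exact this

end CubeForm

end

noncomputable section

set_option linter.unusedSectionVars false

/-! ### Symmetry of the operator -/

namespace CubicalComplex

open CubeForm

variable {V : Type*} {K : CubicalComplex V}

theorem Step.isSplit (hK : K.IsCAT0) {P : V} {C D : K.Cube} (s : Step P C D) :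
    IsSplit (dirIncl s.facet.1) (⟨s.H, s.mem_mid⟩ : Dir D) := by
  refine ⟨fun a ha => s.notMem_mid ?_, fun b hb => ?_⟩
  · have : a.1 = s.H := congrArg Subtype.val ha
    exact this ▸ a.2
  · rcases (s.mid_eq hK).subset b.2 with h | h
    · exact absurd (Subtype.ext h) hb
    · exact ⟨⟨b.1, h⟩, rfl⟩

theorem finite_step_out (hK : K.IsCAT0) (hK' : K.HasBoundedGeometry) (P : V) (C : K.Cube) :
    Finite (Σ D : K.Cube, Step P C D) := by
  obtain ⟨Q, hQ⟩ := hK.exists_leads P C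
  have h : (Set.range fun s : (Σ D : K.Cube, Step P C D) => s.2.H).Finite := by
    rw [hK.range_step_out hK' hQ]
    exact (hK'.finite_sah hK P Q).subset Set.sdiff_subset
  exact Set.finite_univ_iff.1 (Set.Finite.of_finite_image (by rwa [Set.image_univ])
    (Step.injective_out hK P C).injOn)

theorem finite_step_in (hK : K.IsCAT0) (P : V) (D : K.Cube) :
    Finite (Σ C : K.Cube, Step P C D) := by
  obtain ⟨Q, hQ⟩ := hK.exists_leads P D
  have h : (Set.range fun s : (Σ C : K.Cube, Step P C D) => s.2.H).Finite := by
    rw [hK.range_step_in hQ]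
    exact finite_mid D
  exact Set.finite_univ_iff.1 (Set.Finite.of_finite_image (by rwa [Set.image_univ])
    (Step.injective_in hK P D).injOn)

open Classical in
theorem onCube_apply_of_ne {C D : K.Cube} (h : D ≠ C) (β : contForm (Dir C)) :
    onCube C β D = 0 := lp.single_apply_ne _ _ _ h

open Classical in
theorem inner_onCube_same (C : K.Cube) (β γ : contForm (Dir C)) :
    inner ℂ (onCube C β) (onCube C γ) = inner ℂ (toL2 _ β) (toL2 _ γ) := by
  change inner ℂ (lp.single 2 C _) (lp.single 2 C _) = _
  rw [lp.inner_single_left, lp.single_apply_self]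

open Classical in
theorem inner_onCube_of_ne {C D : K.Cube} (h : C ≠ D) (β : contForm (Dir C))
    (γ : contForm (Dir D)) : inner ℂ (onCube C β) (onCube D γ) = 0 := by
  change inner ℂ (lp.single 2 C _) (lp.single 2 D _) = _
  rw [lp.inner_single_left, lp.single_apply_ne _ _ _ h, inner_zero_right]

theorem inner_wittenOn (w : K.Hyperplane → ℝ) (C D : K.Cube) (β : smoothForm₀ (Dir C))
    (γ : smoothForm₀ (Dir D)) :
    inner ℂ (wittenOn w C β) (onCube D (smoothToCont _ γ)) =
      inner ℂ (onCube C (smoothToCont _ β)) (wittenOn w D γ) := by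
  by_cases h : C = D
  · subst h
    exact (inner_onCube_same C _ _).trans ((inner_wittenOp _ β γ).trans
      (inner_onCube_same C _ _).symm)
  · exact (inner_onCube_of_ne h _ _).trans (inner_onCube_of_ne h _ _).symm

/-- At most one step joins `C` to `D`, so on either side at most one summand is not orthogonal to
the other form, and the two match by `inner_eMap`. -/
theorem inner_eOn (hK : K.IsCAT0) (hK' : K.HasBoundedGeometry) (P : V) (w : K.Hyperplane → ℝ)
    (C D : K.Cube) (β : smoothForm₀ (Dir C)) (γ : smoothForm₀ (Dir D)) :
    inner ℂ (eOn P w C β) (onCube D (smoothToCont _ γ)) =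
      inner ℂ (onCube C (smoothToCont _ β)) (eAdjOn P w D γ) := by
  classical
  -- A `finsum` with infinite support is 0 by default; bounded geometry makes the sum defining `e_w`
  -- a genuine finite sum.
  have := finite_step_out hK hK' P C
  have := finite_step_in hK P D
  have := Fintype.ofFinite (Σ D : K.Cube, Step P C D)
  have := Fintype.ofFinite (Σ C : K.Cube, Step P C D)
  have hsub := Step.subsingleton hK (P := P) (C := C) (D := D)
  rw [eOn, eAdjOn, finsum_eq_sum_of_fintype, finsum_eq_sum_of_fintype, LinearMap.sum_apply,
    LinearMap.sum_apply, sum_inner, inner_sum]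
  simp only [LinearMap.comp_apply]
  by_cases hs : Nonempty (Step P C D)
  · obtain ⟨s⟩ := hs
    rw [Finset.sum_eq_single ⟨D, s⟩, Finset.sum_eq_single ⟨C, s⟩, inner_onCube_same,
      inner_onCube_same]
    · exact inner_eMap (s.isSplit hK) _ _ _
    · rintro ⟨C', s'⟩ _ hne
      refine inner_onCube_of_ne ?_ _ _
      rintro rfl
      exact hne (by rw [Subsingleton.elim s s'])
    · simp
    · rintro ⟨D', s'⟩ _ hne
      refine inner_onCube_of_ne ?_ _ _
      rintro rfl
      exact hne (by rw [Subsingleton.elim s s'])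
    · simp
  · rw [Finset.sum_eq_zero, Finset.sum_eq_zero]
    · rintro ⟨C', s'⟩ _
      refine inner_onCube_of_ne ?_ _ _
      rintro rfl
      exact hs ⟨s'⟩
    · rintro ⟨D', s'⟩ _
      refine inner_onCube_of_ne ?_ _ _
      rintro rfl
      exact hs ⟨s'⟩

open Classical in
theorem smoothToL2_lof (C : K.Cube) (β : smoothForm₀ (Dir C)) :
    smoothToL2 (DirectSum.lof ℂ K.Cube (fun C => smoothForm₀ (Dir C)) C β) =
      onCube C (smoothToCont _ β) := by
  rw [smoothToL2, DirectSum.toModule_lof]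
  rfl

open Classical in
theorem deRhamMap_lof (P : V) (w : K.Hyperplane → ℝ) (C : K.Cube)
    (β : smoothForm₀ (Dir C)) :
    deRhamMap P w (DirectSum.lof ℂ K.Cube (fun C => smoothForm₀ (Dir C)) C β) =
      wittenOn w C β + eOn P w C β + eAdjOn P w C β := by
  rw [deRhamMap, DirectSum.toModule_lof]
  rfl

theorem inner_deRhamMap (hK : K.IsCAT0) (hK' : K.HasBoundedGeometry) (P : V)
    (w : K.Hyperplane → ℝ) (β γ : K.Smooth₀) :
    inner ℂ (deRhamMap P w β) (smoothToL2 γ) = inner ℂ (smoothToL2 β) (deRhamMap P w γ) := by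
  classical
  induction β using DirectSum.induction_on with
  | zero => simp
  | add x y hx hy => simp only [map_add, inner_add_left, hx, hy]
  | of C b =>
    induction γ using DirectSum.induction_on with
    | zero => simp
    | add x y hx hy => simp only [map_add, inner_add_right, hx, hy]
    | of D g =>
      change inner ℂ (deRhamMap P w (DirectSum.lof ℂ K.Cube _ C b))
        (smoothToL2 (DirectSum.lof ℂ K.Cube _ D g)) =
        inner ℂ (smoothToL2 (DirectSum.lof ℂ K.Cube _ C b))
          (deRhamMap P w (DirectSum.lof ℂ K.Cube _ D g))
      rw [smoothToL2_lof, smoothToL2_lof, deRhamMap_lof, deRhamMap_lof]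
      have h := congrArg (starRingEnd ℂ) (inner_eOn hK hK' P w D C g b)
      rw [inner_conj_symm, inner_conj_symm] at h
      rw [inner_add_left, inner_add_left, inner_add_right, inner_add_right, inner_wittenOn,
        inner_eOn hK hK', h]
      ring

theorem mem_graph_deRham (P : V) (w : K.Hyperplane → ℝ) (β : K.Smooth₀) :
    (smoothToL2 β, deRhamMap P w β) ∈ (deRham P w).graph :=
  (LinearPMap.mem_graph_iff _).2 ⟨⟨_, LinearMap.mem_range_self _ β⟩, rfl,
    LinearPMap.ofRange_apply _ _ _ β⟩

theorem inner_deRham (hK : K.IsCAT0) (hK' : K.HasBoundedGeometry) (P : V)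
    (w : K.Hyperplane → ℝ) (x y : (deRham P w).domain) :
    inner ℂ (deRham P w x) (y : K.L2Forms) = inner ℂ (x : K.L2Forms) (deRham P w y) := by
  obtain ⟨_, β, rfl⟩ := x
  obtain ⟨_, γ, rfl⟩ := y
  have h : ∀ δ : K.Smooth₀, deRham P w ⟨smoothToL2 δ, LinearMap.mem_range_self _ δ⟩ =
    deRhamMap P w δ := fun δ => LinearPMap.ofRange_apply _ _ _ δ
  rw [h, h]
  exact inner_deRhamMap hK hK' P w β γ

end CubicalComplex

end

noncomputable section

set_option linter.unusedSectionVars false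

/-! ### The eigenspaces -/

namespace CubeForm

/-! ### Signs and anticommutation -/

section sign

variable {α : Type*} [LinearOrder α]

theorem neg_one_pow_card_toggle (i : α) (I : Finset α) :
    (-1 : ℂ) ^ (toggle i I).card = -(-1) ^ I.card := by
  by_cases h : i ∈ I
  · rw [toggle_of_mem h, ← Finset.card_erase_add_one h, pow_succ]
    ring
  · rw [toggle_of_notMem h, Finset.card_insert_of_notMem h, pow_succ]
    ring

theorem sgn_toggle_of_ne {i k : α} (h : i ≠ k) (I : Finset α) :
    sgn k (toggle i I) = (if i < k then -1 else 1) * sgn k I := by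
  unfold sgn
  split_ifs with hik
  · have : (toggle i I).filter (· < k) = toggle i (I.filter (· < k)) := by
      ext m
      by_cases hm : m = i
      · subst hm; simp [mem_toggle_self, hik]
      · simp [mem_toggle_of_ne hm]
    rw [this, neg_one_pow_card_toggle]
    ring
  · rw [one_mul]
    congr 2
    ext m
    by_cases hm : m = i
    · subst hm; simp [hik]
    · simp [mem_toggle_of_ne hm]

/-- Toggling the smaller of two directions changes the sign of the larger one, and not the reverse:
this is the anticommutation of the differentials. -/
theorem sgn_mul_sgn_toggle {i k : α} (h : i ≠ k) (I : Finset α) :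
    sgn i I * sgn k (toggle i I) = -(sgn k I * sgn i (toggle k I)) := by
  rw [sgn_toggle_of_ne h, sgn_toggle_of_ne h.symm]
  rcases lt_or_gt_of_ne h with hlt | hlt
  · rw [if_pos hlt, if_neg hlt.not_gt]; ring
  · rw [if_neg hlt.not_gt, if_pos hlt]; ring

theorem sgn_mul_self (i : α) (I : Finset α) : sgn i I * sgn i I = 1 := by
  rw [sgn, ← pow_add, ← two_mul, pow_mul]; simp

theorem toggle_comm (i k : α) (I : Finset α) : toggle i (toggle k I) = toggle k (toggle i I) := by
  by_cases h : i = k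
  · rw [h]
  ext m
  by_cases hi : m = i
  · subst hi; rw [mem_toggle_self, mem_toggle_of_ne h, mem_toggle_of_ne h, mem_toggle_self]
  · by_cases hk : m = k
    · subst hk; rw [mem_toggle_of_ne hi, mem_toggle_self, mem_toggle_self, mem_toggle_of_ne hi]
    · simp only [mem_toggle_of_ne hi, mem_toggle_of_ne hk]

theorem toggle_subset {i : α} {I A : Finset α} (hi : i ∈ A) (hI : I ⊆ A) : toggle i I ⊆ A := by
  unfold toggle; split_ifs
  · exact (Finset.erase_subset _ _).trans hI
  · exact Finset.insert_subset hi hI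

/-- The off-diagonal part of the double sum equals its own negative. -/
theorem sum_sum_eq_sum_diag {E : Type*} [AddCommGroup E] [Module ℂ E] (A : Finset α)
    (a : α → α → E) (h : ∀ i k, i ≠ k → a i k = -a k i) :
    ∑ i ∈ A, ∑ k ∈ A, a i k = ∑ i ∈ A, a i i := by
  have h0 : ∑ i ∈ A, ∑ k ∈ A, (a i k - if i = k then a i i else 0) = 0 := by
    have hswap : ∑ i ∈ A, ∑ k ∈ A, (a i k - if i = k then a i i else 0) =
        -∑ i ∈ A, ∑ k ∈ A, (a i k - if i = k then a i i else 0) := by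
      conv_lhs => rw [Finset.sum_comm]
      rw [← Finset.sum_neg_distrib]
      refine Finset.sum_congr rfl fun k _ => ?_
      rw [← Finset.sum_neg_distrib]
      refine Finset.sum_congr rfl fun i _ => ?_
      by_cases hik : i = k
      · subst hik; simp
      · simp [hik, Ne.symm hik, h i k hik]
    have h2 : (2 : ℂ) • ∑ i ∈ A, ∑ k ∈ A, (a i k - if i = k then a i i else 0) = 0 := by
      rw [two_smul]
      nth_rewrite 1 [hswap]
      exact neg_add_cancel _
    exact (smul_eq_zero.1 h2).resolve_left two_ne_zero
  simp only [Finset.sum_sub_distrib, sub_eq_zero] at h0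
  rw [h0]
  refine Finset.sum_congr rfl fun i hi => ?_
  rw [Finset.sum_ite_eq, if_pos hi]

end sign

end CubeForm

namespace CubicalComplex

open CubeForm

variable {V : Type*} {K : CubicalComplex V}

theorem intervalEigenvalueSq_eq (c : ℝ) (k : ℕ) :
    intervalEigenvalueSq c k = if k = 0 then intervalEigenvalueSq c k else nu c k := by
  by_cases h : k = 0 <;> simp [intervalEigenvalueSq, nu, h]

/-- The cube that contains `Q` and is cut by the hyperplanes in `S`. -/
def cubeAt (Q : V) (S : Finset K.Hyperplane) : K.Cube :=
  @Classical.epsilon K.Cube ⟨vertex Q⟩ fun C => Q ∈ C.1 ∧ Mid C = S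

theorem cubeAt_eq (hK : K.IsCAT0) {Q : V} {S : Finset K.Hyperplane} {C : K.Cube} (hQ : Q ∈ C.1)
    (h : Mid C = S) : cubeAt Q S = C := by
  have := Classical.epsilon_spec_aux ⟨vertex Q⟩ (fun C : K.Cube => Q ∈ C.1 ∧ Mid C = S)
    ⟨C, hQ, h⟩
  exact hK.cube_eq_of_mid_eq this.1 hQ (this.2.trans h.symm)

theorem cubeAt_spec (hK : K.IsCAT0) {P Q : V} {S : Finset K.Hyperplane}
    (hS : ↑S ⊆ SAH P (vertex Q : K.Cube)) :
    Mid (cubeAt Q S : K.Cube) = S ∧ Leads P Q (cubeAt Q S : K.Cube) := by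
  obtain ⟨C, hQ, hC⟩ := hK.exists_cube hS
  rw [cubeAt_eq hK hQ hC]
  exact ⟨hC, hQ, by rwa [hC]⟩

/-- The directions of `C` that belong to `I`. -/
def loc (C : K.Cube) (I : Finset K.Hyperplane) : Finset (Dir C) :=
  Finset.univ.filter fun a => a.1 ∈ I

theorem mem_loc {C : K.Cube} {I : Finset K.Hyperplane} {a : Dir C} : a ∈ loc C I ↔ a.1 ∈ I := by
  simp [loc]

/-- The sign does not depend on the cube, because the order on the directions of `C` is that of all
hyperplanes. So terms coming from cubes of different dimension have compatible signs. -/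
theorem sgn_loc {C : K.Cube} {I : Finset K.Hyperplane} (hI : ↑I ⊆ Mid C) (a : Dir C) :
    sgn a (loc C I) = sgn a.1 I := by
  unfold sgn
  congr 1
  refine Finset.card_bij (fun b _ => b.1) (fun b hb => ?_) (fun b _ b' _ h => Subtype.ext h)
    fun H hH => ?_
  · simpa [mem_loc] using hb
  · rw [Finset.mem_filter] at hH
    exact ⟨⟨H, hI hH.1⟩, Finset.mem_filter.2 ⟨mem_loc.2 hH.1, hH.2⟩, rfl⟩

theorem toggle_loc {C : K.Cube} [DecidableEq (Dir C)] (I : Finset K.Hyperplane) (a : Dir C) :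
    toggle a (loc C I) = loc C (toggle a.1 I) := by
  ext b
  by_cases h : b = a
  · subst h; simp only [mem_toggle_self, mem_loc]
  · rw [mem_toggle_of_ne h, mem_loc, mem_loc,
      mem_toggle_of_ne fun hba => h (Subtype.ext hba)]

/-- The product form on `C` with the modes `k` and the directions `I`. -/
def formOn (w : K.Hyperplane → ℝ) (k : K.Hyperplane → ℕ) (I : Finset K.Hyperplane) (C : K.Cube) :
    K.L2Forms :=
  onCube C (contProd (fun a : Dir C => w a.1) (fun a => k a.1) (loc C I))

/-- The product form with the modes `k` and the directions `I` that belongs to `Q`. -/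
def blockForm (w : K.Hyperplane → ℝ) (Q : V) (k : K.Hyperplane →₀ ℕ) (I : Finset K.Hyperplane) :
    K.L2Forms :=
  -- A direction outside `I` with mode 0 stands for the constant 1 of the one-dimensional model, so
  -- it is not a direction of the cube.
  formOn w k I (cubeAt Q (I ∪ k.support))

theorem formOn_eq_blockForm (hK : K.IsCAT0) (w : K.Hyperplane → ℝ) {Q : V}
    {k : K.Hyperplane →₀ ℕ} {I : Finset K.Hyperplane} {C : K.Cube} (hQ : Q ∈ C.1)
    (h : Mid C = ↑(I ∪ k.support)) : formOn w k I C = blockForm w Q k I := by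
  rw [blockForm, cubeAt_eq hK hQ h]

-- Steps are reindexed by their hyperplanes, so that the three parts of the operator become sums
-- over the same finite set and can be added term by term.
open Classical in
theorem finsum_apply_eq_sum {σ X A E : Type*} [AddCommGroup A] [Module ℂ A] [AddCommGroup E]
    [Module ℂ E] {φ : σ → X} (hφ : Function.Injective φ) {R : Set X} (hR : Set.range φ = R)
    {B : Finset X} (hB : R ⊆ B) (L : σ → A →ₗ[ℂ] E) (a : A) (g : X → E)
    (h : ∀ s, L s a = g (φ s)) : (∑ᶠ s, L s) a = ∑ x ∈ B, if x ∈ R then g x else 0 := by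
  have hfin : Finite σ := Set.finite_univ_iff.1 (Set.Finite.of_finite_image
    (by rw [Set.image_univ, hR]; exact B.finite_toSet.subset hB) hφ.injOn)
  have := Fintype.ofFinite σ
  rw [finsum_eq_sum_of_fintype, LinearMap.sum_apply, ← Finset.sum_filter]
  have : B.filter (· ∈ R) = Finset.univ.image φ := by
    ext x
    rw [← hR]
    simp only [Finset.mem_filter, Finset.mem_image, Finset.mem_univ, true_and, Set.mem_range]
    exact ⟨fun h => h.2, fun h => ⟨hB (hR ▸ h), h⟩⟩
  rw [this, Finset.sum_image hφ.injOn]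
  exact Finset.sum_congr rfl fun s _ => h s

/-! ### The operator on product forms -/

section action

variable (hK : K.IsCAT0) (hK' : K.HasBoundedGeometry) {P Q : V} (w : K.Hyperplane → ℝ)
  {k : K.Hyperplane →₀ ℕ} {I : Finset K.Hyperplane} {C : K.Cube} {A : Finset K.Hyperplane}

/-- The coefficient of the summand of `D_dR` in the direction `H`. -/
def coeff (w : K.Hyperplane → ℝ) (k : K.Hyperplane → ℕ) (I : Finset K.Hyperplane)
    (H : K.Hyperplane) : ℂ :=
  sgn H I * if H ∈ I then (intervalEigenvalueSq (w H) (k H) : ℂ) else 1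

theorem ne_zero_of_notMem_loc (hC : Mid C = ↑(I ∪ k.support)) (a : Dir C) (ha : a ∉ loc C I) :
    k a.1 ≠ 0 := by
  have h := hC.subset a.2
  rw [Finset.coe_union] at h
  rcases h with h | h
  · exact absurd (mem_loc.2 h) ha
  · exact Finsupp.mem_support_iff.1 h

theorem subset_mid (hC : Mid C = ↑(I ∪ k.support)) : ↑I ⊆ Mid C := by
  rw [hC]; exact_mod_cast Finset.subset_union_left

-- The operator `d_w + d_w^⋄` stays on the cube and accounts for the directions with nonzero mode. A
-- direction in `I` with mode 0 drops out because `nu` vanishes there.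
include hK in
theorem wittenOn_smoothProd (hQ : Leads P Q C) (hC : Mid C = ↑(I ∪ k.support))
    (hA : I ∪ k.support ⊆ A) :
    wittenOn w C (smoothProd (fun a : Dir C => w a.1) (fun a => k a.1) (loc C I)) =
      ∑ H ∈ A, if H ∈ k.support then coeff w k I H • blockForm w Q k (toggle H I) else 0 := by
  classical
  rw [wittenOn, LinearMap.comp_apply, wittenOp_smoothProd _ (ne_zero_of_notMem_loc hC), map_sum]
  have hterm : ∀ a : Dir C, onCube C ((sgn a (loc C I) * (if a ∈ loc C I then
      (nu (w a.1) (k a.1) : ℂ) else 1)) • contProd (fun a : Dir C => w a.1) (fun a => k a.1)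
        (toggle a (loc C I))) =
      if a.1 ∈ k.support then coeff w k I a.1 • blockForm w Q k (toggle a.1 I) else 0 := by
    intro a
    rw [map_smul, toggle_loc, sgn_loc (subset_mid hC)]
    change _ • formOn w k (toggle a.1 I) C = _
    simp only [mem_loc]
    split_ifs with h1 h2 h2
    · have hk := Finsupp.mem_support_iff.1 h2
      rw [coeff, if_pos h1, intervalEigenvalueSq_eq, if_neg hk, formOn_eq_blockForm hK w hQ.1]
      refine hC.trans ?_
      rw [toggle_of_mem h1]
      congr 1
      ext m
      simp only [Finset.mem_union, Finset.mem_erase]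
      by_cases hm : m = a.1
      · simp [hm, hk]
      · simp [hm]
    · rw [Finsupp.notMem_support_iff] at h2
      simp [nu, h2]
    · have hk := Finsupp.mem_support_iff.1 h2
      rw [coeff, if_neg h1, formOn_eq_blockForm hK w hQ.1]
      refine hC.trans ?_
      rw [toggle_of_notMem h1, Finset.insert_union, Finset.insert_eq_of_mem]
      exact Finset.mem_union_right _ h2
    · rw [Finsupp.notMem_support_iff] at h2
      exact absurd h2 (ne_zero_of_notMem_loc hC a (by rwa [mem_loc]))
  refine (Finset.sum_congr rfl fun a _ => hterm a).trans ?_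
  have he : (∑ a : Dir C, if a.1 ∈ k.support then
      coeff w k I a.1 • blockForm w Q k (toggle a.1 I) else 0) =
      ∑ H ∈ I ∪ k.support,
        if H ∈ k.support then coeff w k I H • blockForm w Q k (toggle H I) else 0 := by
    refine Finset.sum_bij (fun a _ => a.1) (fun a _ => ?_) (fun _ _ _ _ h => Subtype.ext h)
      (fun H hH => ⟨⟨H, hC.symm.subset hH⟩, Finset.mem_univ _, rfl⟩) fun _ _ => rfl
    exact Finset.mem_coe.1 (hC.subset a.2)
  rw [he]
  exact Finset.sum_subset hA fun H _ hH => if_neg fun h => hH (Finset.mem_union_right _ h)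

-- The operator `e_w` accounts for the directions that the cube lacks: they have mode 0 and are not
-- in `I`. The new factor on `D_H` is precisely the mode 0.
include hK hK' in
theorem eOn_smoothProd (hQ : Leads P Q C) (hC : Mid C = ↑(I ∪ k.support))
    (hA : (A : Set K.Hyperplane) = SAH P (vertex Q)) :
    eOn P w C (smoothProd (fun a : Dir C => w a.1) (fun a => k a.1) (loc C I)) =
      ∑ H ∈ A, if H ∉ I ∪ k.support then coeff w k I H • blockForm w Q k (toggle H I) else 0 := by
  rw [eOn, finsum_apply_eq_sum (Step.injective_out hK P C) (hK.range_step_out hK' hQ) (B := A)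
    (by rw [hA]; exact Set.sdiff_subset) _ _
    fun H => coeff w k I H • blockForm w Q k (toggle H I)]
  · refine Finset.sum_congr rfl fun H hH => ?_
    have : H ∈ SAH P (vertex Q) \ Mid C ↔ H ∉ I ∪ k.support := by
      rw [hC, ← hA]
      simp [hH]
    simp only [this]
  · rintro ⟨D, s⟩
    dsimp only
    have hs := s.isSplit hK
    have hH : s.H ∉ I ∪ k.support := fun h => s.notMem_mid (hC.symm.subset h)
    have hHI : s.H ∉ I := fun h => hH (Finset.mem_union_left _ h)
    have hk : k s.H = 0 := Finsupp.notMem_support_iff.1 fun h => hH (Finset.mem_union_right _ h)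
    have hloc : loc C I = restr (dirIncl s.facet.1) (loc D I) := by
      ext a; rw [mem_restr, mem_loc, mem_loc]; rfl
    have hID : ↑I ⊆ Mid D := by
      rw [s.mid_eq hK]; exact (subset_mid hC).trans (Set.subset_insert _ _)
    have hne : ∀ a ∉ restr (dirIncl s.facet.1) (loc D I),
        (fun b : Dir D => k b.1) (dirIncl s.facet.1 a) ≠ 0 := by
      rw [← hloc]; exact fun a ha => ne_zero_of_notMem_loc hC a ha
    have h := hs.eMap_smoothProd (fun a : Dir D => w a.1) (k := fun a => k a.1) (I := loc D I) hk
      (by rwa [mem_loc]) hne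
    have hins : insert (⟨s.H, s.mem_mid⟩ : Dir D) (loc D I) = loc D (toggle s.H I) := by
      rw [← toggle_of_notMem (by rwa [mem_loc])]
      exact toggle_loc I _
    rw [LinearMap.comp_apply, hloc]
    refine (congrArg (onCube D) (h.trans (congrArg (fun J => _ • contProd _ _ J) hins))).trans ?_
    rw [map_smul, sgn_loc hID]
    change _ • formOn w k (toggle s.H I) D = _
    rw [formOn_eq_blockForm hK w (s.leads hK hQ).1, coeff, if_neg hHI, mul_one]
    rw [s.mid_eq hK, hC, toggle_of_notMem hHI, Finset.insert_union, Finset.coe_insert]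

-- The operator `e_w^⋄` accounts for the directions in `I` with mode 0; the fibre integral kills all
-- other modes and drops `H` from the cube.
include hK in
theorem eAdjOn_smoothProd (hQ : Leads P Q C) (hC : Mid C = ↑(I ∪ k.support))
    (hA : I ∪ k.support ⊆ A) :
    eAdjOn P w C (smoothProd (fun a : Dir C => w a.1) (fun a => k a.1) (loc C I)) =
      ∑ H ∈ A, if H ∈ I ∧ H ∉ k.support then
        coeff w k I H • blockForm w Q k (toggle H I) else 0 := by
  classical
  rw [eAdjOn, finsum_apply_eq_sum (Step.injective_in hK P C) (hK.range_step_in hQ) (B := A)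
    (by rw [hC]; exact_mod_cast hA) _ _
    fun H => if H ∈ I ∧ H ∉ k.support then coeff w k I H • blockForm w Q k (toggle H I) else 0]
  · refine Finset.sum_congr rfl fun H hH => ?_
    split_ifs with h1 h2 h2
    · rfl
    · rfl
    · exact absurd (subset_mid hC h2.1) h1
    · rfl
  · rintro ⟨D, s⟩
    dsimp only
    have hs := s.isSplit hK
    have h := hs.eAdjMap_smoothProd (fun a : Dir C => w a.1) (k := fun a => k a.1) (I := loc C I)
      (ne_zero_of_notMem_loc hC)
    rw [LinearMap.comp_apply]
    refine (congrArg (onCube D) h).trans ?_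
    rw [map_smul]
    simp only [mem_loc, Finsupp.mem_support_iff, not_not]
    split_ifs with h1 h2 h3 h3 h3
    · rw [sgn_loc (subset_mid hC), coeff, if_pos h1]
      have hloc : restr (dirIncl s.facet.1) (loc C I) = loc D (toggle s.H I) := by
        ext a
        have hne : a.1 ≠ s.H := fun h => s.notMem_mid (h ▸ a.2)
        rw [mem_restr, mem_loc, mem_loc, mem_toggle_of_ne hne]
        rfl
      rw [hloc]
      change _ • formOn w k (toggle s.H I) D = _
      rw [formOn_eq_blockForm hK w ((s.leads_iff hK).1 hQ).1]
      rw [← Set.insert_sdiff_self_of_notMem s.notMem_mid, ← s.mid_eq hK, hC, toggle_of_mem h1]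
      ext m
      by_cases hm : m = s.H
      · subst hm; simp [h2]
      · simp [hm]
    all_goals simp_all

include hK hK' in
/-- The operator on the product forms that belong to `Q`. -/
theorem mem_graph_blockForm (hA : (A : Set K.Hyperplane) = SAH P (vertex Q))
    (hk : k.support ⊆ A) (hI : I ⊆ A) :
    (blockForm w Q k I, ∑ H ∈ A, coeff w k I H • blockForm w Q k (toggle H I)) ∈
      (deRham P w).graph := by
  classical
  have hS : I ∪ k.support ⊆ A := Finset.union_subset hI hk
  obtain ⟨hC, hQ⟩ := cubeAt_spec hK (P := P) (Q := Q) (S := I ∪ k.support)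
    (by rw [← hA]; exact_mod_cast hS)
  have h := mem_graph_deRham P w (DirectSum.lof ℂ K.Cube (fun C => smoothForm₀ (Dir C))
    (cubeAt Q (I ∪ k.support)) (smoothProd (fun a => w a.1) (fun a => k a.1) (loc _ I)))
  rw [smoothToL2_lof, deRhamMap_lof, smoothToCont_smoothProd (ne_zero_of_notMem_loc hC),
    wittenOn_smoothProd hK w hQ hC hS, eOn_smoothProd hK hK' w hQ hC hA,
    eAdjOn_smoothProd hK w hQ hC hS, ← Finset.sum_add_distrib, ← Finset.sum_add_distrib] at h
  -- Each `H` falls under exactly one of three cases: nonzero mode, mode 0 outside `I`, mode 0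
  -- inside `I`.
  have hsum : ∀ H, ((if H ∈ k.support then coeff w k I H • blockForm w Q k (toggle H I) else 0) +
      (if H ∉ I ∪ k.support then coeff w k I H • blockForm w Q k (toggle H I) else 0)) +
      (if H ∈ I ∧ H ∉ k.support then coeff w k I H • blockForm w Q k (toggle H I) else 0) =
      coeff w k I H • blockForm w Q k (toggle H I) := by
    intro H
    by_cases h1 : H ∈ k.support
    · simp [h1]
    · by_cases h2 : H ∈ I <;> simp [h1, h2]
  simp only [hsum] at h
  exact h

end action

theorem coeff_mul_coeff_self (w : K.Hyperplane → ℝ) (k : K.Hyperplane → ℕ)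
    (I : Finset K.Hyperplane) (H : K.Hyperplane) :
    coeff w k I H * coeff w k (toggle H I) H = intervalEigenvalueSq (w H) (k H) := by
  have hs := sgn_mul_self H I
  by_cases h : H ∈ I
  · simp only [coeff, sgn_toggle, mem_toggle_self, h, if_true, not_true_eq_false, if_false]
    linear_combination (intervalEigenvalueSq (w H) (k H) : ℂ) * hs
  · simp only [coeff, sgn_toggle, mem_toggle_self, h, if_true, not_false_eq_true, if_false]
    linear_combination (intervalEigenvalueSq (w H) (k H) : ℂ) * hs

theorem coeff_mul_coeff (w : K.Hyperplane → ℝ) (k : K.Hyperplane → ℕ)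
    (I : Finset K.Hyperplane) {H L : K.Hyperplane} (h : H ≠ L) :
    coeff w k I H * coeff w k (toggle H I) L = -(coeff w k I L * coeff w k (toggle L I) H) := by
  have hs := sgn_mul_sgn_toggle h I
  simp only [coeff, mem_toggle_of_ne h, mem_toggle_of_ne h.symm]
  linear_combination (if H ∈ I then (intervalEigenvalueSq (w H) (k H) : ℂ) else 1) *
    (if L ∈ I then (intervalEigenvalueSq (w L) (k L) : ℂ) else 1) * hs

/-- The span of the product forms with modes `k` that belong to `Q`. -/
def blockSpan (w : K.Hyperplane → ℝ) (Q : V) (k : K.Hyperplane →₀ ℕ) (A : Finset K.Hyperplane) :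
    Submodule ℂ K.L2Forms :=
  Submodule.span ℂ (blockForm w Q k '' A.powerset)

/-- In the square of the operator the terms for two different directions anticommute and cancel, and
each single direction contributes its scalar. Working with graphs lets linear combinations be formed
without tracking domains. -/
theorem exists_mem_graph_of_mem_blockSpan (hK : K.IsCAT0) (hK' : K.HasBoundedGeometry) {P Q : V}
    (w : K.Hyperplane → ℝ) {k : K.Hyperplane →₀ ℕ} {A : Finset K.Hyperplane}
    (hA : (A : Set K.Hyperplane) = SAH P (vertex Q)) (hk : k.support ⊆ A) {x : K.L2Forms}
    (hx : x ∈ blockSpan w Q k A) : ∃ y ∈ blockSpan w Q k A, (x, y) ∈ (deRham P w).graph ∧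
      (y, ((∑ H ∈ A, intervalEigenvalueSq (w H) (k H) : ℝ) : ℂ) • x) ∈ (deRham P w).graph := by
  induction hx using Submodule.span_induction with
  | mem x hx =>
    obtain ⟨I, hI, rfl⟩ := hx
    have hI' : I ⊆ A := Finset.mem_powerset.1 hI
    refine ⟨_, Submodule.sum_mem _ fun H hH => Submodule.smul_mem _ _ (Submodule.subset_span
      ⟨toggle H I, Finset.mem_powerset.2 (toggle_subset hH hI'), rfl⟩),
      mem_graph_blockForm hK hK' w hA hk hI', ?_⟩
    have h : ∑ H ∈ A, coeff w k I H • (blockForm w Q k (toggle H I),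
        ∑ L ∈ A, coeff w k (toggle H I) L • blockForm w Q k (toggle L (toggle H I))) ∈
        (deRham P w).graph :=
      Submodule.sum_mem _ fun H hH => Submodule.smul_mem _ _
        (mem_graph_blockForm hK hK' w hA hk (toggle_subset hH hI'))
    convert h using 1
    refine Prod.ext ?_ ?_
    · simp [Prod.fst_sum]
    · simp only [Prod.snd_sum, Prod.smul_snd, Finset.smul_sum, smul_smul]
      rw [sum_sum_eq_sum_diag A fun H L => (coeff w k I H * coeff w k (toggle H I) L) •
        blockForm w Q k (toggle L (toggle H I))]
      · simp only [coeff_mul_coeff_self, toggle_involutive _ I]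
        rw [← Finset.sum_smul, Complex.ofReal_sum]
      · intro H L hHL
        rw [coeff_mul_coeff w k I hHL, toggle_comm, neg_smul]
  | zero => exact ⟨0, Submodule.zero_mem _, Submodule.zero_mem _, by
      rw [smul_zero]; exact Submodule.zero_mem _⟩
  | add x x' _ _ ih ih' =>
    obtain ⟨y, hy, h1, h2⟩ := ih
    obtain ⟨y', hy', h1', h2'⟩ := ih'
    exact ⟨y + y', Submodule.add_mem _ hy hy', Submodule.add_mem _ h1 h1', by
      rw [smul_add]; exact Submodule.add_mem _ h2 h2'⟩
  | smul c x _ ih =>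
    obtain ⟨y, hy, h1, h2⟩ := ih
    exact ⟨c • y, Submodule.smul_mem _ _ hy, Submodule.smul_mem _ c h1, by
      rw [smul_comm]; exact Submodule.smul_mem _ c h2⟩

end CubicalComplex

end

noncomputable section

set_option linter.unusedSectionVars false

/-! ### Orthogonality and completeness of the blocks, finiteness of the low spectrum -/

namespace CubicalComplex

open CubeForm

variable {V : Type*} {K : CubicalComplex V}

/-- Forms on different cubes are orthogonal. The same cube forces `Q = Q'`, and the modes, which
vanish off the cube, must then differ in one of its directions. -/
theorem inner_blockForm_eq_zero (hK : K.IsCAT0) {P Q Q' : V} (w : K.Hyperplane → ℝ)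
    {k k' : K.Hyperplane →₀ ℕ} {I I' : Finset K.Hyperplane}
    (hS : ↑(I ∪ k.support) ⊆ SAH P (vertex Q : K.Cube))
    (hS' : ↑(I' ∪ k'.support) ⊆ SAH P (vertex Q' : K.Cube)) (hne : Q = Q' → k ≠ k') :
    inner ℂ (blockForm w Q k I) (blockForm w Q' k' I') = 0 := by
  obtain ⟨hC, hQ⟩ := cubeAt_spec hK hS
  obtain ⟨hC', hQ'⟩ := cubeAt_spec hK hS'
  unfold blockForm
  generalize (cubeAt Q (I ∪ k.support) : K.Cube) = C at *
  generalize (cubeAt Q' (I' ∪ k'.support) : K.Cube) = C' at *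
  by_cases h : C = C'
  · subst h
    have hQQ := hK.leads_unique hQ hQ'
    rw [formOn, formOn, inner_onCube_same]
    refine inner_contProd_eq_zero (ne_zero_of_notMem_loc hC) (ne_zero_of_notMem_loc hC') fun h => ?_
    refine hne hQQ (Finsupp.ext fun H => ?_)
    by_cases hH : H ∈ Mid C
    · exact congrFun h ⟨H, hH⟩
    · have h1 : H ∉ k.support := fun h => hH (hC.symm.subset (Finset.mem_union_right _ h))
      have h2 : H ∉ k'.support := fun h => hH (hC'.symm.subset (Finset.mem_union_right _ h))
      rw [Finsupp.notMem_support_iff.1 h1, Finsupp.notMem_support_iff.1 h2]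
  · exact inner_onCube_of_ne h _ _

/-- Every product form that satisfies the boundary conditions belongs to a vertex. -/
theorem exists_blockForm_eq (hK : K.IsCAT0) (P : V) (w : K.Hyperplane → ℝ) (C : K.Cube)
    (k : Dir C → ℕ) (I : Finset (Dir C)) (hI : ∀ a ∉ I, k a ≠ 0) :
    ∃ (Q : V) (k' : K.Hyperplane →₀ ℕ) (I' : Finset K.Hyperplane),
      ↑(I' ∪ k'.support) ⊆ SAH P (vertex Q : K.Cube) ∧
      blockForm w Q k' I' = onCube C (contProd (fun a => w a.1) k I) := by
  obtain ⟨Q, hQ⟩ := hK.exists_leads P C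
  let j : Dir C ↪ K.Hyperplane := Function.Embedding.subtype _
  let k' : K.Hyperplane →₀ ℕ := Finsupp.embDomain j (Finsupp.equivFunOnFinite.symm k)
  have hk' : ∀ a : Dir C, k' a.1 = k a := fun a =>
    Finsupp.embDomain_apply_self j (Finsupp.equivFunOnFinite.symm k) a
  have hmid : Mid C = ↑(I.map j ∪ k'.support) := by
    ext H
    simp only [k', Finsupp.support_embDomain, ← Finset.map_union, Finset.mem_coe, Finset.mem_map]
    constructor
    · intro hH
      refine ⟨⟨H, hH⟩, ?_, rfl⟩
      by_cases h : (⟨H, hH⟩ : Dir C) ∈ I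
      · exact Finset.mem_union_left _ h
      · exact Finset.mem_union_right _ (Finsupp.mem_support_iff.2 (hI _ h))
    · rintro ⟨a, _, rfl⟩
      exact a.2
  refine ⟨Q, k', I.map j, hmid ▸ hQ.2, ?_⟩
  rw [← formOn_eq_blockForm hK w hQ.1 hmid, formOn]
  have h1 : (fun a : Dir C => k' a.1) = k := funext hk'
  have h2 : loc C (I.map j) = I := by
    ext a
    rw [mem_loc]
    exact Finset.mem_map' j
  rw [h1, h2]

open Classical in
theorem eq_top_of_blockForm_mem (hK : K.IsCAT0) (P : V) {w : K.Hyperplane → ℝ} (hw : IsWeight w)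
    {M : Submodule ℂ K.L2Forms} (hM : IsClosed (M : Set K.L2Forms))
    (h : ∀ (Q : V) (k : K.Hyperplane →₀ ℕ) (I : Finset K.Hyperplane),
      ↑(I ∪ k.support) ⊆ SAH P (vertex Q : K.Cube) → blockForm w Q k I ∈ M) : M = ⊤ := by
  have hC : ∀ C : K.Cube,
      M.comap (lp.lsingle (𝕜 := ℂ) (E := fun C : K.Cube => L2Form (Dir C)) 2 C) = ⊤ := by
    intro C
    refine eq_top_of_contProd_mem (c := fun a : Dir C => w a.1) (fun a => hw a.1)
      (hM.preimage (lp.isometry_single C).continuous) fun k I hI => ?_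
    obtain ⟨Q, k', I', hS, he⟩ := exists_blockForm_eq hK P w C k I hI
    have := h Q k' I' hS
    rw [he] at this
    exact this
  refine eq_top_iff.2 fun v _ => ?_
  refine hM.mem_of_tendsto (lp.hasSum_single (by norm_num) v) (Filter.Eventually.of_forall
    fun s => Submodule.sum_mem _ fun C _ => ?_)
  have : v C ∈ M.comap (lp.lsingle (𝕜 := ℂ) (E := fun C : K.Cube => L2Form (Dir C)) 2 C) := by
    rw [hC]; trivial
  exact this

theorem intervalEigenvalueSq_nonneg {c : ℝ} (hc : 0 < c) (k : ℕ) :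
    0 ≤ intervalEigenvalueSq c k := by
  unfold intervalEigenvalueSq
  split_ifs
  · have : Real.exp (-2 * c) ≤ 1 := Real.exp_le_one_iff.2 (by linarith)
    have : 0 ≤ c * (1 - Real.exp (-2 * c)) := mul_nonneg hc.le (by linarith)
    linarith
  · positivity

/-- For `c > 1` the exponential is at most 1/2, so the entry with `k = 0` is at least `c / 4`; every
other entry is at least `c ^ 2`. -/
theorem le_of_intervalEigenvalueSq_le {c M : ℝ} (hc : 0 < c) {k : ℕ}
    (h : intervalEigenvalueSq c k ≤ M) : c ≤ 1 + 4 * M := by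
  have hM : 0 ≤ M := (intervalEigenvalueSq_nonneg hc k).trans h
  by_contra! hlt
  have h1 : 1 < c := by linarith
  unfold intervalEigenvalueSq at h
  split_ifs at h
  · have h2 : 2 ≤ Real.exp (2 * c) := by linarith [Real.add_one_le_exp (2 * c)]
    have h3 : Real.exp (-2 * c) ≤ 1 / 2 := by
      rw [neg_mul, Real.exp_neg, ← one_div]
      exact one_div_le_one_div_of_le two_pos h2
    nlinarith
  · nlinarith [sq_nonneg (Real.pi * k)]

theorem natCast_le_of_intervalEigenvalueSq_le {c M : ℝ} {k : ℕ}
    (h : intervalEigenvalueSq c k ≤ M) (hM : 0 ≤ M) : (k : ℝ) ≤ M := by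
  by_cases hk : k = 0
  · simpa [hk] using hM
  · rw [intervalEigenvalueSq, if_neg hk] at h
    have h1 : (1 : ℝ) ≤ k := by exact_mod_cast Nat.one_le_iff_ne_zero.2 hk
    have h2 : (1 : ℝ) ≤ Real.pi ^ 2 := by nlinarith [Real.pi_gt_three]
    nlinarith [sq_nonneg c, mul_le_mul h2 (le_refl ((k : ℝ) ^ 2)) (sq_nonneg _) (by positivity)]

/-- The vertices together with modes in the hyperplanes that are adjacent to them and separate
them from `P`. -/
abbrev BlockIndex (K : CubicalComplex V) (P : V) : Type _ :=
  Σ Q : V, {k : K.Hyperplane →₀ ℕ // ↑k.support ⊆ SAH P (vertex Q : K.Cube)}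

/-- All summands are nonnegative, so each is at most `M`. Hence the hyperplanes in SAH(`Q`) have
weight at most `1 + 4 * M` and, by properness, come from a fixed finite set; the modes are bounded
as well, and `Q` is recovered from SAH(`Q`). -/
theorem finite_sum_intervalEigenvalueSq_le (hK : K.IsCAT0) {P : V} {w : K.Hyperplane → ℝ}
    (hw : IsWeight w) (hw' : IsProperWeight w) (A : V → Finset K.Hyperplane)
    (hA : ∀ Q, (A Q : Set K.Hyperplane) = SAH P (vertex Q)) (M : ℝ) :
    {a : BlockIndex K P | ∑ H ∈ A a.1, intervalEigenvalueSq (w H) (a.2.1 H) ≤ M}.Finite := by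
  by_cases hM : 0 ≤ M
  swap
  · convert Set.finite_empty
    refine Set.eq_empty_of_forall_notMem fun a ha => hM (le_trans ?_ ha)
    exact Finset.sum_nonneg fun H _ => intervalEigenvalueSq_nonneg (hw H) _
  have hF := hw' (1 + 4 * M) (by positivity)
  obtain ⟨N, hN⟩ := exists_nat_ge M
  -- All admissible mode functions lie below this one function of finite support, and only finitely
  -- many do.
  let b : K.Hyperplane →₀ ℕ := Finsupp.indicator hF.toFinset fun _ _ => N
  let φ : BlockIndex K P → Set K.Hyperplane × (K.Hyperplane →₀ ℕ) :=
    fun a => (SAH P (vertex a.1), a.2.1)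
  have hφ : Function.Injective φ := by
    rintro ⟨Q, k, hk⟩ ⟨Q', k', hk'⟩ h
    obtain rfl : Q = Q' := hK.sah_vertex_injective P (congrArg Prod.fst h)
    obtain rfl : k = k' := congrArg Prod.snd h
    rfl
  refine ((hF.finite_subsets.prod (Set.finite_Iic b)).preimage hφ.injOn).subset fun a ha => ?_
  have hle : ∀ H ∈ SAH P (vertex a.1 : K.Cube), intervalEigenvalueSq (w H) (a.2.1 H) ≤ M := by
    intro H hH
    rw [← hA] at hH
    exact (Finset.single_le_sum (f := fun H => intervalEigenvalueSq (w H) (a.2.1 H))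
      (fun H _ => intervalEigenvalueSq_nonneg (hw H) _) hH).trans ha
  have hsub : SAH P (vertex a.1 : K.Cube) ⊆ {H | w H ≤ 1 + 4 * M} := fun H hH =>
    le_of_intervalEigenvalueSq_le (hw H) (hle H hH)
  refine ⟨hsub, fun H => ?_⟩
  by_cases hH : H ∈ a.2.1.support
  · have hH' := a.2.2 hH
    have h1 : b H = N := Finsupp.indicator_of_mem (hF.mem_toFinset.2 (hsub hH')) _
    rw [h1]
    exact_mod_cast (natCast_le_of_intervalEigenvalueSq_le (hle H hH') hM).trans hN
  · rw [Finsupp.notMem_support_iff.1 hH]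
    exact Nat.zero_le _

end CubicalComplex

end

/-! ### The main theorem -/

open CubicalComplex in
theorem mainTheorem6 {V : Type*} (K : CubicalComplex V) (hK : K.IsCAT0)
    (hK' : K.HasBoundedGeometry) (P : V) (w : K.Hyperplane → ℝ)
    (hw : CubicalComplex.IsWeight w) (hw' : CubicalComplex.IsProperWeight w) :
    UnboundedOp.IsEssentiallySelfAdjoint (CubicalComplex.deRham P w) ∧
    UnboundedOp.HasCompactResolvent (CubicalComplex.deRham P w).closure ∧
    ∃ B : Set K.L2Forms, Orthonormal ℂ (fun b : B => (b : K.L2Forms)) ∧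
      (Submodule.span ℂ B).topologicalClosure = ⊤ ∧
      ∀ b ∈ B, ∃ Q : V, b ∈ CubicalComplex.block P Q ∧
        ∃ (hb : b ∈ (CubicalComplex.deRham P w).domain) (l : ℝ),
          CubicalComplex.deRham P w ⟨b, hb⟩ = (l : ℂ) • b ∧
          ∃ k : K.Hyperplane → ℕ,
            l ^ 2 = ∑ᶠ H ∈ CubicalComplex.SAH P (CubicalComplex.vertex Q),
              CubicalComplex.intervalEigenvalueSq (w H) (k H) := by
  let A : V → Finset K.Hyperplane := fun Q => (hK'.finite_sah hK P Q).toFinset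
  have hA : ∀ Q, (A Q : Set K.Hyperplane) = SAH P (vertex Q) := fun Q =>
    (hK'.finite_sah hK P Q).coe_toFinset
  let W : BlockIndex K P → Submodule ℂ K.L2Forms := fun a => blockSpan w a.1 a.2.1 (A a.1)
  have hk : ∀ a : BlockIndex K P, a.2.1.support ⊆ A a.1 := fun a =>
    Finset.coe_subset.1 (a.2.2.trans (hA a.1).symm.subset)
  have hS : ∀ (a : BlockIndex K P) I, I ∈ (A a.1).powerset →
      ↑(I ∪ a.2.1.support) ⊆ SAH P (vertex a.1 : K.Cube) := by
    intro a I hI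
    refine subset_trans (Finset.coe_subset.2 ?_) (hA a.1).subset
    exact Finset.union_subset (Finset.mem_powerset.1 hI) (hk a)
  have hfd : ∀ a, FiniteDimensional ℂ (W a) := fun a =>
    FiniteDimensional.span_of_finite ℂ ((Finset.finite_toSet _).image _)
  have hgraph := fun a x (hx : x ∈ W a) =>
    exists_mem_graph_of_mem_blockSpan hK hK' w (hA a.1) (hk a) hx
  have hdom : ∀ a, W a ≤ (deRham P w).domain := fun a x hx => by
    obtain ⟨y, _, h, _⟩ := hgraph a x hx
    exact LinearPMap.mem_domain_of_mem_graph h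
  have heq : ∀ {x y : K.L2Forms} (hx : x ∈ (deRham P w).domain), (x, y) ∈ (deRham P w).graph →
      deRham P w ⟨x, hx⟩ = y := by
    intro x y hx h
    exact ((deRham P w).image_iff hx).2 h |>.symm
  have hinv : ∀ a, ∀ x (hx : x ∈ W a), deRham P w ⟨x, hdom a hx⟩ ∈ W a := by
    intro a x hx
    obtain ⟨y, hy, h, _⟩ := hgraph a x hx
    rwa [heq _ h]
  obtain ⟨h1, h2, B, hB, hB', hB''⟩ := UnboundedOp.exists_eigenbasis_of_blocks (deRham P w)
    (inner_deRham hK hK' P w) W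
    (fun a => ∑ H ∈ A a.1, intervalEigenvalueSq (w H) (a.2.1 H)) hdom hinv
    (fun a x hx => by
      obtain ⟨y, hy, h, h'⟩ := hgraph a x hx
      exact heq _ (by rwa [heq _ h]))
    (fun a a' hne x hx y hy => by
      refine Submodule.isOrtho_iff_inner_eq.1 (Submodule.isOrtho_span.2 ?_) x hx y hy
      rintro _ ⟨I, hI, rfl⟩ _ ⟨I', hI', rfl⟩
      refine inner_blockForm_eq_zero hK w (hS a I hI) (hS a' I' hI') fun hQ hkk => hne ?_
      obtain ⟨Q, k, hk⟩ := a
      obtain ⟨Q', k', hk'⟩ := a'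
      obtain rfl : Q = Q' := hQ
      obtain rfl : k = k' := hkk
      rfl)
    (eq_top_of_blockForm_mem hK P hw (Submodule.isClosed_topologicalClosure _) fun Q k I hI => by
      refine Submodule.le_topologicalClosure _ ?_
      rw [Finset.coe_union, Set.union_subset_iff] at hI
      refine Submodule.mem_iSup_of_mem ⟨Q, k, hI.2⟩ (Submodule.subset_span ⟨I, ?_, rfl⟩)
      have := hI.1
      rw [← hA] at this
      exact Finset.mem_coe.2 (Finset.mem_powerset.2 (by exact_mod_cast this)))
    (finite_sum_intervalEigenvalueSq_le hK hw hw' A hA)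
  refine ⟨h1, h2, B, hB, hB', fun b hb => ?_⟩
  obtain ⟨a, hba, hdomb, l, hl, hl2⟩ := hB'' b hb
  refine ⟨a.1, ?_, hdomb, l, hl, a.2.1, ?_⟩
  -- Each generator is supported on the single cube `cubeAt`, which leads the vertex to `P`.
  · refine (Submodule.span_le.2 ?_ : W a ≤ block P a.1) hba
    rintro _ ⟨I, hI, rfl⟩ C hC
    refine onCube_apply_of_ne ?_ _
    rintro rfl
    exact hC (cubeAt_spec hK (hS a I hI)).2
  · rw [hl2, finsum_mem_eq_finite_toFinset_sum _ (hK'.finite_sah hK P a.1)]
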